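/- Let $\alpha:\mathbb M\to\mathbb R^3$ be an immersion of class $C^r$, $r\ge 6$, of an oriented smooth surface, with positive unit normal $N$, Gaussian curvature $\mathcal K$ and arithmetic mean curvature $\mathcal H$. A *harmonic mean curvature line* of an immersion is a regular curve in the set of non-umbilic points with $\mathcal K>0$ along which the normal curvature equals $\mathcal K/\mathcal H$; it is *maximal* if its geodesic torsion $\tau_g$ is positive. The maximal lines are the leaves of a foliation of that set; a *maximal harmonic mean curvature cycle* is a closed leaf of it, and it is *hyperbolic* if its first return map, defined on a cross section normal to the cycle by following the leaves until they meet the section again, has derivative different from $1$ at the fixed point. Let $c$ be a maximal harmonic mean curvature cycle of $\alpha$, parametrized by arc length $s$ and of length $L$; write $T(s)$, $N(s)$, $\tau_g(s)$, $\mathcal H(s)$, $\frac{\mathcal K}{\mathcal H}(s)$ for the unit tangent, the normal, the geodesic torsion and the curvatures along $c$. Let $(s,v)$, $s\in\mathbb R/L\mathbb Z$, $|v|<\eta$, be a chart of class $C^{r-5}$ in a neighborhood of $c$, with $c=\{v=0\}$, in which $$\alpha(s,v)=\alpha(c(s))+v\,(N\wedge T)(s)+\Big[\big(2\mathcal H(s)-\tfrac{\mathcal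 K}{\mathcal H}(s)\big)\tfrac{v^2}{2}+\tfrac{A(s)}{6}v^3+v^3B(s,v)\Big]N(s),\qquad B(s,0)=0,$$ with $A$ of class $C^{r-5}$ and $B$ continuous. Then there is $\eta_0\in(0,\eta]$ such that the following holds for every $C^r$ function $\delta:\mathbb R\to\mathbb R$ with support in $(-\eta_0,\eta_0)$ and $\delta=1$ in a neighborhood of $0$, and for $A_1=\mu\,\tau_g$ with any constant $\mu>0$. Define $\beta_\epsilon:\mathbb M\to\mathbb R^3$ by $$\beta_\epsilon(s,v)=\alpha(s,v)+\epsilon\,\frac{A_1(s)}{6}v^3\,\delta(v)\,N(s)$$ in the chart and $\beta_\epsilon=\alpha$ outside its domain. There is $\epsilon_0>0$ such that for all $\epsilon$ with $|\epsilon|<\epsilon_0$ the map $\beta_\epsilon$ is an immersion of class $C^{r-2}$, $c$ is a maximal harmonic mean curvature cycle of $\beta_\epsilon$ (of the same length $L$ and again parametrized by arc length), and, if $\epsilon\neq 0$, $c$ is a hyperbolic harmonic mean curvature cycle of $\beta_\epsilon$. -/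

import Mathlib

open Set Filter Topology
open scoped Manifold ContDiff

namespace HarmonicMC

/-- The parameter plane. -/
abbrev Plane := EuclideanSpace ℝ (Fin 2)

/-- Euclidean 3-space. -/
abbrev Space := EuclideanSpace ℝ (Fin 3)

noncomputable section

/-- The vector product `x ∧ y` of Euclidean 3-space with its standard orientation. -/
def vec (x y : Space) : Space :=
  WithLp.toLp 2 (crossProduct (WithLp.ofLp x) (WithLp.ofLp y))

/-- The coordinate directions `∂/∂u`, `∂/∂v` of the parameter plane. -/
def dir (j : Fin 2) : Plane := EuclideanSpace.single j 1

/-! ### Parametrized surfaces `F : Plane → Space` -/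

/-- The positive unit normal `F_u ∧ F_v / |F_u ∧ F_v|`. -/
def patchNormal (F : Plane → Space) (y : Plane) : Space :=
  (‖vec (fderiv ℝ F y (dir 0)) (fderiv ℝ F y (dir 1))‖)⁻¹ •
    vec (fderiv ℝ F y (dir 0)) (fderiv ℝ F y (dir 1))

/-- The first fundamental form `⟨DF, DF⟩`. -/
def firstForm (F : Plane → Space) (y u w : Plane) : ℝ :=
  inner ℝ (fderiv ℝ F y u) (fderiv ℝ F y w)

/-- The second fundamental form `⟨N, D²F⟩`. -/
def secondForm (F : Plane → Space) (y u w : Plane) : ℝ :=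
  inner ℝ (patchNormal F y) (fderiv ℝ (fderiv ℝ F) y u w)

/-- The discriminant `EG - F²` of the first fundamental form. -/
def firstDet (F : Plane → Space) (y : Plane) : ℝ :=
  firstForm F y (dir 0) (dir 0) * firstForm F y (dir 1) (dir 1)
    - firstForm F y (dir 0) (dir 1) ^ 2

/-- The Gaussian curvature `(eg - f²) / (EG - F²)`. -/
def patchGauss (F : Plane → Space) (y : Plane) : ℝ :=
  (secondForm F y (dir 0) (dir 0) * secondForm F y (dir 1) (dir 1)
    - secondForm F y (dir 0) (dir 1) ^ 2) / firstDet F y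

/-- The arithmetic mean curvature `(eG - 2fF + gE) / (2 (EG - F²))`. -/
def patchMean (F : Plane → Space) (y : Plane) : ℝ :=
  (secondForm F y (dir 0) (dir 0) * firstForm F y (dir 1) (dir 1)
    - 2 * secondForm F y (dir 0) (dir 1) * firstForm F y (dir 0) (dir 1)
    + secondForm F y (dir 1) (dir 1) * firstForm F y (dir 0) (dir 0)) / (2 * firstDet F y)

/-- The normal curvature `II(u, u) / I(u, u)` in the direction `u`. -/
def patchNormalCurvature (F : Plane → Space) (y u : Plane) : ℝ :=
  secondForm F y u u / firstForm F y u u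

/-- The geodesic torsion in the direction `u`: along a curve with unit tangent `T` the Darboux
equation is `N' = - k_n T - τ_g (N ∧ T)`, so that `τ_g = - ⟨N', N ∧ T⟩`. The quotient by `I(u, u)`
normalizes `u` to unit length. -/
def patchTorsion (F : Plane → Space) (y u : Plane) : ℝ :=
  - inner ℝ (fderiv ℝ (patchNormal F) y u) (vec (patchNormal F y) (fderiv ℝ F y u))
    / firstForm F y u u

/-! ### Immersed surfaces `f : M → Space` -/

/-- The atlas of the surface is oriented: all coordinate changes preserve the orientation of the
plane. Charts of the atlas are the positive charts. -/
class OrientedAtlas (M : Type*) [TopologicalSpace M] [ChartedSpace Plane M] : Prop where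
  det_pos : ∀ e ∈ atlas Plane M, ∀ e' ∈ atlas Plane M, ∀ x ∈ (e.symm.trans e').source,
    0 < (fderiv ℝ (e.symm.trans e') x).det

variable {M : Type*} [TopologicalSpace M] [ChartedSpace Plane M]

/-- `f` is an immersion of class `C^n`: the derivative is injective at every point. -/
def IsImmersionOfClass (n : ℕ) (f : M → Space) : Prop :=
  ContMDiff (𝓡 2) 𝓘(ℝ, Space) n f ∧
    ∀ p, Function.Injective (mfderiv (𝓡 2) 𝓘(ℝ, Space) f p)

/-- The expression of `f` in the preferred positive chart at `p`. -/
def patch (f : M → Space) (p : M) : Plane → Space := f ∘ (extChartAt (𝓡 2) p).symm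

/-- The coordinates of `p` in the preferred chart at `p`. -/
def coord (p : M) : Plane := extChartAt (𝓡 2) p p

/-- The positive unit normal `N(p)` of the immersion `f`. -/
def unitNormal (f : M → Space) (p : M) : Space := patchNormal (patch f p) (coord p)

/-- The Gaussian curvature `𝒦(p)`. -/
def gauss (f : M → Space) (p : M) : ℝ := patchGauss (patch f p) (coord p)

/-- The arithmetic mean curvature `ℋ(p)`. -/
def mean (f : M → Space) (p : M) : ℝ := patchMean (patch f p) (coord p)

/-- The harmonic mean curvature `𝒦/ℋ`. -/
def harmonicMean (f : M → Space) (p : M) : ℝ := gauss f p / mean f p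

/-- The velocity of a curve in `M`, a vector of `T_{γ(t)} M`; Mathlib identifies this tangent space
with the plane through the preferred chart at `γ(t)`. -/
def velocity (γ : ℝ → M) (t : ℝ) : Plane :=
  (mfderiv 𝓘(ℝ, ℝ) (𝓡 2) γ t : ℝ →L[ℝ] Plane) 1

/-- The normal curvature of `f` along the curve `γ`. -/
def normalCurvature (f : M → Space) (γ : ℝ → M) (t : ℝ) : ℝ :=
  patchNormalCurvature (patch f (γ t)) (coord (γ t)) (velocity γ t)

/-- The geodesic torsion of `f` along the curve `γ`. -/
def geodesicTorsion (f : M → Space) (γ : ℝ → M) (t : ℝ) : ℝ :=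
  patchTorsion (patch f (γ t)) (coord (γ t)) (velocity γ t)

/-- The two harmonic mean curvature foliations. -/
inductive Family
  | minimal
  | maximal

/-- The sign of the geodesic torsion along the leaves of each of the two foliations. -/
def Family.HasSign : Family → ℝ → Prop
  | .minimal, τ => τ < 0
  | .maximal, τ => 0 < τ

/-- The restriction of `γ` to the (open) set `J` is a curve of the harmonic mean curvature foliation
`i` of `f`: a regular curve in the complement of the umbilic points in the elliptic region `𝒦 > 0`,
along which `k_n = 𝒦/ℋ` and the geodesic torsion has the sign that belongs to `i`. -/
structure IsHarmonicLineOn (i : Family) (f : M → Space) (γ : ℝ → M) (J : Set ℝ) : Prop where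
  contMDiffOn : ContMDiffOn 𝓘(ℝ, ℝ) (𝓡 2) 1 γ J
  regular : ∀ t ∈ J, velocity γ t ≠ 0
  elliptic : ∀ t ∈ J, 0 < gauss f (γ t)
  nonumbilic : ∀ t ∈ J, mean f (γ t) ^ 2 - gauss f (γ t) ≠ 0
  normalCurvature_eq : ∀ t ∈ J, normalCurvature f γ t = harmonicMean f (γ t)
  torsion_sign : ∀ t ∈ J, i.HasSign (geodesicTorsion f γ t)

/-- `c` is a harmonic mean curvature cycle of `f` that belongs to the foliation `i`, parametrized by
arc length and of length `L`: a simple closed leaf. -/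
structure IsHarmonicCycle (i : Family) (f : M → Space) (c : ℝ → M) (L : ℝ) : Prop where
  length_pos : 0 < L
  line : IsHarmonicLineOn i f c univ
  arcLength : ∀ s, ‖deriv (f ∘ c) s‖ = 1
  periodic : Function.Periodic c L
  simple : InjOn c (Ico 0 L)

/-- `σ : [-a, a] → M` is a cross section normal to the closed curve `c` at `c(0)`, which meets `c`
at that point only. -/
structure IsCrossSection (f : M → Space) (c : ℝ → M) (a : ℝ) (σ : ℝ → M) : Prop where
  pos : 0 < a
  contMDiffOn : ContMDiffOn 𝓘(ℝ, ℝ) (𝓡 2) 1 σ (Icc (-a) a)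
  injOn : InjOn σ (Icc (-a) a)
  base : σ 0 = c 0
  regular : velocity σ 0 ≠ 0
  normal : inner ℝ (deriv (f ∘ σ) 0) (deriv (f ∘ c) 0) = 0
  meets_once : ∀ s, c s ∈ σ '' Icc (-a) a → c s = c 0

/-- `π` is, near `0`, the return map of the cycle `c` on the cross section `σ`: the leaf of the
foliation `i` that starts at `σ(v)` in the direction of `c` meets the section again, for the first
time, at `σ(π(v))`. -/
def IsReturnMap (i : Family) (f : M → Space) (c : ℝ → M) (a : ℝ) (σ : ℝ → M) (π : ℝ → ℝ) : Prop :=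
  ∀ᶠ v in 𝓝 (0 : ℝ), ∃ (T : ℝ) (J : Set ℝ) (γ : ℝ → M),
    0 < T ∧ IsOpen J ∧ Icc 0 T ⊆ J ∧ IsHarmonicLineOn i f γ J ∧
    γ 0 = σ v ∧ 0 < inner ℝ (deriv (f ∘ γ) 0) (deriv (f ∘ c) 0) ∧
    (∀ t ∈ Ioo 0 T, γ t ∉ σ '' Icc (-a) a) ∧
    π v ∈ Icc (-a) a ∧ γ T = σ (π v)

/-- `c` is a hyperbolic harmonic mean curvature cycle: its return map has at the fixed point a
derivative that is different from one. -/
def IsHyperbolicCycle (i : Family) (f : M → Space) (c : ℝ → M) (L : ℝ) : Prop :=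
  IsHarmonicCycle i f c L ∧ ∃ (a : ℝ) (σ : ℝ → M) (π : ℝ → ℝ) (d : ℝ),
    IsCrossSection f c a σ ∧ IsReturnMap i f c a σ π ∧ HasDerivAt π d 0 ∧ d ≠ 1

/-- The unit tangent `T(s)` of a curve parametrized by arc length. -/
def tangent (f : M → Space) (c : ℝ → M) (s : ℝ) : Space := deriv (f ∘ c) s

/-- The adapted chart `(s, v)`, `s ∈ ℝ / Lℤ`, `|v| < η`, of class `C^k` in a neighborhood of the
cycle `c`; `X` is the inverse of the chart, lifted to a map that is `L`-periodic in `s`. In it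
`α(s,v) = c(s) + v (N ∧ T)(s) + [(2ℋ - 𝒦/ℋ)(s) v²/2 + A(s) v³/6 + v³ B(s,v)] N(s)`, `B(s,0) = 0`. -/
structure IsAdaptedChart (k : ℕ) (α : M → Space) (c : ℝ → M) (L η : ℝ) (X : ℝ × ℝ → M) :
    Prop where
  pos : 0 < η
  localDiffeo : IsLocalDiffeomorphOn 𝓘(ℝ, ℝ × ℝ) (𝓡 2) k X (univ ×ˢ Ioo (-η) η)
  periodic : ∀ s, ∀ v ∈ Ioo (-η) η, X (s + L, v) = X (s, v)
  inj : ∀ s s', ∀ v ∈ Ioo (-η) η, ∀ v' ∈ Ioo (-η) η, X (s, v) = X (s', v') →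
    v = v' ∧ ∃ m : ℤ, s' = s + m * L
  axis : ∀ s, X (s, 0) = c s
  form : ∃ (A : ℝ → ℝ) (B : ℝ × ℝ → ℝ), ContDiff ℝ k A ∧
    ContinuousOn B (univ ×ˢ Ioo (-η) η) ∧ (∀ s, B (s, 0) = 0) ∧
    ∀ s, ∀ v ∈ Ioo (-η) η,
      α (X (s, v)) = α (c s) + v • vec (unitNormal α (c s)) (tangent α c s)
        + ((2 * mean α (c s) - harmonicMean α (c s)) * (v ^ 2 / 2) + A s / 6 * v ^ 3
            + v ^ 3 * B (s, v)) • unitNormal α (c s)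

/-- The deformation `β_ε : M → Space` of `α`. In the chart it is
`β_ε(s,v) = α(s,v) + ε (A₁(s)/6) v³ δ(v) N(s)`, and it agrees with `α` off the domain of the
chart (`Function.extend` extends by zero from the domain). -/
def deformation (α : M → Space) (c : ℝ → M) (η : ℝ) (X : ℝ × ℝ → M) (A₁ δ : ℝ → ℝ) (ε : ℝ)
    (p : M) : Space :=
  α p + ε • Function.extend (fun x : {x : ℝ × ℝ // x.2 ∈ Ioo (-η) η} => X x.1)
    (fun x => (A₁ x.1.1 / 6 * x.1.2 ^ 3 * δ x.1.2) • unitNormal α (c x.1.1)) 0 p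

/-- The deformation in the chart. -/
theorem deformation_chart {k : ℕ} {α : M → Space} {c : ℝ → M} {L η : ℝ} {X : ℝ × ℝ → M}
    (hX : IsAdaptedChart k α c L η X) (hc : Function.Periodic c L) {A₁ : ℝ → ℝ}
    (hA : Function.Periodic A₁ L) (δ : ℝ → ℝ) (ε s v : ℝ) (hv : v ∈ Ioo (-η) η) :
    deformation α c η X A₁ δ ε (X (s, v)) =
      α (X (s, v)) + ε • ((A₁ s / 6 * v ^ 3 * δ v) • unitNormal α (c s)) := by
  have key : Function.FactorsThrough
      (fun x : {x : ℝ × ℝ // x.2 ∈ Ioo (-η) η} =>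
        (A₁ x.1.1 / 6 * x.1.2 ^ 3 * δ x.1.2) • unitNormal α (c x.1.1))
      (fun x : {x : ℝ × ℝ // x.2 ∈ Ioo (-η) η} => X x.1) := by
    rintro ⟨⟨s₁, v₁⟩, h₁⟩ ⟨⟨s₂, v₂⟩, h₂⟩ h
    obtain ⟨hv, m, hm⟩ := hX.inj s₁ s₂ v₁ h₁ v₂ h₂ h
    simp only
    rw [hm, ← hv, hA.int_mul m s₁, hc.int_mul m s₁]
  have := key.extend_apply (0 : M → Space) ⟨(s, v), hv⟩
  simp only at this
  rw [deformation, this]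

/-- The deformation off the chart. -/
theorem deformation_off {α : M → Space} {c : ℝ → M} {η : ℝ} {X : ℝ × ℝ → M} {A₁ : ℝ → ℝ}
    (δ : ℝ → ℝ) (ε : ℝ) (p : M) (hp : ∀ s, ∀ v ∈ Ioo (-η) η, X (s, v) ≠ p) :
    deformation α c η X A₁ δ ε p = α p := by
  have h : ¬ ∃ x : {x : ℝ × ℝ // x.2 ∈ Ioo (-η) η}, X x.1 = p := by
    rintro ⟨⟨⟨s, v⟩, hv⟩, h⟩
    exact hp s v hv h
  rw [deformation, Function.extend_apply' _ _ _ h]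
  simp

end

end HarmonicMC

open HarmonicMC

/-! ### Vector algebra in Euclidean 3-space and in the parameter plane. -/

namespace HarmonicMC

/-! In the chart `(s, v)` the harmonic mean curvature lines are the null directions of the quadratic
form `II - (𝒦/ℋ) I = a ds² + 2b ds dv + d dv²`. Along `v = 0` the vectors `α_s = T` and `α_v = N ∧
T` are orthonormal, so `a = k_n - 𝒦/ℋ = 0` and `b = τ_g > 0`. Near the axis one of the two null
directions is therefore close to `∂/∂s`; its slope is `p = -a / (b + √(b² - a d))` (`slope`), and by
continuity its geodesic torsion stays positive. The maximal leaves near `c` are thus the graphs of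
the solutions of `dv/ds = p(s, v)` (`isHarmonicLineOn_graph`). Since `p(s, 0) = 0`, the return map
on the section `s = 0` has derivative `exp ∫₀ᴸ p_v(s, 0) ds` at the fixed point
(`exists_return_map`, `exists_isReturnMap`), where `p_v = -a_v / (2 τ_g)` (`fderiv_slope`).

Near the axis the deformation adds `ε (A₁/6) v³ N`. This leaves the 2-jet along the axis unchanged,
so `c` stays a maximal cycle with the same curvatures and torsion (`isHarmonicCycle_perturbation`).
Among the `v`-derivatives at `v = 0` of the coefficients of `I` and `II`, only that of `g = II(∂/∂v,
∂/∂v)` changes, by `ε A₁`. On the axis `𝒦/ℋ = 2(eg - f²)/(e + g)`; its partial derivative in `g`,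
simplified by the relation `e = 𝒦/ℋ` that holds there, equals `𝒦/(2ℋ²)`. Hence `a_v` decreases by `ε
A₁ 𝒦/(2ℋ²)` (`fderiv_harmonicCoeff_perturbation`), and for `A₁ = μ τ_g` the number `p_v` increases
by `ε μ 𝒦/(4ℋ²)`. The logarithm of the derivative of the return map is `I₀ + ε μ I₁` with `I₁ = ∫
𝒦/(4ℋ²) > 0`. An affine function of `ε` with nonzero slope has one zero, so it does not vanish for
small `ε ≠ 0`.

The other point is regularity: the chart is only of class `C^{r-5}`, while the deformed map has to
be of class `C^{r-2}`. Put `n = r - 2`. A unit speed harmonic line with nonzero torsion solves an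
ordinary differential equation and is of class `C^{n+1}` (`contDiffAt_of_isHarmonic`), so the frame
`T, N ∧ T, N` along `c` is of class `C^n`. The adapted chart reads off the first two tubular
coordinates of this frame. Where the tubular map is regular, that is on a strip `|v| < η₀`, the
chart is then itself of class `C^n` (`IsAdaptedChart.contMDiffAt_of_injective`). That the deformed
map is an immersion for small `ε` follows from compactness of the support and openness of
injectivity. -/

theorem vec_apply_zero (x y : Space) : vec x y 0 = x 1 * y 2 - x 2 * y 1 := by
  simp [vec, crossProduct]

theorem vec_apply_one (x y : Space) : vec x y 1 = x 2 * y 0 - x 0 * y 2 := by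
  simp [vec, crossProduct]

theorem vec_apply_two (x y : Space) : vec x y 2 = x 0 * y 1 - x 1 * y 0 := by
  simp [vec, crossProduct]

theorem inner_eq_sum (x y : Space) : inner ℝ x y = x 0 * y 0 + x 1 * y 1 + x 2 * y 2 := by
  simp [PiLp.inner_apply, Fin.sum_univ_three]; ring

theorem inner_vec_left (x y : Space) : inner ℝ (vec x y) x = 0 := by
  simp only [inner_eq_sum, vec_apply_zero, vec_apply_one, vec_apply_two]; ring

theorem inner_vec_right (x y : Space) : inner ℝ (vec x y) y = 0 := by
  simp only [inner_eq_sum, vec_apply_zero, vec_apply_one, vec_apply_two]; ring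

/-- The Lagrange identity; for equal pairs it identifies `EG - F²` with a squared norm. -/
theorem inner_vec_vec (x y z w : Space) :
    inner ℝ (vec x y) (vec z w) = inner ℝ x z * inner ℝ y w - inner ℝ x w * inner ℝ y z := by
  simp only [inner_eq_sum, vec_apply_zero, vec_apply_one, vec_apply_two]; ring

theorem norm_vec_sq (x y : Space) :
    ‖vec x y‖ ^ 2 = inner ℝ x x * inner ℝ y y - inner ℝ x y ^ 2 := by
  rw [← real_inner_self_eq_norm_sq, inner_vec_vec, real_inner_comm x y]; ring

theorem vec_combination (x y : Space) (a b c d : ℝ) :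
    vec (a • x + b • y) (c • x + d • y) = (a * d - b * c) • vec x y := by
  ext i
  fin_cases i <;>
    simp only [Fin.zero_eta, Fin.mk_one, Fin.reduceFinMk, vec_apply_zero, vec_apply_one,
      vec_apply_two, PiLp.add_apply, PiLp.smul_apply, smul_eq_mul] <;> ring

theorem contDiff_vec {n : WithTop ℕ∞} : ContDiff ℝ n (fun p : Space × Space => vec p.1 p.2) := by
  rw [contDiff_piLp]
  intro i
  have h1 (j : Fin 3) : ContDiff ℝ n (fun p : Space × Space => p.1 j) :=
    (EuclideanSpace.proj j : Space →L[ℝ] ℝ).contDiff.comp contDiff_fst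
  have h2 (j : Fin 3) : ContDiff ℝ n (fun p : Space × Space => p.2 j) :=
    (EuclideanSpace.proj j : Space →L[ℝ] ℝ).contDiff.comp contDiff_snd
  fin_cases i <;>
    simp only [Fin.zero_eta, Fin.mk_one, Fin.reduceFinMk, vec_apply_zero, vec_apply_one,
      vec_apply_two]
  · exact ((h1 1).mul (h2 2)).sub ((h1 2).mul (h2 1))
  · exact ((h1 2).mul (h2 0)).sub ((h1 0).mul (h2 2))
  · exact ((h1 0).mul (h2 1)).sub ((h1 1).mul (h2 0))

theorem plane_eq (u : Plane) : u = u 0 • dir 0 + u 1 • dir 1 := by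
  ext i
  fin_cases i <;> simp [dir]

theorem det_eq (A : Plane →L[ℝ] Plane) :
    A.det = A (dir 0) 0 * A (dir 1) 1 - A (dir 1) 0 * A (dir 0) 1 := by
  rw [ContinuousLinearMap.det, ← LinearMap.det_toMatrix (EuclideanSpace.basisFun (Fin 2) ℝ).toBasis,
    Matrix.det_fin_two]
  simp [LinearMap.toMatrix_apply, dir]

theorem vec_map (B : Plane →L[ℝ] Space) (u w : Plane) :
    vec (B u) (B w) = (u 0 * w 1 - u 1 * w 0) • vec (B (dir 0)) (B (dir 1)) := by
  conv_lhs => rw [plane_eq u, plane_eq w]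
  simp only [map_add, map_smul]
  exact vec_combination _ _ _ _ _ _

theorem vec_comp (B : Plane →L[ℝ] Space) (A : Plane →L[ℝ] Plane) :
    vec (B (A (dir 0))) (B (A (dir 1))) = A.det • vec (B (dir 0)) (B (dir 1)) := by
  rw [vec_map, det_eq]; congr 1; ring

/-- A linear map of the plane into space is injective iff the vector product of the images of the
coordinate directions does not vanish. -/
theorem injective_iff_vec_ne_zero (B : Plane →L[ℝ] Space) :
    Function.Injective B ↔ vec (B (dir 0)) (B (dir 1)) ≠ 0 := by
  constructor
  · intro h h0
    have h1 := norm_vec_sq (B (dir 0)) (B (dir 1))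
    rw [h0] at h1
    set x := B (dir 0)
    set y := B (dir 1)
    have hx : x ≠ 0 := fun hx => by
      have := h (hx.trans (map_zero B).symm)
      have := congrFun (congrArg WithLp.ofLp this) 0
      simp [dir] at this
    -- Equality in the Cauchy–Schwarz inequality makes `x` and `y` proportional, against
    -- injectivity.
    have h2 : |inner ℝ x y| = ‖x‖ * ‖y‖ := by
      rw [real_inner_self_eq_norm_sq, real_inner_self_eq_norm_sq] at h1
      rw [← abs_of_nonneg (by positivity : 0 ≤ ‖x‖ * ‖y‖), ← sq_eq_sq_iff_abs_eq_abs]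
      simp at h1; nlinarith
    have h3 := (norm_inner_eq_norm_iff (𝕜 := ℝ) hx (y := y) (fun hy => by
      have := h (hy.trans (map_zero B).symm)
      have := congrFun (congrArg WithLp.ofLp this) 1
      simp [dir] at this)).1 (by simpa using h2)
    obtain ⟨r, -, hr⟩ := h3
    have h4 : B (dir 1) = B (r • dir 0) := by rw [map_smul]; exact hr
    have := congrFun (congrArg WithLp.ofLp (h h4)) 1
    simp [dir] at this
  · intro h
    rw [injective_iff_map_eq_zero]
    intro u hu
    have h0 (w : Plane) : u 0 * w 1 - u 1 * w 0 = 0 := by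
      have := vec_map B u w
      rw [hu] at this
      have h00 : vec 0 (B w) = 0 := by simp [vec]
      rw [h00] at this
      exact (smul_eq_zero.1 this.symm).resolve_right h
    have e0 := h0 (dir 0)
    have e1 := h0 (dir 1)
    simp [dir] at e0 e1
    ext i
    fin_cases i <;> simp [e0, e1]

end HarmonicMC

/-! ### Calculus of the fundamental forms of a parametrized surface. -/

namespace HarmonicMC

variable {E : Type*} [NormedAddCommGroup E] [NormedSpace ℝ E]

theorem _root_.ContDiffAt.vec {n : WithTop ℕ∞} {f g : E → Space} {x : E}
    (hf : ContDiffAt ℝ n f x) (hg : ContDiffAt ℝ n g x) :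
    ContDiffAt ℝ n (fun z => vec (f z) (g z)) x :=
  contDiff_vec.contDiffAt.comp x (hf.prodMk hg)

theorem firstDet_eq (F : Plane → Space) (y : Plane) :
    firstDet F y = ‖vec (fderiv ℝ F y (dir 0)) (fderiv ℝ F y (dir 1))‖ ^ 2 :=
  (norm_vec_sq _ _).symm

theorem firstDet_pos {F : Plane → Space} {y : Plane} (h : Function.Injective (fderiv ℝ F y)) :
    0 < firstDet F y := by
  rw [firstDet_eq]
  have := (injective_iff_vec_ne_zero _).1 h
  positivity

theorem firstForm_pos {F : Plane → Space} {y u : Plane}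
    (h : Function.Injective (fderiv ℝ F y)) (hu : u ≠ 0) : 0 < firstForm F y u u := by
  rw [firstForm, real_inner_self_eq_norm_sq]
  have : fderiv ℝ F y u ≠ 0 := fun h0 => hu (h (h0.trans (map_zero _).symm))
  positivity

theorem norm_patchNormal {F : Plane → Space} {y : Plane}
    (h : Function.Injective (fderiv ℝ F y)) : ‖patchNormal F y‖ = 1 := by
  have := (injective_iff_vec_ne_zero _).1 h
  rw [patchNormal, norm_smul, norm_inv, norm_norm, inv_mul_cancel₀]
  simpa using this

theorem inner_patchNormal (F : Plane → Space) (y u : Plane) :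
    inner ℝ (patchNormal F y) (fderiv ℝ F y u) = 0 := by
  rw [plane_eq u, map_add, map_smul, map_smul, patchNormal, inner_smul_left, inner_add_right,
    inner_smul_right, inner_smul_right, inner_vec_left, inner_vec_right]
  simp

/-! ### Smoothness -/

section Smooth

variable {n : WithTop ℕ∞} {F : Plane → Space} {y u w : E → Plane} {x : E}

theorem _root_.ContDiffAt.fderiv_patch (hF : ContDiffAt ℝ (n + 1) F (y x))
    (hy : ContDiffAt ℝ n y x) (hu : ContDiffAt ℝ n u x) :
    ContDiffAt ℝ n (fun z => fderiv ℝ F (y z) (u z)) x :=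
  ((hF.fderiv_right le_rfl).comp x hy).clm_apply hu

theorem contDiffAt_patchNormal {F : Plane → Space} {y : Plane} (hF : ContDiffAt ℝ (n + 1) F y)
    (hi : Function.Injective (fderiv ℝ F y)) : ContDiffAt ℝ n (patchNormal F) y := by
  have h0 : ContDiffAt ℝ n (fun z => vec (fderiv ℝ F z (dir 0)) (fderiv ℝ F z (dir 1))) y :=
    (hF.fderiv_patch (y := id) contDiffAt_id contDiffAt_const).vec
      (hF.fderiv_patch (y := id) contDiffAt_id contDiffAt_const)
  have h1 := (injective_iff_vec_ne_zero _).1 hi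
  exact ((h0.norm ℝ h1).inv (by simpa using h1)).smul h0

theorem _root_.ContDiffAt.firstForm (hF : ContDiffAt ℝ (n + 1) F (y x))
    (hy : ContDiffAt ℝ n y x) (hu : ContDiffAt ℝ n u x) (hw : ContDiffAt ℝ n w x) :
    ContDiffAt ℝ n (fun z => firstForm F (y z) (u z) (w z)) x :=
  (hF.fderiv_patch hy hu).inner ℝ (hF.fderiv_patch hy hw)

theorem add_one_add_one_le (n : WithTop ℕ∞) : n + 1 + 1 ≤ n + 2 := by
  rw [add_assoc, one_add_one_eq_two]

theorem _root_.ContDiffAt.secondForm (hF : ContDiffAt ℝ (n + 2) F (y x))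
    (hi : Function.Injective (fderiv ℝ F (y x)))
    (hy : ContDiffAt ℝ n y x) (hu : ContDiffAt ℝ n u x) (hw : ContDiffAt ℝ n w x) :
    ContDiffAt ℝ n (fun z => secondForm F (y z) (u z) (w z)) x := by
  have h2 := add_one_add_one_le n
  have h1 : ContDiffAt ℝ (n + 1) F (y x) := hF.of_le (le_self_add.trans h2)
  have hN : ContDiffAt ℝ n (fun z => patchNormal F (y z)) x :=
    (contDiffAt_patchNormal h1 hi).comp x hy
  have h3 : ContDiffAt ℝ n (fun z => fderiv ℝ (fderiv ℝ F) (y z)) x :=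
    ((hF.fderiv_right h2).fderiv_right le_rfl).comp x hy
  exact hN.inner ℝ ((h3.clm_apply hu).clm_apply hw)

theorem _root_.ContDiffAt.firstDet (hF : ContDiffAt ℝ (n + 1) F (y x))
    (hy : ContDiffAt ℝ n y x) : ContDiffAt ℝ n (fun z => firstDet F (y z)) x :=
  ((hF.firstForm hy contDiffAt_const contDiffAt_const).mul
    (hF.firstForm hy contDiffAt_const contDiffAt_const)).sub
    ((hF.firstForm hy contDiffAt_const contDiffAt_const).pow 2)

theorem _root_.ContDiffAt.patchGauss (hF : ContDiffAt ℝ (n + 2) F (y x))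
    (hi : Function.Injective (fderiv ℝ F (y x))) (hy : ContDiffAt ℝ n y x) :
    ContDiffAt ℝ n (fun z => patchGauss F (y z)) x := by
  have h1 : ContDiffAt ℝ (n + 1) F (y x) := hF.of_le (le_self_add.trans (add_one_add_one_le n))
  have hs (i j : Fin 2) := hF.secondForm hi hy (contDiffAt_const (c := dir i))
    (contDiffAt_const (c := dir j))
  exact (((hs 0 0).mul (hs 1 1)).sub ((hs 0 1).pow 2)).div (h1.firstDet hy) (firstDet_pos hi).ne'

theorem _root_.ContDiffAt.patchMean (hF : ContDiffAt ℝ (n + 2) F (y x))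
    (hi : Function.Injective (fderiv ℝ F (y x))) (hy : ContDiffAt ℝ n y x) :
    ContDiffAt ℝ n (fun z => patchMean F (y z)) x := by
  have h1 : ContDiffAt ℝ (n + 1) F (y x) := hF.of_le (le_self_add.trans (add_one_add_one_le n))
  have hs (i j : Fin 2) := hF.secondForm hi hy (contDiffAt_const (c := dir i))
    (contDiffAt_const (c := dir j))
  have hf (i j : Fin 2) := h1.firstForm hy (contDiffAt_const (c := dir i))
    (contDiffAt_const (c := dir j))
  exact (((((hs 0 0).mul (hf 1 1)).sub ((contDiffAt_const.mul (hs 0 1)).mul (hf 0 1))).add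
    ((hs 1 1).mul (hf 0 0)))).div (contDiffAt_const.mul (h1.firstDet hy))
      (mul_ne_zero two_ne_zero (firstDet_pos hi).ne')

theorem _root_.ContDiffAt.patchTorsion (hF : ContDiffAt ℝ (n + 2) F (y x))
    (hi : Function.Injective (fderiv ℝ F (y x)))
    (hy : ContDiffAt ℝ n y x) (hu : ContDiffAt ℝ n u x) (hu0 : u x ≠ 0) :
    ContDiffAt ℝ n (fun z => patchTorsion F (y z) (u z)) x := by
  have h2 := add_one_add_one_le n
  have h1 : ContDiffAt ℝ (n + 1) F (y x) := hF.of_le (le_self_add.trans h2)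
  have hN := contDiffAt_patchNormal (hF.of_le h2) hi
  have hN' : ContDiffAt ℝ n (fun z => patchNormal F (y z)) x :=
    (contDiffAt_patchNormal h1 hi).comp x hy
  have h3 : ContDiffAt ℝ n (fun z => fderiv ℝ (HarmonicMC.patchNormal F) (y z) (u z)) x :=
    ((hN.fderiv_right le_rfl).comp x hy).clm_apply hu
  exact (h3.inner ℝ (hN'.vec (h1.fderiv_patch hy hu))).neg.div (h1.firstForm hy hu hu)
    (firstForm_pos hi hu0).ne'

end Smooth

/-! ### Bilinearity -/

theorem firstForm_expand (F : Plane → Space) (y u w : Plane) :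
    firstForm F y u w = u 0 * w 0 * firstForm F y (dir 0) (dir 0)
      + (u 0 * w 1 + u 1 * w 0) * firstForm F y (dir 0) (dir 1)
      + u 1 * w 1 * firstForm F y (dir 1) (dir 1) := by
  conv_lhs => rw [plane_eq u, plane_eq w]
  simp only [firstForm, map_add, map_smul, inner_add_left, inner_add_right, inner_smul_left,
    inner_smul_right, conj_trivial]
  rw [real_inner_comm (fderiv ℝ F y (dir 0)) (fderiv ℝ F y (dir 1))]
  ring

theorem secondForm_comm {F : Plane → Space} {y : Plane} (hF : ContDiffAt ℝ 2 F y) (u w : Plane) :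
    secondForm F y u w = secondForm F y w u := by
  rw [secondForm, secondForm, (hF.isSymmSndFDerivAt (by simp)).eq]

theorem secondForm_expand {F : Plane → Space} {y : Plane} (hF : ContDiffAt ℝ 2 F y)
    (u w : Plane) :
    secondForm F y u w = u 0 * w 0 * secondForm F y (dir 0) (dir 0)
      + (u 0 * w 1 + u 1 * w 0) * secondForm F y (dir 0) (dir 1)
      + u 1 * w 1 * secondForm F y (dir 1) (dir 1) := by
  have hc := secondForm_comm hF (dir 1) (dir 0)
  conv_lhs => rw [plane_eq u, plane_eq w]
  simp only [secondForm, map_add, map_smul, inner_add_right, add_apply,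
    inner_smul_right, smul_apply] at hc ⊢
  rw [hc]
  ring

/-! ### Change of parameters -/

section Change

variable {F : Plane → Space} {φ : Plane → Plane} {y : Plane}

theorem firstForm_comp (hF : DifferentiableAt ℝ F (φ y)) (hφ : DifferentiableAt ℝ φ y)
    (u w : Plane) : firstForm (F ∘ φ) y u w =
      firstForm F (φ y) (fderiv ℝ φ y u) (fderiv ℝ φ y w) := by
  simp only [firstForm, fderiv_comp y hF hφ, ContinuousLinearMap.comp_apply]

/-- The vector product of the partial derivatives is multiplied by the Jacobian determinant, and a
positive factor disappears on normalizing. -/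
theorem patchNormal_comp (hF : DifferentiableAt ℝ F (φ y)) (hφ : DifferentiableAt ℝ φ y)
    (hd : 0 < (fderiv ℝ φ y).det) : patchNormal (F ∘ φ) y = patchNormal F (φ y) := by
  simp only [patchNormal, fderiv_comp y hF hφ, ContinuousLinearMap.comp_apply, vec_comp]
  rw [norm_smul, mul_inv, smul_smul, Real.norm_of_nonneg hd.le]
  congr 1
  field_simp

theorem eventually_fderiv_comp (hF : ContDiffAt ℝ 1 F (φ y)) (hφ : ContDiffAt ℝ 1 φ y) :
    fderiv ℝ (F ∘ φ) =ᶠ[𝓝 y] fun z => (fderiv ℝ F (φ z)).comp (fderiv ℝ φ z) := by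
  have h1 : ∀ᶠ z in 𝓝 (φ y), ContDiffAt ℝ 1 F z := hF.eventually (by simp)
  filter_upwards [hφ.continuousAt.eventually h1, hφ.eventually (by simp)] with z h2 h3
  exact fderiv_comp z (h2.differentiableAt one_ne_zero) (h3.differentiableAt one_ne_zero)

/-- The chain rule gives `D²F(Dφ, Dφ) + DF(D²φ)`; the second term is tangent to the surface and is
annihilated by the normal. -/
theorem secondForm_comp (hF : ContDiffAt ℝ 2 F (φ y)) (hφ : ContDiffAt ℝ 2 φ y)
    (hd : 0 < (fderiv ℝ φ y).det) (u w : Plane) : secondForm (F ∘ φ) y u w =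
      secondForm F (φ y) (fderiv ℝ φ y u) (fderiv ℝ φ y w) := by
  have hF1 := hF.differentiableAt two_ne_zero
  have hφ1 := hφ.differentiableAt two_ne_zero
  have h0 : DifferentiableAt ℝ (fderiv ℝ F) (φ y) :=
    (hF.fderiv_right (m := 1) (by norm_num)).differentiableAt one_ne_zero
  have h1 : DifferentiableAt ℝ (fun z => fderiv ℝ F (φ z)) y := h0.comp y hφ1
  have h2 : DifferentiableAt ℝ (fderiv ℝ φ) y :=
    (hφ.fderiv_right (m := 1) (by norm_num)).differentiableAt one_ne_zero
  have h3 : fderiv ℝ (fun z => fderiv ℝ F (φ z)) y =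
      (fderiv ℝ (fderiv ℝ F) (φ y)).comp (fderiv ℝ φ y) := fderiv_comp y h0 hφ1
  rw [secondForm, secondForm, patchNormal_comp hF1 hφ1 hd,
    (eventually_fderiv_comp (hF.of_le one_le_two) (hφ.of_le one_le_two)).fderiv_eq,
    fderiv_clm_comp h1 h2, h3]
  simp [inner_add_right, inner_patchNormal]

theorem firstDet_comp (hF : DifferentiableAt ℝ F (φ y)) (hφ : DifferentiableAt ℝ φ y) :
    firstDet (F ∘ φ) y = (fderiv ℝ φ y).det ^ 2 * firstDet F (φ y) := by
  simp only [firstDet_eq, fderiv_comp y hF hφ, ContinuousLinearMap.comp_apply, vec_comp,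
    norm_smul, mul_pow, Real.norm_eq_abs, sq_abs]

/-- Numerator and denominator are both multiplied by the square of the Jacobian determinant. -/
theorem patchGauss_comp (hF : ContDiffAt ℝ 2 F (φ y)) (hφ : ContDiffAt ℝ 2 φ y)
    (hd : 0 < (fderiv ℝ φ y).det) : patchGauss (F ∘ φ) y = patchGauss F (φ y) := by
  have hF1 := hF.differentiableAt two_ne_zero
  have hφ1 := hφ.differentiableAt two_ne_zero
  rw [patchGauss, patchGauss, firstDet_comp hF1 hφ1,
    ← mul_div_mul_left _ (firstDet F (φ y)) (pow_ne_zero 2 hd.ne')]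
  congr 1
  simp only [secondForm_comp hF hφ hd]
  rw [secondForm_expand hF (fderiv ℝ φ y (dir 0)) (fderiv ℝ φ y (dir 0)),
    secondForm_expand hF (fderiv ℝ φ y (dir 0)) (fderiv ℝ φ y (dir 1)),
    secondForm_expand hF (fderiv ℝ φ y (dir 1)) (fderiv ℝ φ y (dir 1)), det_eq]
  ring

theorem patchMean_comp (hF : ContDiffAt ℝ 2 F (φ y)) (hφ : ContDiffAt ℝ 2 φ y)
    (hd : 0 < (fderiv ℝ φ y).det) : patchMean (F ∘ φ) y = patchMean F (φ y) := by
  have hF1 := hF.differentiableAt two_ne_zero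
  have hφ1 := hφ.differentiableAt two_ne_zero
  rw [patchMean, patchMean, firstDet_comp hF1 hφ1,
    ← mul_div_mul_left _ (2 * firstDet F (φ y)) (pow_ne_zero 2 hd.ne')]
  congr 1
  · simp only [secondForm_comp hF hφ hd, firstForm_comp hF1 hφ1]
    rw [secondForm_expand hF (fderiv ℝ φ y (dir 0)) (fderiv ℝ φ y (dir 0)),
      secondForm_expand hF (fderiv ℝ φ y (dir 0)) (fderiv ℝ φ y (dir 1)),
      secondForm_expand hF (fderiv ℝ φ y (dir 1)) (fderiv ℝ φ y (dir 1)), det_eq,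
      firstForm_expand F _ (fderiv ℝ φ y (dir 0)) (fderiv ℝ φ y (dir 0)),
      firstForm_expand F _ (fderiv ℝ φ y (dir 0)) (fderiv ℝ φ y (dir 1)),
      firstForm_expand F _ (fderiv ℝ φ y (dir 1)) (fderiv ℝ φ y (dir 1))]
    ring
  · ring

theorem patchNormalCurvature_comp (hF : ContDiffAt ℝ 2 F (φ y)) (hφ : ContDiffAt ℝ 2 φ y)
    (hd : 0 < (fderiv ℝ φ y).det) (u : Plane) :
    patchNormalCurvature (F ∘ φ) y u = patchNormalCurvature F (φ y) (fderiv ℝ φ y u) := by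
  rw [patchNormalCurvature, patchNormalCurvature, secondForm_comp hF hφ hd,
    firstForm_comp (hF.differentiableAt two_ne_zero) (hφ.differentiableAt two_ne_zero)]

theorem continuous_det_plane : Continuous fun A : Plane →L[ℝ] Plane => A.det := by
  simp only [det_eq]
  have h (i j : Fin 2) : Continuous fun A : Plane →L[ℝ] Plane => A (dir i) j :=
    (EuclideanSpace.proj j : Plane →L[ℝ] ℝ).continuous.comp
      (ContinuousLinearMap.apply ℝ Plane (dir i)).continuous
  exact ((h 0 0).mul (h 1 1)).sub ((h 1 0).mul (h 0 1))

theorem eventually_det_pos (hφ : ContDiffAt ℝ 1 φ y) (hd : 0 < (fderiv ℝ φ y).det) :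
    ∀ᶠ z in 𝓝 y, 0 < (fderiv ℝ φ z).det :=
  (ContinuousAt.comp (f := fderiv ℝ φ) continuous_det_plane.continuousAt
    (hφ.continuousAt_fderiv one_ne_zero)).eventually (lt_mem_nhds hd)

theorem eventually_patchNormal_comp (hF : ContDiffAt ℝ 1 F (φ y)) (hφ : ContDiffAt ℝ 1 φ y)
    (hd : 0 < (fderiv ℝ φ y).det) :
    patchNormal (F ∘ φ) =ᶠ[𝓝 y] patchNormal F ∘ φ := by
  have h1 : ∀ᶠ z in 𝓝 (φ y), ContDiffAt ℝ 1 F z := hF.eventually (by simp)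
  filter_upwards [hφ.continuousAt.eventually h1, hφ.eventually (by simp),
    eventually_det_pos hφ hd] with z h2 h3 h4
  exact patchNormal_comp (h2.differentiableAt one_ne_zero) (h3.differentiableAt one_ne_zero) h4

theorem patchTorsion_comp (hF : ContDiffAt ℝ 2 F (φ y)) (hφ : ContDiffAt ℝ 2 φ y)
    (hd : 0 < (fderiv ℝ φ y).det) (hi : Function.Injective (fderiv ℝ F (φ y))) (u : Plane) :
    patchTorsion (F ∘ φ) y u = patchTorsion F (φ y) (fderiv ℝ φ y u) := by
  have hF1 := hF.differentiableAt two_ne_zero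
  have hφ1 := hφ.differentiableAt two_ne_zero
  have hN : DifferentiableAt ℝ (patchNormal F) (φ y) :=
    (contDiffAt_patchNormal (n := 1) (by simpa [one_add_one_eq_two] using hF) hi).differentiableAt
      one_ne_zero
  rw [patchTorsion, patchTorsion, firstForm_comp hF1 hφ1, patchNormal_comp hF1 hφ1 hd,
    (eventually_patchNormal_comp (hF.of_le one_le_two) (hφ.of_le one_le_two) hd).fderiv_eq,
    fderiv_comp y hN hφ1, fderiv_comp y hF1 hφ1]
  rfl

end Change

end HarmonicMC

namespace HarmonicMC

/-! ### Dependence on germs -/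

section Germ

variable {F G : Plane → Space} {y : Plane}

theorem patchNormal_congr (h : F =ᶠ[𝓝 y] G) : patchNormal F y = patchNormal G y := by
  rw [patchNormal, patchNormal, h.fderiv_eq]

theorem firstForm_congr (h : F =ᶠ[𝓝 y] G) : firstForm F y = firstForm G y := by
  ext u w
  rw [firstForm, firstForm, h.fderiv_eq]

theorem secondForm_congr (h : F =ᶠ[𝓝 y] G) : secondForm F y = secondForm G y := by
  ext u w
  rw [secondForm, secondForm, patchNormal_congr h, h.fderiv.fderiv_eq]

theorem patchGauss_congr (h : F =ᶠ[𝓝 y] G) : patchGauss F y = patchGauss G y := by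
  rw [patchGauss, patchGauss, firstDet, firstDet, firstForm_congr h, secondForm_congr h]

theorem patchMean_congr (h : F =ᶠ[𝓝 y] G) : patchMean F y = patchMean G y := by
  rw [patchMean, patchMean, firstDet, firstDet, firstForm_congr h, secondForm_congr h]

theorem patchNormalCurvature_congr (h : F =ᶠ[𝓝 y] G) (u : Plane) :
    patchNormalCurvature F y u = patchNormalCurvature G y u := by
  rw [patchNormalCurvature, patchNormalCurvature, firstForm_congr h, secondForm_congr h]

theorem patchTorsion_congr (h : F =ᶠ[𝓝 y] G) (u : Plane) :
    patchTorsion F y u = patchTorsion G y u := by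
  have h1 : patchNormal F =ᶠ[𝓝 y] patchNormal G :=
    h.eventuallyEq_nhds.mono fun z hz => patchNormal_congr hz
  rw [patchTorsion, patchTorsion, firstForm_congr h, patchNormal_congr h, h.fderiv_eq,
    h1.fderiv_eq]

end Germ

/-! ### Positive parametrizations of a surface -/

variable {M : Type*} [TopologicalSpace M] [ChartedSpace Plane M]

/-- `Y : Plane → M` is, near `y`, a `C²` parametrization that is compatible with the positive
charts. -/
structure IsPositiveParamAt (Y : Plane → M) (y : Plane) : Prop where
  continuousAt : ContinuousAt Y y
  contDiffAt : ContDiffAt ℝ 2 (extChartAt (𝓡 2) (Y y) ∘ Y) y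
  det_pos : 0 < (fderiv ℝ (extChartAt (𝓡 2) (Y y) ∘ Y) y).det

theorem comp_eventuallyEq_patch (f : M → Space) {Y : Plane → M} {y : Plane}
    (hY : ContinuousAt Y y) :
    f ∘ Y =ᶠ[𝓝 y] patch f (Y y) ∘ (extChartAt (𝓡 2) (Y y) ∘ Y) := by
  filter_upwards [hY.preimage_mem_nhds (extChartAt_source_mem_nhds (I := 𝓡 2) (Y y))] with z hz
  rw [Function.comp_apply, Function.comp_apply, Function.comp_apply, patch, Function.comp_apply,
    (extChartAt (𝓡 2) (Y y)).left_inv hz]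

theorem mfderiv_eq_fderiv_patch {f : M → Space} {p : M} (hf : MDifferentiableAt (𝓡 2)
    𝓘(ℝ, Space) f p) : mfderiv (𝓡 2) 𝓘(ℝ, Space) f p = fderiv ℝ (patch f p) (coord p) := by
  rw [hf.mfderiv]
  simp only [mfld_simps, patch, coord, fderivWithin_univ, writtenInExtChartAt]
  rfl

theorem velocity_eq_deriv {γ : ℝ → M} {t : ℝ} (h : MDifferentiableAt 𝓘(ℝ, ℝ) (𝓡 2) γ t) :
    velocity γ t = deriv (extChartAt (𝓡 2) (γ t) ∘ γ) t := by
  rw [velocity, h.mfderiv]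
  simp only [mfld_simps, fderivWithin_univ, writtenInExtChartAt]
  rfl

section Param

variable [IsManifold (𝓡 2) ∞ M]

theorem contDiffAt_patch {n : ℕ} {f : M → Space} {p : M} {y : Plane}
    (hy : y ∈ (extChartAt (𝓡 2) p).target)
    (hf : ContMDiffAt (𝓡 2) 𝓘(ℝ, Space) n f ((extChartAt (𝓡 2) p).symm y)) :
    ContDiffAt ℝ n (patch f p) y := by
  rw [← contMDiffAt_iff_contDiffAt]
  have : IsManifold (𝓡 2) n M := IsManifold.of_le (n := ∞) (by exact_mod_cast le_top)
  exact hf.comp y ((contMDiffOn_extChartAt_symm (I := 𝓡 2) (n := n) p).contMDiffAt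
    ((isOpen_extChartAt_target p).mem_nhds hy))

theorem contDiffAt_patch_coord {n : ℕ} {f : M → Space} {p : M}
    (hf : ContMDiffAt (𝓡 2) 𝓘(ℝ, Space) n f p) : ContDiffAt ℝ n (patch f p) (coord p) :=
  contDiffAt_patch (mem_extChartAt_target p) (by rwa [coord, extChartAt_to_inv])

omit [IsManifold (𝓡 2) ∞ M] in
theorem injective_fderiv_patch {f : M → Space} {p : M}
    (hf : ContMDiffAt (𝓡 2) 𝓘(ℝ, Space) 1 f p)
    (hi : Function.Injective (mfderiv (𝓡 2) 𝓘(ℝ, Space) f p)) :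
    Function.Injective (fderiv ℝ (patch f p) (coord p)) := by
  rwa [mfderiv_eq_fderiv_patch (hf.mdifferentiableAt one_ne_zero)] at hi

variable {Y : Plane → M} {y : Plane} {f : M → Space}

theorem IsPositiveParamAt.contDiffAt_comp (hY : IsPositiveParamAt Y y)
    (hf : ContMDiffAt (𝓡 2) 𝓘(ℝ, Space) 2 f (Y y)) : ContDiffAt ℝ 2 (f ∘ Y) y :=
  ((contDiffAt_patch_coord (n := 2) hf).comp y hY.contDiffAt).congr_of_eventuallyEq
    (comp_eventuallyEq_patch f hY.continuousAt)

/-- The invariants of the surface are defined through the preferred chart at each point, and this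
chart changes with the point. This lemma and its companions let one fixed positive parametrization
serve at all nearby points. -/
theorem IsPositiveParamAt.unitNormal_eq (hY : IsPositiveParamAt Y y)
    (hf : ContMDiffAt (𝓡 2) 𝓘(ℝ, Space) 2 f (Y y)) :
    unitNormal f (Y y) = patchNormal (f ∘ Y) y := by
  rw [patchNormal_congr (comp_eventuallyEq_patch f hY.continuousAt),
    patchNormal_comp ((contDiffAt_patch_coord (n := 2) hf).differentiableAt two_ne_zero)
      (hY.contDiffAt.differentiableAt two_ne_zero) hY.det_pos]
  rfl

theorem IsPositiveParamAt.gauss_eq (hY : IsPositiveParamAt Y y)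
    (hf : ContMDiffAt (𝓡 2) 𝓘(ℝ, Space) 2 f (Y y)) : gauss f (Y y) = patchGauss (f ∘ Y) y := by
  rw [patchGauss_congr (comp_eventuallyEq_patch f hY.continuousAt),
    patchGauss_comp (φ := extChartAt (𝓡 2) (Y y) ∘ Y)
      (contDiffAt_patch_coord (n := 2) hf) hY.contDiffAt hY.det_pos]
  rfl

theorem IsPositiveParamAt.mean_eq (hY : IsPositiveParamAt Y y)
    (hf : ContMDiffAt (𝓡 2) 𝓘(ℝ, Space) 2 f (Y y)) : mean f (Y y) = patchMean (f ∘ Y) y := by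
  rw [patchMean_congr (comp_eventuallyEq_patch f hY.continuousAt),
    patchMean_comp (φ := extChartAt (𝓡 2) (Y y) ∘ Y)
      (contDiffAt_patch_coord (n := 2) hf) hY.contDiffAt hY.det_pos]
  rfl

theorem injective_of_det_ne_zero {A : Plane →L[ℝ] Plane} (h : A.det ≠ 0) :
    Function.Injective A := by
  have h1 : LinearMap.ker (A : Plane →ₗ[ℝ] Plane) = ⊥ :=
    (LinearMap.isUnit_iff_ker_eq_bot _).1
      ((LinearMap.isUnit_iff_isUnit_det _).2 (isUnit_iff_ne_zero.2 h))
  exact LinearMap.ker_eq_bot.1 h1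

theorem IsPositiveParamAt.injective_fderiv (hY : IsPositiveParamAt Y y)
    (hf : ContMDiffAt (𝓡 2) 𝓘(ℝ, Space) 2 f (Y y))
    (hi : Function.Injective (mfderiv (𝓡 2) 𝓘(ℝ, Space) f (Y y))) :
    Function.Injective (fderiv ℝ (f ∘ Y) y) := by
  rw [(comp_eventuallyEq_patch f hY.continuousAt).fderiv_eq,
    fderiv_comp y ((contDiffAt_patch_coord (n := 2) hf).differentiableAt two_ne_zero)
      (hY.contDiffAt.differentiableAt two_ne_zero)]
  exact (injective_fderiv_patch (hf.of_le one_le_two) hi).comp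
    (injective_of_det_ne_zero hY.det_pos.ne')

variable {γ : ℝ → M} {ζ : ℝ → Plane} {t : ℝ} {u : Plane}

omit [IsManifold (𝓡 2) ∞ M] in
theorem IsPositiveParamAt.hasDerivAt_coord (hY : IsPositiveParamAt Y (ζ t))
    (hζ : HasDerivAt ζ u t) (hγ : γ =ᶠ[𝓝 t] Y ∘ ζ) :
    HasDerivAt (extChartAt (𝓡 2) (γ t) ∘ γ)
      (fderiv ℝ (extChartAt (𝓡 2) (Y (ζ t)) ∘ Y) (ζ t) u) t := by
  have h0 : γ t = Y (ζ t) := hγ.eq_of_nhds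
  rw [h0]
  refine HasDerivAt.congr_of_eventuallyEq ?_ (hγ.fun_comp (extChartAt (𝓡 2) (Y (ζ t))))
  exact ((hY.contDiffAt.differentiableAt two_ne_zero).hasFDerivAt).comp_hasDerivAt t hζ

omit [IsManifold (𝓡 2) ∞ M] in
theorem IsPositiveParamAt.velocity_eq (hY : IsPositiveParamAt Y (ζ t))
    (hζ : HasDerivAt ζ u t) (hγ : γ =ᶠ[𝓝 t] Y ∘ ζ) :
    velocity γ t = fderiv ℝ (extChartAt (𝓡 2) (Y (ζ t)) ∘ Y) (ζ t) u := by
  have h1 := hY.hasDerivAt_coord hζ hγ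
  have h0 : γ t = Y (ζ t) := hγ.eq_of_nhds
  rw [velocity_eq_deriv, h1.deriv]
  rw [mdifferentiableAt_iff]
  refine ⟨?_, ?_⟩
  · exact (ContinuousAt.comp hY.continuousAt hζ.continuousAt).congr hγ.symm
  · simp only [mfld_simps, writtenInExtChartAt, differentiableWithinAt_univ]
    exact h1.differentiableAt

omit [IsManifold (𝓡 2) ∞ M] in
theorem IsPositiveParamAt.velocity_ne_zero (hY : IsPositiveParamAt Y (ζ t))
    (hζ : HasDerivAt ζ u t) (hγ : γ =ᶠ[𝓝 t] Y ∘ ζ) (hu : u ≠ 0) : velocity γ t ≠ 0 := by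
  rw [hY.velocity_eq hζ hγ]
  exact fun h => hu (injective_of_det_ne_zero hY.det_pos.ne' (h.trans (map_zero _).symm))

theorem IsPositiveParamAt.normalCurvature_eq (hY : IsPositiveParamAt Y (ζ t))
    (hf : ContMDiffAt (𝓡 2) 𝓘(ℝ, Space) 2 f (Y (ζ t)))
    (hζ : HasDerivAt ζ u t) (hγ : γ =ᶠ[𝓝 t] Y ∘ ζ) :
    normalCurvature f γ t = patchNormalCurvature (f ∘ Y) (ζ t) u := by
  have h0 : γ t = Y (ζ t) := hγ.eq_of_nhds
  rw [patchNormalCurvature_congr (comp_eventuallyEq_patch f hY.continuousAt),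
    patchNormalCurvature_comp (φ := extChartAt (𝓡 2) (Y (ζ t)) ∘ Y)
      (contDiffAt_patch_coord (n := 2) hf) hY.contDiffAt hY.det_pos,
    normalCurvature, h0, hY.velocity_eq hζ hγ]
  rfl

theorem IsPositiveParamAt.geodesicTorsion_eq (hY : IsPositiveParamAt Y (ζ t))
    (hf : ContMDiffAt (𝓡 2) 𝓘(ℝ, Space) 2 f (Y (ζ t)))
    (hi : Function.Injective (mfderiv (𝓡 2) 𝓘(ℝ, Space) f (Y (ζ t))))
    (hζ : HasDerivAt ζ u t) (hγ : γ =ᶠ[𝓝 t] Y ∘ ζ) :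
    geodesicTorsion f γ t = patchTorsion (f ∘ Y) (ζ t) u := by
  have h0 : γ t = Y (ζ t) := hγ.eq_of_nhds
  rw [patchTorsion_congr (comp_eventuallyEq_patch f hY.continuousAt),
    patchTorsion_comp (φ := extChartAt (𝓡 2) (Y (ζ t)) ∘ Y)
      (contDiffAt_patch_coord (n := 2) hf) hY.contDiffAt hY.det_pos
      (injective_fderiv_patch (hf.of_le one_le_two) hi),
    geodesicTorsion, h0, hY.velocity_eq hζ hγ]
  rfl

/-- The inverses of the charts of an oriented atlas are positive parametrizations. -/
theorem isPositiveParamAt_extChartAt_symm [OrientedAtlas M] {p : M} {y : Plane}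
    (hy : y ∈ (extChartAt (𝓡 2) p).target) :
    IsPositiveParamAt (extChartAt (𝓡 2) p).symm y := by
  have h1 := continuousAt_extChartAt_symm'' hy
  set q := (extChartAt (𝓡 2) p).symm y with hq
  have h2 : y ∈ ((extChartAt (𝓡 2) p).symm ≫ extChartAt (𝓡 2) q).source := by
    rw [PartialEquiv.trans_source]
    exact ⟨hy, mem_extChartAt_source (I := 𝓡 2) q⟩
  refine ⟨h1, ?_, ?_⟩
  · have := (contDiffOn_ext_coord_change (I := 𝓡 2) (n := ∞) q p).contDiffAt
      (mem_of_superset ((h1.preimage_mem_nhds (extChartAt_source_mem_nhds (I := 𝓡 2) q) |>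
        inter_mem ((isOpen_extChartAt_target p).mem_nhds hy))) (fun z hz => by
          rw [PartialEquiv.trans_source]
          exact hz))
    exact this.of_le (WithTop.coe_le_coe.2 le_top)
  · have h3 := OrientedAtlas.det_pos (chartAt Plane p) (chart_mem_atlas _ p) (chartAt Plane q)
      (chart_mem_atlas _ q) y (by
        rw [OpenPartialHomeomorph.trans_source]
        simpa only [PartialEquiv.trans_source, mfld_simps] using h2)
    rw [← hq]
    simpa only [mfld_simps] using h3

/-- Orientation makes the preferred chart at a nearby point and the fixed chart at `p` give the same
normal, so near `p` the normal is a single expression in first derivatives. One derivative is lost.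
-/
theorem contMDiff_unitNormal [OrientedAtlas M] {n : ℕ} (hn : 1 ≤ n)
    (hf : ContMDiff (𝓡 2) 𝓘(ℝ, Space) (n + 1 : ℕ) f)
    (hi : ∀ p, Function.Injective (mfderiv (𝓡 2) 𝓘(ℝ, Space) f p)) :
    ContMDiff (𝓡 2) 𝓘(ℝ, Space) n (unitNormal f) := by
  intro p
  have h2 : ContMDiff (𝓡 2) 𝓘(ℝ, Space) 2 f :=
    hf.of_le (by exact_mod_cast (by omega : 2 ≤ n + 1))
  have h1 : unitNormal f =ᶠ[𝓝 p] patchNormal (patch f p) ∘ extChartAt (𝓡 2) p := by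
    filter_upwards [extChartAt_source_mem_nhds (I := 𝓡 2) p] with q hq
    have h3 := (isPositiveParamAt_extChartAt_symm
      ((extChartAt (𝓡 2) p).map_source hq)).unitNormal_eq (h2 _)
    rwa [(extChartAt (𝓡 2) p).left_inv hq] at h3
  have : IsManifold (𝓡 2) n M := IsManifold.of_le (n := ∞) (by exact_mod_cast le_top)
  refine ContMDiffAt.congr_of_eventuallyEq ?_ h1
  refine ContMDiffAt.comp p (I' := 𝓘(ℝ, Plane)) ?_ (contMDiffAt_extChartAt)
  exact (contDiffAt_patchNormal (by exact_mod_cast contDiffAt_patch_coord (hf p))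
    (injective_fderiv_patch ((h2 p).of_le one_le_two) (hi p))).contMDiffAt

end Param

end HarmonicMC

namespace HarmonicMC

/-! ### Inverse functions and ordinary differential equations: regularity -/

theorem exists_contDiffAt_local_inverse {E F : Type*} [NormedAddCommGroup E] [NormedSpace ℝ E]
    [NormedAddCommGroup F] [NormedSpace ℝ F] [FiniteDimensional ℝ E] [FiniteDimensional ℝ F]
    (hEF : Module.finrank ℝ E = Module.finrank ℝ F) {n : WithTop ℕ∞} (hn : n ≠ 0) {f : E → F}
    {x : E} (hf : ContDiffAt ℝ n f x) (hi : Function.Injective (fderiv ℝ f x)) :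
    ∃ g : F → E, ContDiffAt ℝ n g (f x) ∧ (∀ᶠ z in 𝓝 x, g (f z) = z) ∧
      ∀ᶠ w in 𝓝 (f x), f (g w) = w := by
  have : CompleteSpace E := FiniteDimensional.complete ℝ E
  set A : E ≃L[ℝ] F :=
    (LinearMap.linearEquivOfInjective (fderiv ℝ f x : E →ₗ[ℝ] F) hi hEF).toContinuousLinearEquiv
  have hA : (A : E →L[ℝ] F) = fderiv ℝ f x := by ext v; rfl
  have hd : HasFDerivAt f (A : E →L[ℝ] F) x := by
    rw [hA]; exact (hf.differentiableAt hn).hasFDerivAt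
  have hs : HasStrictFDerivAt f (A : E →L[ℝ] F) x := hf.hasStrictFDerivAt' hd hn
  exact ⟨hf.localInverse hd hn, hf.to_localInverse hd hn, hs.eventually_left_inverse,
    hs.eventually_right_inverse⟩

/-- Bootstrapping: if `ζ` is of class `C^m` with `m ≤ n`, then `ζ' = V ∘ ζ` is too, and `ζ` gains
one derivative. -/
theorem contDiffAt_of_deriv_eq_comp {E : Type*} [NormedAddCommGroup E] [NormedSpace ℝ E]
    {ζ : ℝ → E} {V : E → E} {t : ℝ} {n : ℕ} (hV : ContDiffAt ℝ n V (ζ t))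
    (h : ∀ᶠ s in 𝓝 t, HasDerivAt ζ (V (ζ s)) s) : ContDiffAt ℝ (n + 1 : ℕ) ζ t := by
  have key (m : ℕ) (hm : m ≤ n + 1) : ContDiffAt ℝ m ζ t := by
    induction m with
    | zero =>
      have := h.mono fun s hs => hs.continuousAt
      exact (contDiffAt_zero.2 ⟨_, this, fun s hs => ContinuousAt.continuousWithinAt hs⟩)
    | succ m ih =>
      have h1 : ContDiffAt ℝ m (fun s => V (ζ s)) t :=
        (hV.of_le (by exact_mod_cast (by omega : m ≤ n))).comp t (ih (by omega))
      push_cast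
      rw [contDiffAt_succ_iff_hasFDerivAt]
      refine ⟨fun s => ContinuousLinearMap.toSpanSingleton ℝ (V (ζ s)), ⟨_, h, fun s hs => ?_⟩, ?_⟩
      · exact HasDerivAt.hasFDerivAt hs
      · exact (ContinuousLinearMap.toSpanSingletonCLE (𝕜 := ℝ) (E := E)).contDiff.contDiffAt.comp t h1
  exact key _ le_rfl

/-! ### The Weingarten relation -/

section Weingarten

variable {F : Plane → Space} {y : Plane}

/-- Differentiate the identity `⟨N, DF w⟩ = 0` with `w` constant. -/
theorem inner_fderiv_patchNormal (hF : ContDiffAt ℝ 2 F y)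
    (hi : Function.Injective (fderiv ℝ F y)) (u w : Plane) :
    inner ℝ (fderiv ℝ (patchNormal F) y u) (fderiv ℝ F y w) = - secondForm F y u w := by
  have h1 : DifferentiableAt ℝ (patchNormal F) y :=
    (contDiffAt_patchNormal (n := 1) (by simpa [one_add_one_eq_two] using hF) hi).differentiableAt
      one_ne_zero
  have h2 : DifferentiableAt ℝ (fderiv ℝ F) y :=
    (hF.fderiv_right (m := 1) (by norm_num)).differentiableAt one_ne_zero
  have h3 : DifferentiableAt ℝ (fun z => fderiv ℝ F z w) y := h2.clm_apply
    (differentiableAt_const w)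
  have h4 := fderiv_inner_apply (𝕜 := ℝ) h1 h3 u
  have h5 : (fun z => inner ℝ (patchNormal F z) (fderiv ℝ F z w)) = fun _ => (0 : ℝ) :=
    funext fun z => inner_patchNormal F z w
  have h6 : fderiv ℝ (fun z => fderiv ℝ F z w) y u = fderiv ℝ (fderiv ℝ F) y u w := by
    rw [fderiv_clm_apply h2 (differentiableAt_const w)]
    simp
  rw [h5, h6] at h4
  simp only [fderiv_fun_const, Pi.zero_apply, zero_apply] at h4
  rw [secondForm]
  linarith

theorem vec_triple (x y z : Space) :
    vec x (vec y z) = (inner ℝ x z : ℝ) • y - (inner ℝ x y : ℝ) • z := by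
  simp only [inner_eq_sum]
  ext i
  fin_cases i <;>
    simp only [Fin.zero_eta, Fin.mk_one, Fin.reduceFinMk, vec_apply_zero, vec_apply_one,
      vec_apply_two, PiLp.smul_apply, PiLp.sub_apply, smul_eq_mul] <;> ring

/-- If the directions `u`, `b` are orthogonal and conjugate, the geodesic torsion vanishes. -/
theorem patchTorsion_eq_zero (hF : ContDiffAt ℝ 2 F y) (hi : Function.Injective (fderiv ℝ F y))
    {u b : Plane} (hb : b ≠ 0) (h1 : firstForm F y u b = 0) (h2 : secondForm F y u b = 0) :
    patchTorsion F y u = 0 := by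
  set q := fderiv ℝ F y b with hq
  set w := vec (patchNormal F y) (fderiv ℝ F y u) with hw
  have hq0 : q ≠ 0 := fun h0 => hb (hi (h0.trans (map_zero _).symm))
  -- Both `q` and `w` are tangent and orthogonal to `DF u`, hence parallel. The derivative of the
  -- normal along `u` is orthogonal to `q` by conjugacy, hence to `w`.
  have h3 : vec q w = 0 := by
    rw [hw, vec_triple, real_inner_comm, ← firstForm, h1, real_inner_comm, inner_patchNormal]
    simp
  have h4 : inner ℝ (fderiv ℝ (patchNormal F) y u) q = 0 := by
    rw [inner_fderiv_patchNormal hF hi, h2, neg_zero]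
  suffices inner ℝ (fderiv ℝ (patchNormal F) y u) w = 0 by
    rw [patchTorsion, this]; simp
  by_cases hw0 : w = 0
  · rw [hw0, inner_zero_right]
  have h5 := norm_vec_sq q w
  rw [h3, real_inner_self_eq_norm_sq, real_inner_self_eq_norm_sq, norm_zero] at h5
  have h6 : ‖(inner ℝ q w : ℝ)‖ = ‖q‖ * ‖w‖ := by
    rw [Real.norm_eq_abs, ← abs_of_nonneg (by positivity : 0 ≤ ‖q‖ * ‖w‖),
      ← sq_eq_sq_iff_abs_eq_abs]
    nlinarith
  obtain ⟨r, -, hr⟩ := (norm_inner_eq_norm_iff (𝕜 := ℝ) hq0 hw0).1 h6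
  rw [hr, inner_smul_right, h4, mul_zero]

end Weingarten

/-- If `eG + gE = 2fF`, then `4f²F² = (eG + gE)² ≥ 4(eg)(EG)`, which contradicts `eg > f²` and `EG >
F²`. -/
theorem patchMean_ne_zero {F : Plane → Space} {y : Plane}
    (hi : Function.Injective (fderiv ℝ F y)) (hK : 0 < patchGauss F y) : patchMean F y ≠ 0 := by
  have hd := firstDet_pos hi
  have h1 : 0 < secondForm F y (dir 0) (dir 0) * secondForm F y (dir 1) (dir 1)
      - secondForm F y (dir 0) (dir 1) ^ 2 := by
    rw [patchGauss] at hK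
    exact (div_pos_iff_of_pos_right hd).1 hK
  intro h0
  rw [patchMean, div_eq_zero_iff] at h0
  have h2 := h0.resolve_right (by positivity)
  rw [firstDet] at hd
  set e := secondForm F y (dir 0) (dir 0)
  set f := secondForm F y (dir 0) (dir 1)
  set g := secondForm F y (dir 1) (dir 1)
  set a := firstForm F y (dir 0) (dir 0)
  set b := firstForm F y (dir 0) (dir 1)
  set c := firstForm F y (dir 1) (dir 1)
  have h3 : e * c + g * a = 2 * (f * b) := by linarith
  have h4 : 0 < (e * g - f ^ 2) * (a * c - b ^ 2) := mul_pos h1 hd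
  have h5 : (e * c + g * a) ^ 2 = 4 * (f ^ 2 * b ^ 2) := by rw [h3]; ring
  nlinarith [sq_nonneg (e * c - g * a), mul_nonneg (sq_nonneg f) hd.le,
    mul_nonneg (sq_nonneg b) h1.le]

/-! ### Regularity of harmonic mean curvature lines -/

/-- The harmonic mean curvature of a parametrized surface. -/
noncomputable def patchHarmonic (F : Plane → Space) (y : Plane) : ℝ :=
  patchGauss F y / patchMean F y

theorem _root_.ContDiffAt.patchHarmonic {E : Type*} [NormedAddCommGroup E] [NormedSpace ℝ E]
    {n : WithTop ℕ∞} {F : Plane → Space} {y : E → Plane} {x : E}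
    (hF : ContDiffAt ℝ (n + 2) F (y x)) (hi : Function.Injective (fderiv ℝ F (y x)))
    (hm : patchMean F (y x) ≠ 0) (hy : ContDiffAt ℝ n y x) :
    ContDiffAt ℝ n (fun z => patchHarmonic F (y z)) x :=
  (hF.patchGauss hi hy).div (hF.patchMean hi hy) hm

theorem hasDerivAt_quadratic (a b c : ℝ) : HasDerivAt (fun t : ℝ => a + t * b + t ^ 2 * c) b 0 := by
  have := (((hasDerivAt_id (0 : ℝ)).mul_const b).const_add a).fun_add
    (((hasDerivAt_id (0 : ℝ)).fun_pow 2).mul_const c)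
  simpa using this

/-- A curve of unit speed with `k_n = 𝒦/ℋ` and nonzero geodesic torsion solves an ordinary
differential equation, and is of class `C^{n+1}` on a surface of class `C^{n+2}`. -/
theorem contDiffAt_of_isHarmonic {n : ℕ} (hn : n ≠ 0) {F : Plane → Space} {ζ : ℝ → Plane} {t : ℝ}
    (hF : ContDiffAt ℝ (n + 2 : ℕ) F (ζ t)) (hi : Function.Injective (fderiv ℝ F (ζ t)))
    (hm : patchMean F (ζ t) ≠ 0) (hζ : ContDiffAt ℝ 1 ζ t)
    (h1 : ∀ᶠ s in 𝓝 t, firstForm F (ζ s) (deriv ζ s) (deriv ζ s) = 1)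
    (h2 : ∀ᶠ s in 𝓝 t, secondForm F (ζ s) (deriv ζ s) (deriv ζ s) = patchHarmonic F (ζ s))
    (h3 : patchTorsion F (ζ t) (deriv ζ t) ≠ 0) : ContDiffAt ℝ (n + 1 : ℕ) ζ t := by
  -- The two equations satisfied by the velocity, unit speed and `k_n = 𝒦/ℋ`, say that `Θ (ζ, ζ') =
  -- (ζ, (1, 0))`. The inverse function theorem for `Θ` solves them for `ζ'`.
  set Θ : Plane × Plane → Plane × (ℝ × ℝ) := fun x => (x.1, (firstForm F x.1 x.2 x.2,
    secondForm F x.1 x.2 x.2 - patchHarmonic F x.1 * firstForm F x.1 x.2 x.2)) with hΘ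
  set x₀ : Plane × Plane := (ζ t, deriv ζ t) with hx₀
  have hF2 : ContDiffAt ℝ 2 F (ζ t) := hF.of_le (by exact_mod_cast (by omega : 2 ≤ n + 2))
  have hF' : ContDiffAt ℝ (n + 2) F (ζ t) := by exact_mod_cast hF
  have hF1 : ContDiffAt ℝ (n + 1) F (ζ t) :=
    hF'.of_le (by exact_mod_cast (by omega : n + 1 ≤ n + 2))
  have hc : ContDiffAt ℝ n Θ x₀ := by
    have hI := hF1.firstForm (x := x₀) (y := Prod.fst) (u := Prod.snd) (w := Prod.snd)
      contDiffAt_fst contDiffAt_snd contDiffAt_snd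
    have hII := hF'.secondForm (x := x₀) (y := Prod.fst) (u := Prod.snd) (w := Prod.snd) hi
      contDiffAt_fst contDiffAt_snd contDiffAt_snd
    have hk := hF'.patchHarmonic (x := x₀) (y := Prod.fst) hi hm contDiffAt_fst
    exact contDiffAt_fst.prodMk (hI.prodMk (hII.sub (hk.mul hI)))
  have hn' : (n : WithTop ℕ∞) ≠ 0 := by exact_mod_cast hn
  have hd := hc.differentiableAt hn'
  -- A kernel vector has base component zero, and its direction component `b` satisfies `I(u, b) =
  -- 0` and `II(u, b) = 0` for `u = ζ'`. For `b ≠ 0` this would force the geodesic torsion in the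
  -- direction `u` to vanish.
  have hinj : Function.Injective (fderiv ℝ Θ x₀) := by
    rw [injective_iff_map_eq_zero]
    rintro ⟨a, b⟩ hab
    have ha : a = 0 := by
      have e1 : fderiv ℝ (fun x => (Θ x).1) x₀ = fderiv ℝ Prod.fst x₀ := rfl
      have e2 := (hd.hasFDerivAt.fst).fderiv
      rw [e1, fderiv_fst] at e2
      have := congrArg (fun B : Plane × Plane →L[ℝ] Plane => B (a, b)) e2
      simpa [hab] using this
    subst ha
    by_contra hb
    have hb' : b ≠ 0 := fun h => hb (by rw [h]; rfl)
    have hline : HasDerivAt (fun s : ℝ => x₀ + s • ((0, b) : Plane × Plane)) (0, b) 0 := by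
      simpa using ((hasDerivAt_id (0 : ℝ)).smul_const ((0, b) : Plane × Plane)).const_add x₀
    have hcurve : HasDerivAt (fun s : ℝ => Θ (x₀ + s • ((0, b) : Plane × Plane))) 0 0 := by
      rw [← hab]
      have hd' : HasFDerivAt Θ (fderiv ℝ Θ x₀) (x₀ + (0 : ℝ) • ((0, b) : Plane × Plane)) := by
        simpa using hd.hasFDerivAt
      exact hd'.comp_hasDerivAt 0 hline
    have hsnd : HasDerivAt (fun s : ℝ => (Θ (x₀ + s • ((0, b) : Plane × Plane))).2) 0 0 :=
      ((ContinuousLinearMap.snd ℝ Plane (ℝ × ℝ)).hasFDerivAt.comp_hasDerivAt 0 hcurve).congr_deriv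
        rfl
    have hI : HasDerivAt (fun s : ℝ => (Θ (x₀ + s • ((0, b) : Plane × Plane))).2.1) 0 0 :=
      ((ContinuousLinearMap.fst ℝ ℝ ℝ).hasFDerivAt.comp_hasDerivAt 0 hsnd).congr_deriv rfl
    have hII : HasDerivAt (fun s : ℝ => (Θ (x₀ + s • ((0, b) : Plane × Plane))).2.2) 0 0 :=
      ((ContinuousLinearMap.snd ℝ ℝ ℝ).hasFDerivAt.comp_hasDerivAt 0 hsnd).congr_deriv rfl
    set u := deriv ζ t
    have eI (s : ℝ) : firstForm F (ζ t) (u + s • b) (u + s • b) =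
        firstForm F (ζ t) u u + s * (2 * firstForm F (ζ t) u b)
          + s ^ 2 * firstForm F (ζ t) b b := by
      simp only [firstForm, map_add, map_smul, inner_add_left, inner_add_right, inner_smul_left,
        inner_smul_right, conj_trivial]
      rw [real_inner_comm (fderiv ℝ F (ζ t) u) (fderiv ℝ F (ζ t) b)]
      ring
    have eII (s : ℝ) : secondForm F (ζ t) (u + s • b) (u + s • b) =
        secondForm F (ζ t) u u + s * (2 * secondForm F (ζ t) u b)
          + s ^ 2 * secondForm F (ζ t) b b := by
      have hc := secondForm_comm hF2 b u
      simp only [secondForm, map_add, map_smul, inner_add_right, add_apply,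
        inner_smul_right, smul_apply] at hc ⊢
      rw [hc]
      ring
    have d1 : 2 * firstForm F (ζ t) u b = 0 := by
      refine (hasDerivAt_quadratic _ _ (firstForm F (ζ t) b b)).unique
        (f := fun s : ℝ => firstForm F (ζ t) u u + s * (2 * firstForm F (ζ t) u b)
          + s ^ 2 * firstForm F (ζ t) b b) ?_
      simp only [← eI]
      simpa [hΘ, hx₀] using hI
    have d2 : 2 * secondForm F (ζ t) u b = 0 := by
      refine (hasDerivAt_quadratic _ _ (secondForm F (ζ t) b b)).unique
        (f := fun s : ℝ => secondForm F (ζ t) u u + s * (2 * secondForm F (ζ t) u b)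
          + s ^ 2 * secondForm F (ζ t) b b) ?_
      simp only [← eII]
      have e1 := hII.fun_add (hI.const_mul (patchHarmonic F (ζ t)))
      simpa [hΘ, hx₀] using e1
    exact h3 (patchTorsion_eq_zero hF2 hi hb' (by linarith) (by linarith))
  obtain ⟨g, hg, hg1, -⟩ := exists_contDiffAt_local_inverse (by simp) hn' hc hinj
  have e0 : Θ x₀ = (ζ t, (1, 0)) := by
    have i1 := h1.self_of_nhds
    have i2 := h2.self_of_nhds
    simp [hΘ, hx₀, i1, i2]
  -- The local inverse recovers the velocity as a `C^n` vector field evaluated along the curve.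
  refine contDiffAt_of_deriv_eq_comp (V := fun y => (g (y, (1, 0))).2) ?_ ?_
  · rw [e0] at hg
    exact contDiffAt_snd.comp _ (hg.comp (ζ t) (contDiffAt_id.prodMk contDiffAt_const))
  · have hcont : ContinuousAt (fun s => (ζ s, deriv ζ s)) t :=
      hζ.continuousAt.prodMk (by
        have := (hζ.continuousAt_fderiv one_ne_zero)
        exact this.clm_apply continuousAt_const)
    filter_upwards [h1, h2, hcont.eventually hg1, hζ.eventually (by simp)] with s i1 i2 i3 i4
    have e1 : Θ (ζ s, deriv ζ s) = (ζ s, (1, 0)) := by simp [hΘ, i1, i2]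
    rw [e1] at i3
    rw [i3]
    exact (i4.differentiableAt one_ne_zero).hasDerivAt

variable {M : Type*} [TopologicalSpace M] [ChartedSpace Plane M] [IsManifold (𝓡 2) ∞ M]

omit [IsManifold (𝓡 2) ∞ M] in
theorem contMDiffAt_curve_iff {n : WithTop ℕ∞} {γ : ℝ → M} {t : ℝ} :
    ContMDiffAt 𝓘(ℝ, ℝ) (𝓡 2) n γ t ↔
      ContinuousAt γ t ∧ ContDiffAt ℝ n (extChartAt (𝓡 2) (γ t) ∘ γ) t := by
  rw [contMDiffAt_iff]
  simp only [mfld_simps, contDiffWithinAt_univ]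
  rfl

theorem contMDiff_of_isHarmonicLineOn [OrientedAtlas M] {n : ℕ} (hn : n ≠ 0) {α : M → Space}
    (hα : IsImmersionOfClass (n + 2) α) {i : Family} {c : ℝ → M}
    (hc : IsHarmonicLineOn i α c univ) (ha : ∀ s, ‖deriv (α ∘ c) s‖ = 1) :
    ContMDiff 𝓘(ℝ, ℝ) (𝓡 2) (n + 1 : ℕ) c := by
  intro t
  have hc1 : ContMDiff 𝓘(ℝ, ℝ) (𝓡 2) 1 c := contMDiffOn_univ.1 hc.contMDiffOn
  have hα2 : ContMDiff (𝓡 2) 𝓘(ℝ, Space) 2 α :=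
    hα.1.of_le (by exact_mod_cast (by omega : 2 ≤ n + 2))
  set p := c t with hp
  set ζ := extChartAt (𝓡 2) p ∘ c with hζ
  have hsrc : ∀ᶠ s in 𝓝 t, c s ∈ (extChartAt (𝓡 2) p).source :=
    hc1.continuous.continuousAt.eventually (extChartAt_source_mem_nhds (I := 𝓡 2) p)
  have hζ1 : ContDiffAt ℝ 1 ζ t := ((contMDiffAt_curve_iff).1 (hc1 t)).2
  have hcζ : ∀ᶠ s in 𝓝 t, c =ᶠ[𝓝 s] (extChartAt (𝓡 2) p).symm ∘ ζ := by
    filter_upwards [hsrc.eventually_nhds] with s hs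
    filter_upwards [hs] with s' hs'
    simp only [hζ, Function.comp_apply]
    rw [(extChartAt (𝓡 2) p).left_inv hs']
  have hpar : ∀ᶠ s in 𝓝 t, IsPositiveParamAt (extChartAt (𝓡 2) p).symm (ζ s) := by
    filter_upwards [hsrc] with s hs
    exact isPositiveParamAt_extChartAt_symm ((extChartAt (𝓡 2) p).map_source hs)
  have hder : ∀ᶠ s in 𝓝 t, HasDerivAt ζ (deriv ζ s) s :=
    (hζ1.eventually (by simp)).mono fun s hs => (hs.differentiableAt one_ne_zero).hasDerivAt
  have hfirst : ∀ᶠ s in 𝓝 t, firstForm (patch α p) (ζ s) (deriv ζ s) (deriv ζ s) = 1 := by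
    filter_upwards [hcζ, hpar, hder] with s i1 i2 i3
    have e1 : α ∘ c =ᶠ[𝓝 s] patch α p ∘ ζ := i1.fun_comp α
    have e2 := ((i2.contDiffAt_comp (hα2 _)).differentiableAt two_ne_zero).hasFDerivAt
      |>.comp_hasDerivAt s i3
    have e3 := ha s
    rw [e1.deriv_eq, patch, Function.comp_assoc]  at e3
    rw [firstForm, real_inner_self_eq_norm_sq]
    have e4 : deriv (α ∘ ↑(extChartAt (𝓡 2) p).symm ∘ ζ) s =
      fderiv ℝ (patch α p) (ζ s) (deriv ζ s) := e2.deriv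
    rw [← e4, e3, one_pow]
  have hself : ζ t = coord p := rfl
  have hi : Function.Injective (fderiv ℝ (patch α p) (ζ t)) :=
    injective_fderiv_patch (hα2.of_le one_le_two p) (hα.2 p)
  refine contMDiffAt_curve_iff.2 ⟨hc1.continuous.continuousAt,
    contDiffAt_of_isHarmonic (F := patch α p) hn (contDiffAt_patch_coord (hα.1 p)) hi ?_ hζ1
      hfirst ?_ ?_⟩
  · exact patchMean_ne_zero hi (hc.elliptic t trivial)
  · filter_upwards [hcζ, hpar, hder, hfirst] with s i1 i2 i3 i4
    have h0 : c s = (extChartAt (𝓡 2) p).symm (ζ s) := i1.eq_of_nhds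
    have e1 := i2.normalCurvature_eq (hα2 _) i3 i1
    have e2 : gauss α (c s) = _ := h0 ▸ i2.gauss_eq (hα2 _)
    have e3 : mean α (c s) = _ := h0 ▸ i2.mean_eq (hα2 _)
    have e4 := hc.normalCurvature_eq s trivial
    rw [e1, harmonicMean, e2, e3, patchNormalCurvature] at e4
    have i4' : firstForm (α ∘ (extChartAt (𝓡 2) p).symm) (ζ s) (deriv ζ s) (deriv ζ s) = 1 := i4
    rw [i4', div_one] at e4
    exact e4
  · have e1 := hpar.self_of_nhds.geodesicTorsion_eq (hα2 _) (hα.2 _) hder.self_of_nhds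
      hcζ.self_of_nhds
    have e2 := hc.torsion_sign t trivial
    rw [e1] at e2
    intro h
    have h' : patchTorsion (α ∘ (extChartAt (𝓡 2) p).symm) (ζ t) (deriv ζ t) = 0 := h
    rw [h'] at e2
    cases i <;> exact lt_irrefl _ e2

end HarmonicMC

namespace HarmonicMC

variable {M : Type*} [TopologicalSpace M] [ChartedSpace Plane M]

/-! ### The frame along a curve -/

section Frame

variable [IsManifold (𝓡 2) ∞ M]

omit [IsManifold (𝓡 2) ∞ M] in
theorem IsPositiveParamAt.of_comp {Y Z : Plane → M} {φ : Plane → Plane} {y : Plane}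
    (hZ : IsPositiveParamAt Z (φ y)) (hφ : ContDiffAt ℝ 2 φ y) (hd : 0 < (fderiv ℝ φ y).det)
    (h : Y =ᶠ[𝓝 y] Z ∘ φ) : IsPositiveParamAt Y y := by
  have h0 : Y y = Z (φ y) := h.eq_of_nhds
  have h1 : extChartAt (𝓡 2) (Y y) ∘ Y =ᶠ[𝓝 y] (extChartAt (𝓡 2) (Z (φ y)) ∘ Z) ∘ φ := by
    rw [h0]
    exact h.fun_comp _
  refine ⟨(ContinuousAt.comp hZ.continuousAt hφ.continuousAt).congr h.symm,
    (hZ.contDiffAt.comp y hφ).congr_of_eventuallyEq h1, ?_⟩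
  rw [h1.fderiv_eq, fderiv_comp y (hZ.contDiffAt.differentiableAt two_ne_zero)
    (hφ.differentiableAt two_ne_zero), ContinuousLinearMap.det]
  rw [ContinuousLinearMap.toLinearMap_comp, LinearMap.det_comp]
  exact mul_pos hZ.det_pos hd

/-- Near `y` the map `Y` is the inverse of one fixed chart, which is a positive parametrization at
all its points, composed with a coordinate expression whose Jacobian stays positive. -/
theorem IsPositiveParamAt.eventually [OrientedAtlas M] {Y : Plane → M} {y : Plane}
    (hY : IsPositiveParamAt Y y) : ∀ᶠ z in 𝓝 y, IsPositiveParamAt Y z := by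
  have hsrc := (hY.continuousAt.eventually
    (extChartAt_source_mem_nhds (I := 𝓡 2) (Y y))).eventually_nhds
  filter_upwards [hsrc, hY.contDiffAt.eventually (by simp),
    eventually_det_pos (hY.contDiffAt.of_le one_le_two) hY.det_pos] with z h1 h2 h3
  refine (isPositiveParamAt_extChartAt_symm
    ((extChartAt (𝓡 2) (Y y)).map_source h1.self_of_nhds)).of_comp h2 h3 ?_
  filter_upwards [h1] with w hw
  simp only [Function.comp_apply]
  rw [(extChartAt (𝓡 2) (Y y)).left_inv hw]

theorem exists_param [OrientedAtlas M] {γ : ℝ → M} {t : ℝ}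
    (hγ : ContMDiffAt 𝓘(ℝ, ℝ) (𝓡 2) 1 γ t) :
    ∃ (Y : Plane → M) (ζ : ℝ → Plane) (u : Plane), IsPositiveParamAt Y (ζ t) ∧
      HasDerivAt ζ u t ∧ γ =ᶠ[𝓝 t] Y ∘ ζ := by
  obtain ⟨h1, h2⟩ := contMDiffAt_curve_iff.1 hγ
  refine ⟨(extChartAt (𝓡 2) (γ t)).symm, extChartAt (𝓡 2) (γ t) ∘ γ, _,
    isPositiveParamAt_extChartAt_symm (mem_extChartAt_target (γ t)),
    (h2.differentiableAt one_ne_zero).hasDerivAt, ?_⟩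
  filter_upwards [h1.eventually (extChartAt_source_mem_nhds (I := 𝓡 2) (γ t))] with s hs
  simp only [Function.comp_apply]
  rw [(extChartAt (𝓡 2) (γ t)).left_inv hs]

theorem IsPositiveParamAt.deriv_comp_eq {Y : Plane → M} {f : M → Space} {γ : ℝ → M} {ζ : ℝ → Plane}
    {t : ℝ} {u : Plane} (hY : IsPositiveParamAt Y (ζ t))
    (hf : ContMDiffAt (𝓡 2) 𝓘(ℝ, Space) 2 f (Y (ζ t)))
    (hζ : HasDerivAt ζ u t) (hγ : γ =ᶠ[𝓝 t] Y ∘ ζ) :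
    deriv (f ∘ γ) t = fderiv ℝ (f ∘ Y) (ζ t) u := by
  rw [(hγ.fun_comp f).deriv_eq, ← Function.comp_assoc]
  exact (((hY.contDiffAt_comp hf).differentiableAt two_ne_zero).hasFDerivAt.comp_hasDerivAt t
    hζ).deriv

variable [OrientedAtlas M] {f : M → Space}

theorem inner_unitNormal_deriv (hf : ContMDiff (𝓡 2) 𝓘(ℝ, Space) 2 f) {γ : ℝ → M} {t : ℝ}
    (hγ : ContMDiffAt 𝓘(ℝ, ℝ) (𝓡 2) 1 γ t) :
    inner ℝ (unitNormal f (γ t)) (deriv (f ∘ γ) t) = 0 := by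
  obtain ⟨Y, ζ, u, hY, hζ, h⟩ := exists_param hγ
  have h0 : γ t = Y (ζ t) := h.eq_of_nhds
  rw [hY.deriv_comp_eq (hf _) hζ h, h0, hY.unitNormal_eq (hf _), inner_patchNormal]

/-- The right hand side involves only the curve and the normal along it and no chart. It is the
source of the smoothness and periodicity of `τ_g`, hence of `A₁`. -/
theorem geodesicTorsion_eq_inner (hf : ContMDiff (𝓡 2) 𝓘(ℝ, Space) 2 f)
    (hi : ∀ p, Function.Injective (mfderiv (𝓡 2) 𝓘(ℝ, Space) f p)) {γ : ℝ → M} {t : ℝ}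
    (hγ : ContMDiffAt 𝓘(ℝ, ℝ) (𝓡 2) 1 γ t) (ha : ‖deriv (f ∘ γ) t‖ = 1) :
    geodesicTorsion f γ t = - inner ℝ (deriv (fun s => unitNormal f (γ s)) t)
      (vec (unitNormal f (γ t)) (deriv (f ∘ γ) t)) := by
  obtain ⟨Y, ζ, u, hY, hζ, h⟩ := exists_param hγ
  have h0 : γ t = Y (ζ t) := h.eq_of_nhds
  have hinj := hY.injective_fderiv (hf _) (hi _)
  have h1 : (fun s => unitNormal f (γ s)) =ᶠ[𝓝 t] patchNormal (f ∘ Y) ∘ ζ := by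
    filter_upwards [h, hζ.continuousAt.eventually hY.eventually] with s h2 h3
    rw [h2, Function.comp_apply, h3.unitNormal_eq (hf _), Function.comp_apply]
  have h2 : DifferentiableAt ℝ (patchNormal (f ∘ Y)) (ζ t) :=
    (contDiffAt_patchNormal (n := 1)
      (by simpa [one_add_one_eq_two] using hY.contDiffAt_comp (hf _)) hinj).differentiableAt
      one_ne_zero
  have h3 := hY.deriv_comp_eq (hf _) hζ h
  rw [h3] at ha
  rw [h1.deriv_eq, (h2.hasFDerivAt.comp_hasDerivAt t hζ).deriv, h3, h0,
    hY.unitNormal_eq (hf _), hY.geodesicTorsion_eq (hf _) (hi _) hζ h, patchTorsion, firstForm,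
    real_inner_self_eq_norm_sq, ha]
  simp

end Frame

theorem norm_unitNormal {f : M → Space} (hf : ContMDiff (𝓡 2) 𝓘(ℝ, Space) 1 f)
    (hi : ∀ p, Function.Injective (mfderiv (𝓡 2) 𝓘(ℝ, Space) f p)) (p : M) :
    ‖unitNormal f p‖ = 1 :=
  norm_patchNormal (injective_fderiv_patch (hf p) (hi p))

/-! ### Tubular coordinates -/

/-- The coordinates `(s, v, z) ↦ γ(s) + v W(s) + z N(s)` around a curve of space. -/
noncomputable def tube (γ W N : ℝ → Space) (x : ℝ × ℝ × ℝ) : Space :=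
  γ x.1 + x.2.1 • W x.1 + x.2.2 • N x.1

section Tube

variable {γ W N : ℝ → Space}

theorem contDiff_tube {n : WithTop ℕ∞} (hγ : ContDiff ℝ n γ) (hW : ContDiff ℝ n W)
    (hN : ContDiff ℝ n N) : ContDiff ℝ n (tube γ W N) :=
  ((hγ.comp contDiff_fst).add ((contDiff_fst.comp contDiff_snd).smul (hW.comp contDiff_fst))).add
    ((contDiff_snd.comp contDiff_snd).smul (hN.comp contDiff_fst))

theorem fderiv_tube_apply (hγ : ContDiff ℝ 1 γ) (hW : ContDiff ℝ 1 W)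
    (hN : ContDiff ℝ 1 N) (x d : ℝ × ℝ × ℝ) :
    fderiv ℝ (tube γ W N) x d =
      d.1 • (deriv γ x.1 + x.2.1 • deriv W x.1 + x.2.2 • deriv N x.1) + d.2.1 • W x.1
        + d.2.2 • N x.1 := by
  have hdiff : DifferentiableAt ℝ (tube γ W N) x :=
    (contDiff_tube hγ hW hN).differentiable one_ne_zero x
  have hline : HasDerivAt (fun t : ℝ => x + t • d) d 0 := by
    simpa using ((hasDerivAt_id (0 : ℝ)).smul_const d).const_add x
  have h1 : HasDerivAt (fun t : ℝ => tube γ W N (x + t • d)) (fderiv ℝ (tube γ W N) x d) 0 := by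
    have hd' : HasFDerivAt (tube γ W N) (fderiv ℝ (tube γ W N) x) (x + (0 : ℝ) • d) := by
      simpa using hdiff.hasFDerivAt
    exact hd'.comp_hasDerivAt 0 hline
  have ha (a b : ℝ) : HasDerivAt (fun t : ℝ => a + t * b) b 0 := by
    simpa using ((hasDerivAt_id (0 : ℝ)).mul_const b).const_add a
  have hc {g : ℝ → Space} (hg : ContDiff ℝ 1 g) :
      HasDerivAt (fun t : ℝ => g (x.1 + t * d.1)) (d.1 • deriv g x.1) 0 := by
    have h2 : HasDerivAt g (deriv g x.1) (x.1 + 0 * d.1) := by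
      simpa using (hg.differentiable one_ne_zero x.1).hasDerivAt
    exact h2.scomp 0 (ha x.1 d.1)
  have h2 := ((hc hγ).fun_add ((ha x.2.1 d.2.1).fun_smul (hc hW))).fun_add
    ((ha x.2.2 d.2.2).fun_smul (hc hN))
  have h3 := h1.unique h2
  rw [h3]
  simp only [zero_mul, add_zero, smul_add, smul_smul]
  rw [mul_comm d.1 x.2.1, mul_comm d.1 x.2.2]
  abel

/-- The differential is triangular in the frame `T, W, N`. Pairing a kernel vector with `T` removes
the `W` and `N` terms and leaves `d.1` times the displayed factor; then `W` and `N` remove the other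
two components. -/
theorem injective_fderiv_tube (hγ : ContDiff ℝ 1 γ) (hW : ContDiff ℝ 1 W)
    (hN : ContDiff ℝ 1 N) (x : ℝ × ℝ × ℝ) (hTN : inner ℝ (N x.1) (deriv γ x.1) = 0)
    (hWT : inner ℝ (W x.1) (deriv γ x.1) = 0) (hWN : inner ℝ (W x.1) (N x.1) = 0)
    (hT1 : ‖deriv γ x.1‖ = 1) (hN1 : ‖N x.1‖ = 1) (hW1 : ‖W x.1‖ = 1)
    (h : 1 + x.2.1 * inner ℝ (deriv W x.1) (deriv γ x.1)
      + x.2.2 * inner ℝ (deriv N x.1) (deriv γ x.1) ≠ 0) :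
    Function.Injective (fderiv ℝ (tube γ W N) x) := by
  rw [injective_iff_map_eq_zero]
  intro d hd
  rw [fderiv_tube_apply hγ hW hN] at hd
  have h1 : d.1 = 0 := by
    have := congrArg (fun z => inner ℝ z (deriv γ x.1)) hd
    simp only [inner_add_left, inner_smul_left, real_inner_self_eq_norm_sq, hT1, hTN, hWT,
      inner_zero_left, conj_trivial] at this
    have h2 : d.1 * (1 + x.2.1 * inner ℝ (deriv W x.1) (deriv γ x.1)
      + x.2.2 * inner ℝ (deriv N x.1) (deriv γ x.1)) = 0 := by linarith
    exact (mul_eq_zero.1 h2).resolve_right h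
  rw [h1, zero_smul, zero_add] at hd
  have h2 : d.2.1 = 0 := by
    have := congrArg (fun z => inner ℝ (W x.1) z) hd
    simpa [inner_add_right, inner_smul_right, hWN, hW1] using this
  have h3 : d.2.2 = 0 := by
    have := congrArg (fun z => inner ℝ z (N x.1)) hd
    simpa [inner_add_left, inner_smul_left, hWN, hN1] using this
  ext <;> simp [h1, h2, h3]

end Tube

end HarmonicMC

/-! ### Regularity of the frame along a cycle and of an adapted chart. -/

namespace HarmonicMC

variable {M : Type*} [TopologicalSpace M] [ChartedSpace Plane M]

/-- The conormal `N ∧ T` of a curve on a surface. -/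
noncomputable def conormal (α : M → Space) (c : ℝ → M) (s : ℝ) : Space :=
  vec (unitNormal α (c s)) (tangent α c s)

theorem periodic_deriv {E : Type*} [NormedAddCommGroup E] [NormedSpace ℝ E] {f : ℝ → E} {L : ℝ}
    (h : Function.Periodic f L) : Function.Periodic (deriv f) L := fun s => by
  rw [← deriv_comp_add_const]
  exact congrFun (congrArg deriv (funext h)) s

section Cycle

variable [IsManifold (𝓡 2) ∞ M] [OrientedAtlas M] {n : ℕ} {α : M → Space} {c : ℝ → M} {L : ℝ}
  {i : Family}

section Frame

variable (hα : IsImmersionOfClass (n + 2) α) (hc : IsHarmonicCycle i α c L)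

omit [IsManifold (𝓡 2) ∞ M] [OrientedAtlas M] in
include hα in
theorem IsImmersionOfClass.contMDiff_two : ContMDiff (𝓡 2) 𝓘(ℝ, Space) 2 α :=
  hα.1.of_le (by exact_mod_cast (by omega : 2 ≤ n + 2))

omit [IsManifold (𝓡 2) ∞ M] [OrientedAtlas M] in
include hc in
theorem IsHarmonicCycle.contMDiff_one : ContMDiff 𝓘(ℝ, ℝ) (𝓡 2) 1 c :=
  contMDiffOn_univ.1 hc.line.contMDiffOn

include hα hc

/-- The cycle is of class `C^{n+1}` because its harmonic line equation is an ordinary differential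
equation. -/
theorem IsHarmonicCycle.contDiff_comp (hn : n ≠ 0) : ContDiff ℝ (n + 1) (α ∘ c) := by
  rw [← contMDiff_iff_contDiff]
  exact (hα.1.of_le (by exact_mod_cast (by omega : n + 1 ≤ n + 2))).comp
    (by exact_mod_cast contMDiff_of_isHarmonicLineOn hn hα hc.line hc.arcLength)

theorem IsHarmonicCycle.contDiff_unitNormal (hn : n ≠ 0) :
    ContDiff ℝ (n + 1) (fun s => unitNormal α (c s)) := by
  rw [← contMDiff_iff_contDiff]
  exact (contMDiff_unitNormal (n := n + 1) (by omega) hα.1 hα.2).comp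
    (by exact_mod_cast contMDiff_of_isHarmonicLineOn hn hα hc.line hc.arcLength)

theorem IsHarmonicCycle.contDiff_tangent (hn : n ≠ 0) : ContDiff ℝ n (tangent α c) :=
  (contDiff_succ_iff_deriv.1 (hc.contDiff_comp hα hn)).2.2

theorem IsHarmonicCycle.contDiff_conormal (hn : n ≠ 0) : ContDiff ℝ n (conormal α c) :=
  contDiff_vec.comp (((hc.contDiff_unitNormal hα hn).of_le le_self_add).prodMk
    (hc.contDiff_tangent hα hn))

theorem IsHarmonicCycle.inner_normal_tangent (s : ℝ) :
    inner ℝ (unitNormal α (c s)) (tangent α c s) = 0 :=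
  inner_unitNormal_deriv hα.contMDiff_two (hc.contMDiff_one s)

theorem IsHarmonicCycle.geodesicTorsion_eq (s : ℝ) : geodesicTorsion α c s =
    - inner ℝ (deriv (fun s => unitNormal α (c s)) s) (conormal α c s) :=
  geodesicTorsion_eq_inner hα.contMDiff_two hα.2 (hc.contMDiff_one s) (hc.arcLength s)

theorem IsHarmonicCycle.contDiff_torsion (hn : n ≠ 0) :
    ContDiff ℝ n (geodesicTorsion α c) := by
  rw [funext (hc.geodesicTorsion_eq hα)]
  exact ((contDiff_succ_iff_deriv.1 (hc.contDiff_unitNormal hα hn)).2.2.inner ℝ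
    (hc.contDiff_conormal hα hn)).neg

theorem IsHarmonicCycle.periodic_torsion : Function.Periodic (geodesicTorsion α c) L := by
  intro s
  rw [hc.geodesicTorsion_eq hα, hc.geodesicTorsion_eq hα, conormal, conormal, tangent, tangent,
    periodic_deriv (fun s => congrArg (unitNormal α) (hc.periodic s)) s,
    periodic_deriv (fun s => congrArg α (hc.periodic s)) s, hc.periodic s]

theorem IsHarmonicCycle.norm_conormal (s : ℝ) : ‖conormal α c s‖ = 1 := by
  have h := norm_vec_sq (unitNormal α (c s)) (tangent α c s)
  rw [hc.inner_normal_tangent hα, real_inner_self_eq_norm_sq, real_inner_self_eq_norm_sq,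
    norm_unitNormal (hα.contMDiff_two.of_le one_le_two) hα.2, tangent, hc.arcLength] at h
  have h0 := norm_nonneg (conormal α c s)
  rw [conormal, tangent] at h0 ⊢
  nlinarith

/-- This identity fixes the orientation of an adapted chart, since `α_s = T` and `α_v = N ∧ T` on
the axis. -/
theorem IsHarmonicCycle.vec_tangent_conormal (s : ℝ) :
    vec (tangent α c s) (conormal α c s) = unitNormal α (c s) := by
  rw [conormal, vec_triple, real_inner_comm (unitNormal α (c s)), hc.inner_normal_tangent hα,
    real_inner_self_eq_norm_sq, tangent, hc.arcLength]
  simp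

end Frame

/-! ### The adapted chart -/

section Chart

variable {k : ℕ} {η : ℝ} {X : ℝ × ℝ → M}

/-- The height of the surface over its tangent developable in an adapted chart. -/
noncomputable def height (α : M → Space) (c : ℝ → M) (X : ℝ × ℝ → M) (x : ℝ × ℝ) : ℝ :=
  inner ℝ (α (X x) - α (c x.1)) (unitNormal α (c x.1))

omit [IsManifold (𝓡 2) ∞ M] [OrientedAtlas M] in
theorem IsAdaptedChart.continuousAt (hX : IsAdaptedChart k α c L η X) {x : ℝ × ℝ} (hx : x.2 ∈ Ioo (-η) η) :
    ContinuousAt X x := by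
  obtain ⟨Φ, h1, h2⟩ := hX.localDiffeo ⟨x, mem_univ _, hx⟩
  exact ((Φ.contMDiffOn_toFun.contMDiffAt (Φ.open_source.mem_nhds h1)).continuousAt).congr
    (h2.symm.eventuallyEq_of_mem (Φ.open_source.mem_nhds h1))

variable (hα : IsImmersionOfClass (n + 2) α) (hc : IsHarmonicCycle i α c L)
  (hX : IsAdaptedChart k α c L η X)

include hα hc hX

omit [IsManifold (𝓡 2) ∞ M] [OrientedAtlas M] hc in
theorem IsAdaptedChart.eq_tube {x : ℝ × ℝ} (hx : x.2 ∈ Ioo (-η) η) : α (X x) =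
    tube (α ∘ c) (conormal α c) (fun s => unitNormal α (c s)) (x.1, x.2, height α c X x) := by
  obtain ⟨A, B, -, -, -, hform⟩ := hX.form
  have h := hform x.1 x.2 hx
  rw [Prod.mk.eta] at h
  set b := (2 * mean α (c x.1) - harmonicMean α (c x.1)) * (x.2 ^ 2 / 2) + A x.1 / 6 * x.2 ^ 3
            + x.2 ^ 3 * B x
  have h1 : height α c X x = b := by
    rw [height, h, add_assoc, add_sub_cancel_left, inner_add_left, inner_smul_left,
      inner_smul_left, inner_vec_left, real_inner_self_eq_norm_sq,
      norm_unitNormal (hα.contMDiff_two.of_le one_le_two) hα.2]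
    simp
  rw [tube, h1, h]
  rfl

omit hα hc in
omit [IsManifold (𝓡 2) ∞ M] [OrientedAtlas M] in
theorem IsAdaptedChart.height_axis (s : ℝ) : height α c X (s, 0) = 0 := by
  rw [height, hX.axis, sub_self, inner_zero_left]

/-- Near the axis of an adapted chart, the tubular coordinates are regular. -/
theorem IsAdaptedChart.exists_regular (hn : 2 ≤ n) : ∃ η₀ : ℝ, 0 < η₀ ∧ η₀ ≤ η ∧
    ∀ s, ∀ v ∈ Ioo (-η₀) η₀, Function.Injective (fderiv ℝ
      (tube (α ∘ c) (conormal α c) (fun s => unitNormal α (c s)))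
        (s, v, height α c X (s, v))) := by
  have hn0 : n ≠ 0 := by omega
  set N := fun s => unitNormal α (c s) with hN
  set W := conormal α c with hW
  set T := tangent α c with hT
  have cγ := hc.contDiff_comp hα hn0
  have cN := hc.contDiff_unitNormal hα hn0
  have cW := hc.contDiff_conormal hα hn0
  have cT := hc.contDiff_tangent hα hn0
  have h1n : (1 : WithTop ℕ∞) ≤ n := by exact_mod_cast (by omega : 1 ≤ n)
  have h1n' : (1 : WithTop ℕ∞) ≤ n + 1 := by exact_mod_cast (by omega : 1 ≤ n + 1)
  -- The `T`-component of the `s`-derivative of the tubular map at the surface point `α (X x)`. It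
  -- equals `1` on the axis, and the tubular map is regular where it does not vanish.
  set q : ℝ × ℝ → ℝ := fun x => 1 + x.2 * inner ℝ (deriv W x.1) (T x.1)
    + height α c X x * inner ℝ (deriv N x.1) (T x.1) with hq
  have hqper (s v : ℝ) (hv : v ∈ Ioo (-η) η) : q (s + L, v) = q (s, v) := by
    have e1 : deriv W (s + L) = deriv W s := periodic_deriv (fun s => by
      rw [hW, conormal, conormal, tangent, tangent,
        periodic_deriv (fun s => congrArg α (hc.periodic s)) s, hc.periodic s]) s
    have e2 : deriv N (s + L) = deriv N s :=
      periodic_deriv (fun s => congrArg (unitNormal α) (hc.periodic s)) s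
    have e3 : T (s + L) = T s := periodic_deriv (fun s => congrArg α (hc.periodic s)) s
    simp only [hq, height, hX.periodic s v hv, hc.periodic s, e1, e2, e3]
  have hqc (x : ℝ × ℝ) (hx : x.2 ∈ Ioo (-η) η) : ContinuousAt q x := by
    have c1 : ContinuousAt (fun x : ℝ × ℝ => N x.1) x :=
      cN.continuous.continuousAt.comp continuousAt_fst
    have c2 : ContinuousAt (fun x : ℝ × ℝ => T x.1) x :=
      cT.continuous.continuousAt.comp continuousAt_fst
    have c3 : ContinuousAt (fun x : ℝ × ℝ => deriv W x.1) x :=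
      (cW.continuous_deriv h1n).continuousAt.comp continuousAt_fst
    have c4 : ContinuousAt (fun x : ℝ × ℝ => deriv N x.1) x :=
      (cN.continuous_deriv h1n').continuousAt.comp continuousAt_fst
    have c5 : ContinuousAt (fun x : ℝ × ℝ => α (X x)) x :=
      ContinuousAt.comp (f := X) hα.contMDiff_two.continuous.continuousAt (hX.continuousAt hx)
    have c6 : ContinuousAt (fun x : ℝ × ℝ => α (c x.1)) x :=
      cγ.continuous.continuousAt.comp continuousAt_fst
    have c7 : ContinuousAt (fun x : ℝ × ℝ => height α c X x) x := (c5.sub c6).inner c1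
    exact (continuousAt_const.add (continuousAt_snd.mul (c3.inner c2))).add (c7.mul (c4.inner c2))
  -- Compactness of one period gives a width that is uniform in `s`; periodicity extends it to all
  -- `s`.
  have hev : ∀ᶠ v in 𝓝 (0 : ℝ), ∀ s ∈ Icc 0 L, 0 < q (s, v) := by
    refine isCompact_Icc.eventually_forall_of_forall_eventually (fun s _ => ?_)
    have h0 : 0 < q (s, 0) := by simp [hq, hX.height_axis]
    have h1 := (hqc (s, 0) ⟨neg_neg_iff_pos.2 hX.pos, hX.pos⟩).eventually (lt_mem_nhds h0)
    exact (continuous_swap.continuousAt (x := ((0 : ℝ), s))).eventually h1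
  obtain ⟨ρ, hρ, hρ'⟩ := Metric.eventually_nhds_iff.1 hev
  refine ⟨min ρ η, lt_min hρ hX.pos, min_le_right _ _, fun s v hv => ?_⟩
  have hvη : v ∈ Ioo (-η) η :=
    ⟨(neg_le_neg (min_le_right _ _)).trans_lt hv.1, hv.2.trans_le (min_le_right _ _)⟩
  have hpos : 0 < q (s, v) := by
    have hper : Function.Periodic (fun s => q (s, v)) L := fun s => hqper s v hvη
    obtain ⟨s', hs', he⟩ := hper.exists_mem_Ico₀ hc.length_pos s
    have h2 := hρ' (y := v) (by
      rw [Real.dist_eq, sub_zero, abs_lt]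
      exact ⟨(neg_le_neg (min_le_left _ _)).trans_lt hv.1, hv.2.trans_le (min_le_left _ _)⟩) s'
      ⟨hs'.1, hs'.2.le⟩
    rwa [← he] at h2
  have hWT : inner ℝ (W s) (T s) = 0 := inner_vec_right _ _
  have hWN : inner ℝ (W s) (N s) = 0 := inner_vec_left _ _
  exact injective_fderiv_tube (cγ.of_le h1n') (cW.of_le h1n) (cN.of_le h1n') (s, v, _)
    (hc.inner_normal_tangent hα s) hWT hWN (hc.arcLength s)
    (norm_unitNormal (hα.contMDiff_two.of_le one_le_two) hα.2 _) (hc.norm_conormal hα s) hpos.ne'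

omit hα hc hX in
/-- Where the tubular coordinates are regular, an adapted chart is as smooth as they are. -/
theorem IsAdaptedChart.contMDiffAt_of_injective (hk : k ≠ 0) (hn : 2 ≤ n)
    (hα : IsImmersionOfClass (n + 2) α) (hc : IsHarmonicCycle i α c L)
    (hX : IsAdaptedChart k α c L η X) {x : ℝ × ℝ} (hx : x.2 ∈ Ioo (-η) η)
    (hi : Function.Injective (fderiv ℝ
      (tube (α ∘ c) (conormal α c) (fun s => unitNormal α (c s))) (x.1, x.2, height α c X x))) :
    ContMDiffAt 𝓘(ℝ, ℝ × ℝ) (𝓡 2) n X x ∧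
      ∃ ψ : M → ℝ × ℝ, ContMDiffAt (𝓡 2) 𝓘(ℝ, ℝ × ℝ) n ψ (X x) ∧ ψ (X x) = x ∧
        (∀ᶠ q in 𝓝 (X x), X (ψ q) = q) ∧ ∀ᶠ z in 𝓝 x, ψ (X z) = z := by
  have hn0 : n ≠ 0 := by omega
  have hn0' : (n : WithTop ℕ∞) ≠ 0 := by exact_mod_cast hn0
  obtain ⟨Φ, h1, h2⟩ := hX.localDiffeo ⟨x, mem_univ _, hx⟩
  replace h1 : x ∈ Φ.source := h1
  have hsrc := Φ.open_source.mem_nhds h1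
  have hXx : X x = Φ.toPartialEquiv x := h2 h1
  have h1' : X x ∈ Φ.target := hXx ▸ Φ.map_source h1
  have htgt := Φ.open_target.mem_nhds h1'
  set ψ : M → ℝ × ℝ := Φ.invFun with hψ
  have hψx : ψ (X x) = x := by rw [hXx]; exact Φ.left_inv h1
  have hψX : ∀ᶠ z in 𝓝 x, ψ (X z) = z := by
    filter_upwards [hsrc] with z hz
    rw [h2 hz]; exact Φ.left_inv hz
  have hXψ : ∀ᶠ q in 𝓝 (X x), X (ψ q) = q := by
    filter_upwards [htgt] with q hq
    exact (h2 (Φ.map_target hq)).trans (Φ.right_inv hq)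
  have hψc : ContinuousAt ψ (X x) := (Φ.contMDiffOn_invFun.contMDiffAt htgt).continuousAt
  have hXc : ContMDiffAt 𝓘(ℝ, ℝ × ℝ) (𝓡 2) k X x :=
    (Φ.contMDiffOn_toFun.contMDiffAt hsrc).congr_of_eventuallyEq
      (h2.eventuallyEq_of_mem hsrc)
  set τ := tube (α ∘ c) (conormal α c) (fun s => unitNormal α (c s)) with hτ
  have hτc : ContDiff ℝ n τ := contDiff_tube ((hc.contDiff_comp hα hn0).of_le le_self_add)
    (hc.contDiff_conormal hα hn0) ((hc.contDiff_unitNormal hα hn0).of_le le_self_add)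
  obtain ⟨g, hg, hgτ, -⟩ := exists_contDiffAt_local_inverse (by simp) hn0' hτc.contDiffAt hi
  have hhc : ContinuousAt (height α c X) x := by
    have c1 : ContinuousAt (fun x : ℝ × ℝ => unitNormal α (c x.1)) x :=
      (hc.contDiff_unitNormal hα hn0).continuous.continuousAt.comp continuousAt_fst
    have c5 : ContinuousAt (fun x : ℝ × ℝ => α (X x)) x :=
      ContinuousAt.comp (f := X) hα.contMDiff_two.continuous.continuousAt (hX.continuousAt hx)
    have c6 : ContinuousAt (fun x : ℝ × ℝ => α (c x.1)) x :=
      (hc.contDiff_comp hα hn0).continuous.continuousAt.comp continuousAt_fst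
    exact (c5.sub c6).inner c1
  have hψn : ContMDiffAt (𝓡 2) 𝓘(ℝ, ℝ × ℝ) n ψ (X x) := by
    -- By the form of the adapted chart, `s` and `v` are the first two tubular coordinates of `α q`.
    -- The third one, the height, is so far only continuous, and that is enough to stay where the
    -- local inverse `g` is valid.
    have e : ψ =ᶠ[𝓝 (X x)] fun q => ((g (α q)).1, (g (α q)).2.1) := by
      have c1 : ContinuousAt (fun q => ((ψ q).1, (ψ q).2, height α c X (ψ q))) (X x) := by
        have c0 : ContinuousAt (fun q => height α c X (ψ q)) (X x) :=
          ContinuousAt.comp (f := ψ) (g := height α c X) (by rwa [hψx]) hψc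
        exact hψc.fst.prodMk (hψc.snd.prodMk c0)
      have c2 : ∀ᶠ q in 𝓝 (X x), (ψ q).2 ∈ Ioo (-η) η := by
        refine hψc.snd.eventually (isOpen_Ioo.mem_nhds ?_)
        simpa only [hψx] using hx
      have c3 : ∀ᶠ q in 𝓝 (X x),
          g (τ ((ψ q).1, (ψ q).2, height α c X (ψ q))) = ((ψ q).1, (ψ q).2, height α c X (ψ q)) :=
        c1.eventually (p := fun z => g (τ z) = z) (by simpa only [hψx] using hgτ)
      filter_upwards [c2, hXψ, c3] with q i1 i2 i3
      have i4 := hX.eq_tube hα i1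
      rw [i2] at i4
      rw [i4, i3]
    refine ContMDiffAt.congr_of_eventuallyEq ?_ e
    have e2 : ContMDiffAt (𝓡 2) 𝓘(ℝ, ℝ × ℝ × ℝ) n (fun q => g (α q)) (X x) := by
      refine ContMDiffAt.comp (X x) (I' := 𝓘(ℝ, Space)) (ContDiffAt.contMDiffAt ?_)
        ((hα.1 _).of_le (by exact_mod_cast (by omega : n ≤ n + 2)))
      rwa [hX.eq_tube hα hx]
    exact ((contDiff_fst.prodMk (contDiff_fst.comp contDiff_snd)).contDiffAt.contMDiffAt).comp
      (X x) e2
  refine ⟨?_, ψ, hψn, hψx, hXψ, hψX⟩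
  set p := X x with hp
  set χ : Plane → ℝ × ℝ := ψ ∘ (extChartAt (𝓡 2) p).symm with hχ
  have hχx : χ (coord p) = x := by
    simp only [hχ, Function.comp_apply, coord, extChartAt_to_inv, hψx]
  have hχn : ContDiffAt ℝ n χ (coord p) := by
    rw [← contMDiffAt_iff_contDiffAt]
    have : IsManifold (𝓡 2) n M := IsManifold.of_le (n := ∞) (by exact_mod_cast le_top)
    refine ContMDiffAt.comp (coord p) (I' := 𝓡 2) ?_
      ((contMDiffOn_extChartAt_symm (I := 𝓡 2) (n := n) p).contMDiffAt
        ((isOpen_extChartAt_target p).mem_nhds (mem_extChartAt_target p)))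
    rwa [coord, extChartAt_to_inv]
  have hχc : ContinuousAt (extChartAt (𝓡 2) p).symm (coord p) :=
    continuousAt_extChartAt_symm p
  have hinv : ∀ᶠ y in 𝓝 (coord p), (extChartAt (𝓡 2) p) (X (χ y)) = y := by
    have hXψ' : ∀ᶠ q in 𝓝 ((extChartAt (𝓡 2) p).symm (coord p)), X (ψ q) = q := by
      rwa [coord, extChartAt_to_inv]
    filter_upwards [hχc.eventually hXψ', (isOpen_extChartAt_target (I := 𝓡 2) p).mem_nhds
      (mem_extChartAt_target p)] with y i1 i2
    simp only [hχ, Function.comp_apply]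
    rw [i1, (extChartAt (𝓡 2) p).right_inv i2]
  have hXd : DifferentiableAt ℝ (extChartAt (𝓡 2) p ∘ X) (χ (coord p)) := by
    rw [hχx]
    have : ContDiffAt ℝ k (extChartAt (𝓡 2) p ∘ X) x := by
      rw [← contMDiffAt_iff_contDiffAt]
      have : IsManifold (𝓡 2) k M := IsManifold.of_le (n := ∞) (by exact_mod_cast le_top)
      exact ContMDiffAt.comp x (contMDiffAt_extChartAt (I := 𝓡 2) (n := k) (x := p)) hXc
    exact this.differentiableAt (by exact_mod_cast hk)
  -- The chain rule for `X ∘ ψ = id` needs only differentiability of `X`, which is where `k ≠ 0`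
  -- enters. Then `X` is a local inverse of a `C^n` map with injective derivative and inherits its
  -- class.
  have hχi : Function.Injective (fderiv ℝ χ (coord p)) := by
    have e1 : (extChartAt (𝓡 2) p ∘ X) ∘ χ =ᶠ[𝓝 (coord p)] id := hinv
    have e2 := e1.fderiv_eq (𝕜 := ℝ)
    rw [fderiv_comp _ hXd (hχn.differentiableAt hn0'), fderiv_id] at e2
    refine Function.LeftInverse.injective
      (g := fderiv ℝ (extChartAt (𝓡 2) p ∘ X) (χ (coord p))) fun u => ?_
    simpa using congrArg (fun A : Plane →L[ℝ] Plane => A u) e2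
  obtain ⟨g₂, hg₂, hg₂χ, -⟩ := exists_contDiffAt_local_inverse (by simp) hn0' hχn hχi
  rw [hχx] at hg₂
  have hX1 := hX.continuousAt hx
  have hes : ∀ᶠ z in 𝓝 x, X z ∈ (extChartAt (𝓡 2) p).source :=
    hX1.eventually (extChartAt_source_mem_nhds (I := 𝓡 2) p)
  have hec : ContinuousAt (fun z => extChartAt (𝓡 2) p (X z)) x :=
    ContinuousAt.comp (f := X) (continuousAt_extChartAt p) hX1
  have hloc : extChartAt (𝓡 2) p ∘ X =ᶠ[𝓝 x] g₂ := by
    filter_upwards [hes, hec.eventually hg₂χ, hψX] with z i1 i2 i3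
    simp only [hχ, Function.comp_apply] at i2 ⊢
    rwa [(extChartAt (𝓡 2) p).left_inv i1, i3, eq_comm] at i2
  exact contMDiffAt_iff_target.2 ⟨hX1, (hg₂.congr_of_eventuallyEq hloc).contMDiffAt⟩

end Chart

end Cycle

end HarmonicMC

/-! ### Smoothness of the deformation, and that it remains an immersion. -/

namespace HarmonicMC

variable {M : Type*} [TopologicalSpace M] [ChartedSpace Plane M]

/-- The deformation term in the adapted chart. -/
noncomputable def bump (N : ℝ → Space) (A₁ δ : ℝ → ℝ) (x : ℝ × ℝ) : Space :=
  (A₁ x.1 / 6 * x.2 ^ 3 * δ x.2) • N x.1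

theorem contDiff_bump {n : WithTop ℕ∞} {N : ℝ → Space} {A₁ δ : ℝ → ℝ} (hN : ContDiff ℝ n N)
    (hA : ContDiff ℝ n A₁) (hδ : ContDiff ℝ n δ) : ContDiff ℝ n (bump N A₁ δ) :=
  ((((hA.comp contDiff_fst).div_const 6).mul (contDiff_snd.pow 3)).mul
    (hδ.comp contDiff_snd)).smul (hN.comp contDiff_fst)

/-- An adapted chart on the strip `|v| < η₀`, together with the smoothness of the chart there. -/
structure IsSmoothStrip (n : ℕ) (X : ℝ × ℝ → M) (η₀ : ℝ) : Prop where
  contMDiffAt : ∀ x : ℝ × ℝ, x.2 ∈ Ioo (-η₀) η₀ → ContMDiffAt 𝓘(ℝ, ℝ × ℝ) (𝓡 2) n X x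
  exists_inverse : ∀ x : ℝ × ℝ, x.2 ∈ Ioo (-η₀) η₀ →
    ∃ ψ : M → ℝ × ℝ, ContMDiffAt (𝓡 2) 𝓘(ℝ, ℝ × ℝ) n ψ (X x) ∧ ψ (X x) = x ∧
      (∀ᶠ q in 𝓝 (X x), X (ψ q) = q) ∧ ∀ᶠ z in 𝓝 x, ψ (X z) = z

section Deformation

variable {n k : ℕ} {α : M → Space} {c : ℝ → M} {L η η₀ : ℝ} {X : ℝ × ℝ → M} {A₁ δ : ℝ → ℝ}

theorem IsAdaptedChart.exists_mem_Icc (hX : IsAdaptedChart k α c L η X) (hL : 0 < L) {s v : ℝ}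
    (hv : v ∈ Ioo (-η) η) : ∃ s' ∈ Icc 0 L, X (s, v) = X (s', v) := by
  have hper : Function.Periodic (fun s => X (s, v)) L := fun s => hX.periodic s v hv
  obtain ⟨s', hs', he⟩ := hper.exists_mem_Ico₀ hL s
  exact ⟨s', ⟨hs'.1, hs'.2.le⟩, he⟩

variable (hX : IsAdaptedChart k α c L η X) (hc : Function.Periodic c L)
  (hA : Function.Periodic A₁ L) (hη : η₀ ≤ η) (hs : tsupport δ ⊆ Ioo (-η₀) η₀)

theorem mem_Ioo_of_le {v η₀ η : ℝ} (h : η₀ ≤ η) (hv : v ∈ Ioo (-η₀) η₀) : v ∈ Ioo (-η) η :=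
  ⟨(neg_le_neg h).trans_lt hv.1, hv.2.trans_le h⟩

include hX hη hs in
theorem isCompact_image_tsupport : IsCompact (X '' (Icc 0 L ×ˢ tsupport δ)) := by
  have h1 : IsCompact (tsupport δ) := Metric.isCompact_of_isClosed_isBounded
    (isClosed_tsupport δ) (Metric.isBounded_Ioo (-η₀) η₀ |>.subset hs)
  refine (isCompact_Icc.prod h1).image_of_continuousOn fun x hx => ?_
  exact (hX.continuousAt (mem_Ioo_of_le hη (hs hx.2))).continuousWithinAt

include hX hc hA hη hs in
-- The image of one period of the support is compact, hence closed as `M` is Hausdorff, and by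
-- periodicity it contains every point that the deformation moves.
theorem deformation_eventuallyEq_off [T2Space M] (hL : 0 < L) (ε : ℝ) {p : M}
    (hp : p ∉ X '' (Icc 0 L ×ˢ tsupport δ)) : deformation α c η X A₁ δ ε =ᶠ[𝓝 p] α := by
  filter_upwards [(isCompact_image_tsupport hX hη hs).isClosed.isOpen_compl.mem_nhds hp]
    with q hq
  by_cases h : ∃ s v, v ∈ Ioo (-η) η ∧ X (s, v) = q
  · obtain ⟨s, v, hv, rfl⟩ := h
    rw [deformation_chart hX hc hA δ ε s v hv]
    have h0 : δ v = 0 := by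
      refine image_eq_zero_of_notMem_tsupport fun hv' => hq ?_
      obtain ⟨s', hs', he⟩ := hX.exists_mem_Icc hL (s := s) hv
      exact ⟨(s', v), ⟨hs', hv'⟩, he.symm⟩
    rw [h0]
    simp
  · push Not at h
    exact deformation_off δ ε q h

include hX hc hA hη in
theorem deformation_eventuallyEq_on (ε : ℝ) {x : ℝ × ℝ} (hx : x.2 ∈ Ioo (-η₀) η₀)
    {ψ : M → ℝ × ℝ} (hψ : ContinuousAt ψ (X x)) (hψx : ψ (X x) = x)
    (hXψ : ∀ᶠ q in 𝓝 (X x), X (ψ q) = q) :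
    deformation α c η X A₁ δ ε =ᶠ[𝓝 (X x)]
      (fun z => α (X z) + ε • bump (fun s => unitNormal α (c s)) A₁ δ z) ∘ ψ := by
  have h1 : ∀ᶠ q in 𝓝 (X x), (ψ q).2 ∈ Ioo (-η₀) η₀ := by
    refine hψ.snd.eventually (isOpen_Ioo.mem_nhds ?_)
    simpa only [hψx] using hx
  filter_upwards [h1, hXψ] with q i1 i2
  have := deformation_chart hX hc hA δ ε (ψ q).1 (ψ q).2 (mem_Ioo_of_le hη i1)
  rw [Prod.mk.eta, i2] at this
  rw [this, Function.comp_apply, i2, bump]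

include hX hc hA hη hs in
theorem contMDiff_deformation [T2Space M] (hL : 0 < L)
    (hα : ContMDiff (𝓡 2) 𝓘(ℝ, Space) n α)
    (hst : IsSmoothStrip n X η₀)
    (hb : ContDiff ℝ n (bump (fun s => unitNormal α (c s)) A₁ δ)) (ε : ℝ) :
    ContMDiff (𝓡 2) 𝓘(ℝ, Space) n (deformation α c η X A₁ δ ε) := by
  intro p
  by_cases hp : p ∈ X '' (Icc 0 L ×ˢ tsupport δ)
  · obtain ⟨x, hx, rfl⟩ := hp
    obtain ⟨ψ, h1, h2, h3, -⟩ := hst.exists_inverse x (hs hx.2)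
    refine ContMDiffAt.congr_of_eventuallyEq ?_
      (deformation_eventuallyEq_on hX hc hA hη ε (hs hx.2) h1.continuousAt h2 h3)
    refine ContMDiffAt.comp (X x) (I' := 𝓘(ℝ, ℝ × ℝ)) ?_ h1
    rw [h2]
    refine ContMDiffAt.add ?_ ?_
    · exact (hα _).comp x (hst.contMDiffAt x (hs hx.2))
    · exact (hb.const_smul ε).contDiffAt.contMDiffAt
  · exact (hα p).congr_of_eventuallyEq (deformation_eventuallyEq_off hX hc hA hη hs hL ε hp)

theorem IsSmoothStrip.contDiffAt_comp (hst : IsSmoothStrip n X η₀) {f : M → Space}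
    (hf : ContMDiff (𝓡 2) 𝓘(ℝ, Space) n f) {x : ℝ × ℝ} (hx : x.2 ∈ Ioo (-η₀) η₀) :
    ContDiffAt ℝ n (f ∘ X) x := by
  rw [← contMDiffAt_iff_contDiffAt]
  exact (hf _).comp x (hst.contMDiffAt x hx)

theorem injective_fderiv_comp (hn : n ≠ 0) (hst : IsSmoothStrip n X η₀) {f : M → Space}
    (hf : ContMDiff (𝓡 2) 𝓘(ℝ, Space) n f) {x : ℝ × ℝ} (hx : x.2 ∈ Ioo (-η₀) η₀)
    (hi : Function.Injective (mfderiv (𝓡 2) 𝓘(ℝ, Space) f (X x))) :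
    Function.Injective (fderiv ℝ (f ∘ X) x) := by
  have hn' : (n : WithTop ℕ∞) ≠ 0 := by exact_mod_cast hn
  obtain ⟨ψ, h1, h2, -, h4⟩ := hst.exists_inverse x hx
  have hXd := (hst.contMDiffAt x hx).mdifferentiableAt hn'
  have e1 : ψ ∘ X =ᶠ[𝓝 x] id := h4
  have e2 := e1.mfderiv_eq (I := 𝓘(ℝ, ℝ × ℝ)) (I' := 𝓘(ℝ, ℝ × ℝ))
  rw [mfderiv_comp x (h1.mdifferentiableAt hn') hXd, mfderiv_id] at e2
  have hXi : Function.Injective (mfderiv 𝓘(ℝ, ℝ × ℝ) (𝓡 2) X x) := by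
    refine Function.LeftInverse.injective
      (g := mfderiv (𝓡 2) 𝓘(ℝ, ℝ × ℝ) ψ (X x)) fun u => ?_
    exact congrArg (fun A : (ℝ × ℝ) →L[ℝ] ℝ × ℝ => A u) e2
  rw [← mfderiv_eq_fderiv, mfderiv_comp x ((hf _).mdifferentiableAt hn') hXd]
  exact hi.comp hXi

theorem injective_mfderiv_of_comp (hn : n ≠ 0) (hst : IsSmoothStrip n X η₀) {f : M → Space}
    {G : ℝ × ℝ → Space} {x : ℝ × ℝ} (hx : x.2 ∈ Ioo (-η₀) η₀) {ψ : M → ℝ × ℝ}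
    (h1 : ContMDiffAt (𝓡 2) 𝓘(ℝ, ℝ × ℝ) n ψ (X x)) (h2 : ψ (X x) = x)
    (h3 : ∀ᶠ q in 𝓝 (X x), X (ψ q) = q) (hf : f =ᶠ[𝓝 (X x)] G ∘ ψ)
    (hG : DifferentiableAt ℝ G x) (hi : Function.Injective (fderiv ℝ G x)) :
    Function.Injective (mfderiv (𝓡 2) 𝓘(ℝ, Space) f (X x)) := by
  have hn' : (n : WithTop ℕ∞) ≠ 0 := by exact_mod_cast hn
  have hψd := h1.mdifferentiableAt hn'
  have hXd : MDifferentiableAt 𝓘(ℝ, ℝ × ℝ) (𝓡 2) X (ψ (X x)) := by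
    rw [h2]; exact (hst.contMDiffAt x hx).mdifferentiableAt hn'
  have e1 : X ∘ ψ =ᶠ[𝓝 (X x)] id := h3
  have e2 := e1.mfderiv_eq (I := 𝓡 2) (I' := 𝓡 2)
  rw [mfderiv_comp (X x) hXd hψd, mfderiv_id] at e2
  have hψi : Function.Injective (mfderiv (𝓡 2) 𝓘(ℝ, ℝ × ℝ) ψ (X x)) := by
    refine Function.LeftInverse.injective
      (g := mfderiv 𝓘(ℝ, ℝ × ℝ) (𝓡 2) X (ψ (X x))) fun u => ?_
    exact congrArg (fun A : Plane →L[ℝ] Plane => A u) e2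
  have hG' : MDifferentiableAt 𝓘(ℝ, ℝ × ℝ) 𝓘(ℝ, Space) G (ψ (X x)) := by
    rw [h2]; exact hG.mdifferentiableAt
  rw [hf.mfderiv_eq, mfderiv_comp (X x) hG' hψd]
  have hGi : Function.Injective (mfderiv 𝓘(ℝ, ℝ × ℝ) 𝓘(ℝ, Space) G (ψ (X x))) := by
    rw [mfderiv_eq_fderiv, h2]
    exact hi
  exact hGi.comp hψi

include hX hc hA hη hs in
-- In the strip the differential is `D(α ∘ X) + ε D(bump)`, which is continuous in the point and in
-- `ε`. Injective linear maps form an open set and the support is compact over one period, so one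
-- bound on `ε` serves everywhere; elsewhere the map is `α`.
theorem eventually_injective_mfderiv_deformation [T2Space M] (hL : 0 < L) (hn : n ≠ 0)
    (hα : IsImmersionOfClass n α) (hst : IsSmoothStrip n X η₀)
    (hb : ContDiff ℝ n (bump (fun s => unitNormal α (c s)) A₁ δ)) :
    ∀ᶠ ε in 𝓝 (0 : ℝ), ∀ p, Function.Injective
      (mfderiv (𝓡 2) 𝓘(ℝ, Space) (deformation α c η X A₁ δ ε) p) := by
  have hn' : (n : WithTop ℕ∞) ≠ 0 := by exact_mod_cast hn
  set D := bump (fun s => unitNormal α (c s)) A₁ δ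
  have h1 : IsCompact (tsupport δ) := Metric.isCompact_of_isClosed_isBounded
    (isClosed_tsupport δ) (Metric.isBounded_Ioo (-η₀) η₀ |>.subset hs)
  have key : ∀ᶠ ε in 𝓝 (0 : ℝ), ∀ x ∈ Icc 0 L ×ˢ tsupport δ,
      Function.Injective ⇑(fderiv ℝ (α ∘ X) x + ε • fderiv ℝ D x) := by
    refine (isCompact_Icc.prod h1).eventually_forall_of_forall_eventually fun x hx => ?_
    have hP := (hst.contDiffAt_comp hα.1 (hs hx.2)).continuousAt_fderiv hn'
    have hD := hb.contDiffAt.continuousAt_fderiv (x := x) hn'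
    have hcont : ContinuousAt (fun z : ℝ × (ℝ × ℝ) => fderiv ℝ (α ∘ X) z.2 + z.1 • fderiv ℝ D z.2)
        (0, x) :=
      (hP.comp continuousAt_snd).add (continuousAt_fst.smul (hD.comp continuousAt_snd))
    refine hcont.eventually (ContinuousLinearMap.isOpen_injective.mem_nhds ?_)
    simpa using injective_fderiv_comp hn hst hα.1 (hs hx.2) (hα.2 _)
  filter_upwards [key] with ε hε p
  by_cases hp : p ∈ X '' (Icc 0 L ×ˢ tsupport δ)
  · obtain ⟨x, hx, rfl⟩ := hp
    obtain ⟨ψ, i1, i2, i3, -⟩ := hst.exists_inverse x (hs hx.2)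
    have d1 := (hst.contDiffAt_comp hα.1 (hs hx.2)).differentiableAt hn'
    have d2 := (hb.contDiffAt (x := x)).differentiableAt hn'
    have d3 := d1.hasFDerivAt.add (d2.hasFDerivAt.const_smul ε)
    refine injective_mfderiv_of_comp hn hst (hs hx.2) i1 i2 i3
      (deformation_eventuallyEq_on hX hc hA hη ε (hs hx.2) i1.continuousAt i2 i3)
      d3.differentiableAt ?_
    have := d3.fderiv
    have h5 : fderiv ℝ (fun z => α (X z) + ε • D z) x = _ := this
    rw [h5]
    exact hε x hx
  · rw [(deformation_eventuallyEq_off hX hc hA hη hs hL ε hp).mfderiv_eq]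
    exact hα.2 p

end Deformation

end HarmonicMC

namespace HarmonicMC

/-! ### The return map of a scalar differential equation -/

section ReturnMap

variable {F F' : ℝ → ℝ → ℝ} {T a : ℝ}

/-- The projection of the line to the interval `[-a, a]`. -/
noncomputable def clamp (a x : ℝ) : ℝ := max (-a) (min x a)

theorem clamp_mem (ha : 0 < a) (x : ℝ) : clamp a x ∈ Icc (-a) a :=
  ⟨le_max_left _ _, max_le (by linarith) (min_le_right _ _)⟩

theorem clamp_of_mem {x : ℝ} (hx : x ∈ Icc (-a) a) : clamp a x = x := by
  rw [clamp, min_eq_left hx.2, max_eq_right hx.1]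

theorem abs_clamp_sub_le (x y : ℝ) : |clamp a x - clamp a y| ≤ |x - y| := by
  rw [clamp, clamp]
  refine (abs_max_sub_max_le_max _ _ _ _).trans ?_
  rw [sub_self, abs_zero]
  refine max_le (abs_nonneg _) ((abs_min_sub_min_le_max _ _ _ _).trans ?_)
  rw [sub_self, abs_zero]
  exact max_le le_rfl (abs_nonneg _)

theorem abs_sub_le_of_hasDerivAt {f f' : ℝ → ℝ} {C : ℝ} {s : Set ℝ} (hs : Convex ℝ s)
    (hd : ∀ x ∈ s, HasDerivAt f (f' x) x) (hC : ∀ x ∈ s, |f' x| ≤ C) {x y : ℝ} (hx : x ∈ s)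
    (hy : y ∈ s) : |f y - f x| ≤ C * |y - x| :=
  hs.norm_image_sub_le_of_norm_hasDerivWithin_le (fun z hz => (hd z hz).hasDerivWithinAt) hC hx hy

/-- Clamping the space variable makes the equation globally Lipschitz and bounded, so solutions
exist on all of `[-1, T + 1]`; Grönwall keeps the small ones inside `[-a, a]`, where clamping
changes nothing. The derivative at the fixed point comes from the integrating factor of the
linearized equation, so that no theorem on smooth dependence on initial values is needed. -/
theorem exists_return_map (hT : 0 < T) (ha : 0 < a)
    (hF : ContinuousOn (Function.uncurry F) (Icc (-1) (T + 1) ×ˢ Icc (-a) a))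
    (hF' : ContinuousOn (Function.uncurry F') (Icc (-1) (T + 1) ×ˢ Icc (-a) a))
    (hd : ∀ t ∈ Icc (-1) (T + 1), ∀ x ∈ Icc (-a) a, HasDerivAt (F t) (F' t x) x)
    (h0 : ∀ t ∈ Icc (-1) (T + 1), F t 0 = 0) :
    ∃ π : ℝ → ℝ, HasDerivAt π (Real.exp (∫ t in 0..T, F' t 0)) 0 ∧
      ∀ᶠ v in 𝓝 (0 : ℝ), ∃ (φ : ℝ → ℝ) (J : Set ℝ), IsOpen J ∧ Icc 0 T ⊆ J ∧
        J ⊆ Ioo (-1) (T + 1) ∧ φ 0 = v ∧ φ T = π v ∧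
        ∀ t ∈ J, φ t ∈ Ioo (-a) a ∧ HasDerivAt φ (F t (φ t)) t := by
  obtain ⟨K, hK⟩ := (isCompact_Icc.prod isCompact_Icc).exists_bound_of_continuousOn hF'
  have hK0 : 0 ≤ K := (norm_nonneg _).trans
    (hK ((0 : ℝ), (0 : ℝ)) ⟨⟨by linarith, by linarith⟩, ⟨by linarith, by linarith⟩⟩)
  have hz : (0 : ℝ) ∈ Icc (-a) a := ⟨by linarith, ha.le⟩
  have hLip (t : ℝ) (ht : t ∈ Icc (-1) (T + 1)) (x y : ℝ) (hx : x ∈ Icc (-a) a)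
      (hy : y ∈ Icc (-a) a) : |F t y - F t x| ≤ K * |y - x| :=
    abs_sub_le_of_hasDerivAt (convex_Icc _ _) (hd t ht) (fun z hz => hK (t, z) ⟨ht, hz⟩) hx hy
  set G : ℝ → ℝ → ℝ := fun t x => F t (clamp a x) with hG
  have hGb (t : ℝ) (ht : t ∈ Icc (-1) (T + 1)) (x : ℝ) : |G t x| ≤ K * |x| := by
    have h1 := hLip t ht 0 (clamp a x) hz (clamp_mem ha x)
    rw [h0 t ht, sub_zero, sub_zero] at h1
    have h2 := abs_clamp_sub_le (a := a) x 0
    rw [clamp_of_mem hz, sub_zero, sub_zero] at h2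
    exact h1.trans (mul_le_mul_of_nonneg_left h2 hK0)
  have hGb' (t : ℝ) (ht : t ∈ Icc (-1) (T + 1)) (x : ℝ) : |G t x| ≤ K * a := by
    have h1 := hLip t ht 0 (clamp a x) hz (clamp_mem ha x)
    rw [h0 t ht, sub_zero, sub_zero] at h1
    exact h1.trans (mul_le_mul_of_nonneg_left (abs_le.2 (clamp_mem ha x)) hK0)
  -- The speed is at most `K * a` and the largest time distance from `0` is `T + 1`, so a ball of
  -- radius `K * a * (T + 1)` around any initial value is large enough.
  have hpl (v : ℝ) : IsPicardLindelof G (tmin := -1) (tmax := T + 1)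
      ⟨0, by constructor <;> linarith⟩ v (K * a * (T + 1)).toNNReal 0 (K * a).toNNReal
      K.toNNReal := by
    refine ⟨fun t ht => ?_, fun x _ => ?_, fun t ht x _ => ?_, ?_⟩
    · refine LipschitzOnWith.of_dist_le_mul fun x _ y _ => ?_
      rw [Real.coe_toNNReal _ hK0, Real.dist_eq, Real.dist_eq]
      exact (hLip t ht _ _ (clamp_mem ha y) (clamp_mem ha x)).trans
        (mul_le_mul_of_nonneg_left (abs_clamp_sub_le x y) hK0)
    · exact hF.comp (f := fun t => (t, clamp a x)) (by fun_prop) fun t ht => ⟨ht, clamp_mem ha x⟩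
    · rw [Real.coe_toNNReal _ (by positivity)]
      exact hGb' t ht x
    · rw [Real.coe_toNNReal _ (by positivity), Real.coe_toNNReal _ (by positivity)]
      simp only [sub_zero, NNReal.coe_zero, zero_sub, neg_neg]
      rw [max_eq_left (by linarith)]
  choose φ hφ0 hφd using fun v => (hpl v).exists_eq_forall_mem_Icc_hasDerivWithinAt₀
  have hφ0' (v : ℝ) : φ v 0 = v := hφ0 v
  have hφc (v : ℝ) : ContinuousOn (φ v) (Icc (-1) (T + 1)) :=
    fun t ht => (hφd v t ht).continuousWithinAt
  have hφd' (v t : ℝ) (ht : t ∈ Ioo (-1) (T + 1)) : HasDerivAt (φ v) (G t (φ v t)) t :=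
    (hφd v t (Ioo_subset_Icc_self ht)).hasDerivAt (Icc_mem_nhds ht.1 ht.2)
  set C := Real.exp (K * T) with hC
  have hC0 : 0 < C := Real.exp_pos _
  have hsub : Icc 0 T ⊆ Ioo (-1) (T + 1) := fun t ht =>
    ⟨by linarith [ht.1], by linarith [ht.2]⟩
  have hgrow (v t : ℝ) (ht : t ∈ Icc 0 T) : |φ v t| ≤ |v| * C := by
    have h1 := norm_le_gronwallBound_of_norm_deriv_right_le (f := φ v)
      (f' := fun t => G t (φ v t)) (δ := |v|) (K := K) (ε := 0) (a := 0) (b := T)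
      ((hφc v).mono (hsub.trans Ioo_subset_Icc_self))
      (fun x hx => (hφd' v x (hsub (Ico_subset_Icc_self hx))).hasDerivWithinAt)
      (by rw [hφ0', Real.norm_eq_abs])
      (fun x hx => by
        rw [add_zero]
        exact hGb x (Ioo_subset_Icc_self (hsub (Ico_subset_Icc_self hx))) _) t ht
    rw [gronwallBound_ε0, sub_zero] at h1
    refine h1.trans (mul_le_mul_of_nonneg_left (Real.exp_le_exp.2 ?_) (abs_nonneg _))
    exact mul_le_mul_of_nonneg_left ht.2 hK0
  refine ⟨fun v => φ v T, ?_, ?_⟩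
  · set I : ℝ → ℝ := fun t => ∫ s in 0..t, F' s 0 with hI
    have hg : ContinuousOn (fun t => F' t 0) (Icc (-1) (T + 1)) :=
      hF'.comp (f := fun t => (t, (0 : ℝ))) (by fun_prop) fun t ht => ⟨ht, hz⟩
    have hId (t : ℝ) (ht : t ∈ Icc 0 T) : HasDerivAt I (F' t 0) t := by
      have ht' := hsub ht
      refine intervalIntegral.integral_hasDerivAt_right ?_ ?_ ?_
      · refine ContinuousOn.intervalIntegrable (hg.mono ?_)
        rw [uIcc_of_le ht.1]
        exact fun s hs => ⟨by linarith [hs.1], by linarith [hs.2, ht.2]⟩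
      · exact (hg.mono Ioo_subset_Icc_self).stronglyMeasurableAtFilter isOpen_Ioo t ht'
      · exact (hg t (Ioo_subset_Icc_self ht')).continuousAt (Icc_mem_nhds ht'.1 ht'.2)
    have hIb (t : ℝ) (ht : t ∈ Icc 0 T) : Real.exp (-I t) ≤ C := by
      refine Real.exp_le_exp.2 ?_
      have h1 : ‖I t‖ ≤ K * |t - 0| := intervalIntegral.norm_integral_le_of_norm_le_const
        fun s hs => by
          rw [uIoc_of_le ht.1] at hs
          exact hK (s, 0) ⟨⟨by linarith [hs.1], by linarith [hs.2, ht.2]⟩, hz⟩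
      rw [sub_zero, abs_of_nonneg ht.1] at h1
      exact (neg_le_abs _).trans (h1.trans (mul_le_mul_of_nonneg_left ht.2 hK0))
    have hunif (e : ℝ) (he : 0 < e) : ∀ᶠ x in 𝓝 (0 : ℝ), ∀ t ∈ Icc 0 T,
        |F' t x - F' t 0| ≤ e := by
      refine isCompact_Icc.eventually_forall_of_forall_eventually fun t ht => ?_
      have ht' := hsub ht
      have h1 : ContinuousAt (Function.uncurry F') (t, 0) :=
        hF'.continuousAt (prod_mem_nhds (Icc_mem_nhds ht'.1 ht'.2)
          (Icc_mem_nhds (by linarith) ha))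
      have h2 : ContinuousAt (fun z : ℝ × ℝ => Function.uncurry F' (z.2, z.1)) (0, t) :=
        ContinuousAt.comp (g := Function.uncurry F') (f := fun z : ℝ × ℝ => (z.2, z.1))
          (x := ((0 : ℝ), t)) h1 (by fun_prop)
      have h3 : ContinuousAt (fun z : ℝ × ℝ => Function.uncurry F' (z.2, 0)) ((0 : ℝ), t) :=
        ContinuousAt.comp (g := Function.uncurry F') (f := fun z : ℝ × ℝ => (z.2, (0 : ℝ)))
          (x := ((0 : ℝ), t)) h1 (by fun_prop)
      have h4 := (h2.sub h3).abs
      have h5 : |Function.uncurry F' (t, 0) - Function.uncurry F' (t, 0)| < e := by simpa using he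
      exact (h4.eventually (gt_mem_nhds h5)).mono fun z hz => le_of_lt hz
    rw [hasDerivAt_iff_isLittleO, Asymptotics.isLittleO_iff]
    intro c hc
    -- If `F'` varies by at most `e` between `0` and the solution, then `φ v T` differs from `v *
    -- exp (I T)` by at most `exp (I T) * C² * T * e * |v|`. The choice `e = c / B` brings this
    -- below `c * |v|`.
    set B := Real.exp (I T) * (C * C * T) + 1 with hB
    have hB0 : 0 < B := by positivity
    obtain ⟨ρ, hρ, hρ'⟩ := Metric.eventually_nhds_iff.1 (hunif (c / B) (by positivity))
    set m := min ρ a / C with hm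
    have hm0 : 0 < m := div_pos (lt_min hρ ha) hC0
    filter_upwards [Metric.ball_mem_nhds (0 : ℝ) hm0] with v hv
    have hv' : |v| < m := by simpa using hv
    have hsmall (t : ℝ) (ht : t ∈ Icc 0 T) : |φ v t| < min ρ a :=
      (hgrow v t ht).trans_lt ((lt_div_iff₀ hC0).1 hv')
    -- With the integrating factor `exp (-I)` only the deviation of the equation from its
    -- linearization survives; it is small compared with `|v|`.
    have hderiv (t : ℝ) (ht : t ∈ Icc 0 T) :
        HasDerivAt (fun t => φ v t * Real.exp (-I t))
          ((G t (φ v t) - F' t 0 * φ v t) * Real.exp (-I t)) t := by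
      have h1 := (hφd' v t (hsub ht)).fun_mul ((hId t ht).neg.exp)
      refine h1.congr_deriv ?_
      simp only [Pi.neg_apply]
      ring
    have hbound (t : ℝ) (ht : t ∈ Icc 0 T) :
        |(G t (φ v t) - F' t 0 * φ v t) * Real.exp (-I t)| ≤ c / B * (|v| * C) * C := by
      rw [abs_mul, abs_of_pos (Real.exp_pos _)]
      refine mul_le_mul ?_ (hIb t ht) (Real.exp_pos _).le (by positivity)
      have h1 := hsmall t ht
      have h2 : φ v t ∈ Icc (-a) a := abs_le.1 (h1.le.trans (min_le_right _ _))
      rw [hG]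
      simp only [clamp_of_mem h2]
      have ht' := Ioo_subset_Icc_self (hsub ht)
      have h3 := abs_sub_le_of_hasDerivAt (f := fun x => F t x - F' t 0 * x)
        (f' := fun x => F' t x - F' t 0) (C := c / B) (s := Ioo (-(min ρ a)) (min ρ a))
        (convex_Ioo _ _)
        (fun x hx => by
          have h4 := (hd t ht' x ⟨by linarith [hx.1, min_le_right ρ a],
            by linarith [hx.2, min_le_right ρ a]⟩).fun_sub
            ((hasDerivAt_id x).const_mul (F' t 0))
          simpa using h4)
        (fun x hx => hρ' (y := x) (by
          rw [Real.dist_eq, sub_zero, abs_lt]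
          exact ⟨by linarith [hx.1, min_le_left ρ a], hx.2.trans_le (min_le_left _ _)⟩) t ht)
        (x := 0) (y := φ v t) ⟨by linarith [lt_min hρ ha], lt_min hρ ha⟩ (abs_lt.1 h1)
      rw [h0 t ht', mul_zero, sub_zero, sub_zero, sub_zero] at h3
      exact h3.trans (mul_le_mul_of_nonneg_left (hgrow v t ht) (by positivity))
    have hT' : T ∈ Icc 0 T := ⟨hT.le, le_rfl⟩
    have hfin := abs_sub_le_of_hasDerivAt (convex_Icc 0 T) hderiv hbound
      (x := 0) (y := T) ⟨le_rfl, hT.le⟩ hT'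
    have hI0 : I 0 = 0 := by simp [hI]
    rw [hI0, neg_zero, Real.exp_zero, mul_one, hφ0', sub_zero, abs_of_pos hT] at hfin
    have hπ0 : φ 0 T = 0 := by
      have := hgrow 0 T hT'
      rw [abs_zero, zero_mul] at this
      exact abs_nonpos_iff.1 this
    rw [hπ0, sub_zero, sub_zero, smul_eq_mul, Real.norm_eq_abs, Real.norm_eq_abs]
    have e1 : φ v T - v * Real.exp (I T) =
        Real.exp (I T) * (φ v T * Real.exp (-I T) - v) := by
      rw [Real.exp_neg]
      field_simp
    have e2 : ∫ t in 0..T, F' t 0 = I T := rfl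
    rw [e2, e1, abs_mul, abs_of_pos (Real.exp_pos _)]
    calc Real.exp (I T) * |φ v T * Real.exp (-I T) - v|
        ≤ Real.exp (I T) * (c / B * (|v| * C) * C * T) :=
          mul_le_mul_of_nonneg_left hfin (Real.exp_pos _).le
      _ = (c / B) * (Real.exp (I T) * (C * C * T)) * |v| := by ring
      _ ≤ (c / B) * B * |v| := by
          gcongr
          rw [hB]; linarith
      _ = c * |v| := by field_simp
  · have hm0 : 0 < a / C := div_pos ha hC0
    filter_upwards [Metric.ball_mem_nhds (0 : ℝ) hm0] with v hv
    have hv' : |v| < a / C := by simpa using hv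
    refine ⟨φ v, Ioo (-1) (T + 1) ∩ φ v ⁻¹' Ioo (-a) a,
      ((hφc v).mono Ioo_subset_Icc_self).isOpen_inter_preimage isOpen_Ioo isOpen_Ioo,
      fun t ht => ⟨hsub ht, ?_⟩, inter_subset_left, hφ0' v, rfl, fun t ht => ⟨ht.2, ?_⟩⟩
    · exact abs_lt.1 ((hgrow v t ht).trans_lt ((lt_div_iff₀ hC0).1 hv'))
    · have h1 := hφd' v t ht.1
      rwa [hG, show (fun t x => F t (clamp a x)) t (φ v t) = F t (φ v t) by
        simp only [clamp_of_mem (Ioo_subset_Icc_self ht.2)]] at h1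

end ReturnMap

end HarmonicMC

namespace HarmonicMC

/-! ### The slope of the maximal harmonic mean curvature lines -/

/-- The point of the plane with coordinates `s`, `v`. -/
def pt (s v : ℝ) : Plane := WithLp.toLp 2 ![s, v]

@[simp] theorem pt_zero (s v : ℝ) : pt s v 0 = s := rfl

@[simp] theorem pt_one (s v : ℝ) : pt s v 1 = v := rfl

theorem pt_eq (s v : ℝ) : pt s v = s • dir 0 + v • dir 1 := by
  rw [plane_eq (pt s v), pt_zero, pt_one]

theorem contDiff_pt {n : WithTop ℕ∞} : ContDiff ℝ n (fun x : ℝ × ℝ => pt x.1 x.2) := by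
  simp only [pt_eq]
  exact (contDiff_fst.smul contDiff_const).add (contDiff_snd.smul contDiff_const)

theorem hasDerivAt_pt {f g : ℝ → ℝ} {f' g' t : ℝ} (hf : HasDerivAt f f' t)
    (hg : HasDerivAt g g' t) : HasDerivAt (fun t => pt (f t) (g t)) (pt f' g') t := by
  simp only [pt_eq]
  exact (hf.smul_const _).fun_add (hg.smul_const _)

/-- The coefficients of the quadratic form `II - (𝒦/ℋ) I`. -/
noncomputable def harmonicCoeff (F : Plane → Space) (i j : Fin 2) (y : Plane) : ℝ :=
  secondForm F y (dir i) (dir j) - patchHarmonic F y * firstForm F y (dir i) (dir j)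

/-- The discriminant of the quadratic form `II - (𝒦/ℋ) I`. -/
noncomputable def harmonicDisc (F : Plane → Space) (y : Plane) : ℝ :=
  harmonicCoeff F 0 1 y ^ 2 - harmonicCoeff F 0 0 y * harmonicCoeff F 1 1 y

/-- The slope `dv/ds` of the harmonic mean curvature lines near the axis. -/
noncomputable def slope (F : Plane → Space) (y : Plane) : ℝ :=
  - harmonicCoeff F 0 0 y / (harmonicCoeff F 0 1 y + √(harmonicDisc F y))

section Slope

variable {F : Plane → Space} {y : Plane}

/-- `slope` is the rationalized quadratic formula: it selects the root that vanishes together with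
`harmonicCoeff F 0 0`, and it does not divide by `harmonicCoeff F 1 1`, which may be zero. -/
theorem slope_root (hb : 0 < harmonicCoeff F 0 1 y) (hd : 0 < harmonicDisc F y) :
    harmonicCoeff F 0 0 y + 2 * harmonicCoeff F 0 1 y * slope F y
      + harmonicCoeff F 1 1 y * slope F y ^ 2 = 0 := by
  have h1 := Real.sq_sqrt hd.le
  have h2 := Real.sqrt_nonneg (harmonicDisc F y)
  rw [slope]
  set q := √(harmonicDisc F y)
  rw [harmonicDisc] at h1
  have h3 : harmonicCoeff F 0 1 y + q ≠ 0 := by positivity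
  field_simp
  linear_combination (harmonicCoeff F 0 0 y) * h1

theorem patchNormalCurvature_slope (hF : ContDiffAt ℝ 2 F y)
    (hi : Function.Injective (fderiv ℝ F y)) (hb : 0 < harmonicCoeff F 0 1 y)
    (hd : 0 < harmonicDisc F y) :
    patchNormalCurvature F y (pt 1 (slope F y)) = patchHarmonic F y := by
  have hu : pt 1 (slope F y) ≠ 0 := fun h => by
    have := congrArg (fun z : Plane => z 0) h
    simp at this
  have h1 := slope_root hb hd
  rw [patchNormalCurvature, div_eq_iff (firstForm_pos hi hu).ne', secondForm_expand hF,
    firstForm_expand, pt_zero, pt_one]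
  simp only [harmonicCoeff] at h1
  linear_combination h1

theorem contDiffAt_harmonicCoeff {n : WithTop ℕ∞} (hF : ContDiffAt ℝ (n + 2) F y)
    (hi : Function.Injective (fderiv ℝ F y)) (hm : patchMean F y ≠ 0) (i j : Fin 2) :
    ContDiffAt ℝ n (harmonicCoeff F i j) y :=
  (hF.secondForm (y := id) hi contDiffAt_id contDiffAt_const contDiffAt_const).sub
    ((hF.patchHarmonic (y := id) hi hm contDiffAt_id).mul
      ((hF.of_le (le_self_add.trans (add_one_add_one_le n))).firstForm (y := id) contDiffAt_id
        contDiffAt_const contDiffAt_const))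

theorem contDiffAt_harmonicDisc {n : WithTop ℕ∞} (hF : ContDiffAt ℝ (n + 2) F y)
    (hi : Function.Injective (fderiv ℝ F y)) (hm : patchMean F y ≠ 0) :
    ContDiffAt ℝ n (harmonicDisc F) y :=
  ((contDiffAt_harmonicCoeff hF hi hm 0 1).pow 2).sub
    ((contDiffAt_harmonicCoeff hF hi hm 0 0).mul (contDiffAt_harmonicCoeff hF hi hm 1 1))

theorem contDiffAt_slope {n : WithTop ℕ∞} (hF : ContDiffAt ℝ (n + 2) F y)
    (hi : Function.Injective (fderiv ℝ F y)) (hm : patchMean F y ≠ 0)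
    (hb : 0 < harmonicCoeff F 0 1 y) (hd : 0 < harmonicDisc F y) :
    ContDiffAt ℝ n (slope F) y :=
  (contDiffAt_harmonicCoeff hF hi hm 0 0).neg.div
    ((contDiffAt_harmonicCoeff hF hi hm 0 1).add
      ((contDiffAt_harmonicDisc hF hi hm).sqrt hd.ne'))
    (add_pos_of_pos_of_nonneg hb (Real.sqrt_nonneg _)).ne'

theorem slope_eq_zero (h0 : harmonicCoeff F 0 0 y = 0) : slope F y = 0 := by
  rw [slope, h0, neg_zero, zero_div]

theorem harmonicDisc_pos (h0 : harmonicCoeff F 0 0 y = 0) (hb : 0 < harmonicCoeff F 0 1 y) :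
    0 < harmonicDisc F y := by
  rw [harmonicDisc, h0]
  nlinarith

/-- Where `II - (𝒦/ℋ) I` vanishes on `∂/∂s`, the derivative of the slope in the direction of `v`. -/
theorem fderiv_slope (hF : ContDiffAt ℝ 3 F y)
    (hi : Function.Injective (fderiv ℝ F y)) (hm : patchMean F y ≠ 0)
    (h0 : harmonicCoeff F 0 0 y = 0) (hb : 0 < harmonicCoeff F 0 1 y) (u : Plane) :
    fderiv ℝ (slope F) y u =
      - fderiv ℝ (harmonicCoeff F 0 0) y u / (2 * harmonicCoeff F 0 1 y) := by
  have hF' : ContDiffAt ℝ (1 + 2) F y := by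
    have : (1 + 2 : WithTop ℕ∞) = 3 := by norm_num
    rwa [this]
  have hd := harmonicDisc_pos h0 hb
  have d1 := (contDiffAt_harmonicCoeff hF' hi hm 0 0).differentiableAt one_ne_zero
  have d2 := (((contDiffAt_harmonicCoeff hF' hi hm 0 1).add
      ((contDiffAt_harmonicDisc hF' hi hm).sqrt hd.ne')).inv
      (add_pos_of_pos_of_nonneg hb (Real.sqrt_nonneg _)).ne').differentiableAt one_ne_zero
  have h1 : √(harmonicDisc F y) = harmonicCoeff F 0 1 y := by
    rw [harmonicDisc, h0, zero_mul, sub_zero, Real.sqrt_sq hb.le]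
  set w : Plane → ℝ := (fun x => harmonicCoeff F 0 1 x + √(harmonicDisc F x))⁻¹ with hw
  have hwy : w y = (harmonicCoeff F 0 1 y + harmonicCoeff F 0 1 y)⁻¹ := by
    change (harmonicCoeff F 0 1 y + √(harmonicDisc F y))⁻¹ = _
    rw [h1]
  have h2 := (d1.hasFDerivAt.fun_neg.fun_mul d2.hasFDerivAt).fderiv
  have h3 : slope F = fun z => -harmonicCoeff F 0 0 z * w z := by
    ext z
    rw [slope, div_eq_mul_inv]
    rfl
  rw [h3, h2]
  -- The derivative of `w` is multiplied by `harmonicCoeff F 0 0 y = 0`, and `w y` is the inverse of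
  -- `2 * harmonicCoeff F 0 1 y`.
  simp only [h0, hwy, add_apply, smul_apply, neg_apply, smul_eq_mul, neg_zero, zero_mul, zero_add]
  rw [← two_mul]
  field_simp

end Slope

end HarmonicMC

namespace HarmonicMC

/-! ### Perturbations of third order along the axis -/

/-- The map `(s, v) ↦ v^k m(s)`. -/
noncomputable def axisPow (k : ℕ) (m : ℝ → Space) (y : Plane) : Space := y 1 ^ k • m (y 0)

section AxisPow

variable {k : ℕ} {m : ℝ → Space}

theorem hasFDerivAt_coord (j : Fin 2) (y : Plane) :
    HasFDerivAt (fun z : Plane => z j) (EuclideanSpace.proj j : Plane →L[ℝ] ℝ) y :=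
  (EuclideanSpace.proj j : Plane →L[ℝ] ℝ).hasFDerivAt

theorem contDiff_axisPow {n : WithTop ℕ∞} (hm : ContDiff ℝ n m) : ContDiff ℝ n (axisPow k m) :=
  ((EuclideanSpace.proj 1 : Plane →L[ℝ] ℝ).contDiff.pow k).smul
    (hm.comp (EuclideanSpace.proj 0 : Plane →L[ℝ] ℝ).contDiff)

theorem fderiv_axisPow (hm : ContDiff ℝ 1 m) (y u : Plane) : fderiv ℝ (axisPow k m) y u =
    (k * u 1) • axisPow (k - 1) m y + u 0 • axisPow k (deriv m) y := by
  have h1 : HasFDerivAt (fun z : Plane => m (z 0))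
      ((ContinuousLinearMap.toSpanSingleton ℝ (deriv m (y 0))).comp
        (EuclideanSpace.proj 0 : Plane →L[ℝ] ℝ)) y :=
    HasFDerivAt.comp y (f := fun z : Plane => z 0)
      ((hm.differentiable one_ne_zero (y 0)).hasDerivAt.hasFDerivAt) (hasFDerivAt_coord 0 y)
  have h2 := ((hasDerivAt_pow k (y 1)).comp_hasFDerivAt y (hasFDerivAt_coord 1 y)).fun_smul h1
  have h3 : axisPow k m = fun z : Plane => ((fun x : ℝ => x ^ k) ∘ fun z : Plane => z 1) z •
    m (z 0) := rfl
  rw [h3, h2.fderiv]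
  simp [axisPow, smul_smul]
  rw [add_comm]
  congr 2 <;> ring

theorem fderiv_fderiv_axisPow (hm : ContDiff ℝ 2 m) (y u w : Plane) :
    fderiv ℝ (fderiv ℝ (axisPow k m)) y u w =
      (k * w 1) • ((((k - 1 : ℕ) : ℝ) * u 1) • axisPow (k - 1 - 1) m y
        + u 0 • axisPow (k - 1) (deriv m) y)
      + w 0 • ((k * u 1) • axisPow (k - 1) (deriv m) y + u 0 • axisPow k (deriv (deriv m)) y) := by
  have hm1 : ContDiff ℝ 1 m := hm.of_le one_le_two
  have hm' : ContDiff ℝ 1 (deriv m) := by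
    have : ContDiff ℝ (1 + 1) m := by rwa [one_add_one_eq_two]
    exact (contDiff_succ_iff_deriv.1 this).2.2
  have hd : DifferentiableAt ℝ (fderiv ℝ (axisPow k m)) y :=
    (((contDiff_axisPow hm).fderiv_right (m := 1) (by norm_num)).differentiable one_ne_zero) y
  have h1 : fderiv ℝ (fderiv ℝ (axisPow k m)) y u w =
      fderiv ℝ (fun z => fderiv ℝ (axisPow k m) z w) y u := by
    rw [fderiv_clm_apply hd (differentiableAt_const w)]
    simp
  have h2 : (fun z => fderiv ℝ (axisPow k m) z w) = fun z =>
      (k * w 1) • axisPow (k - 1) m z + w 0 • axisPow k (deriv m) z :=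
    funext fun z => fderiv_axisPow hm1 z w
  have d1 := ((contDiff_axisPow (k := k - 1) hm1).differentiable one_ne_zero y).hasFDerivAt
  have d2 := ((contDiff_axisPow (k := k) hm').differentiable one_ne_zero y).hasFDerivAt
  rw [h1, h2, ((d1.fun_const_smul (k * w 1)).fun_add (d2.fun_const_smul (w 0))).fderiv]
  simp [fderiv_axisPow hm1, fderiv_axisPow hm']

theorem axisPow_axis (hk : k ≠ 0) (s : ℝ) : axisPow k m (pt s 0) = 0 := by
  simp [axisPow, hk]

theorem hasDerivAt_line (s v : ℝ) : HasDerivAt (fun v => pt s v) (dir 1) v := by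
  have h := hasDerivAt_pt (hasDerivAt_const v s) (hasDerivAt_id v)
  rwa [pt_eq 0 1, zero_smul, one_smul, zero_add] at h

theorem hasDerivAt_axisPow_line (hm : ContDiff ℝ 1 m) (s : ℝ) :
    HasDerivAt (fun v => axisPow k m (pt s v)) ((k : ℝ) • axisPow (k - 1) m (pt s 0)) 0 := by
  have h1 := ((contDiff_axisPow (k := k) hm).differentiable one_ne_zero (pt s 0)).hasFDerivAt
  have h2 : HasDerivAt (fun v => axisPow k m (pt s v)) _ 0 :=
    h1.comp_hasDerivAt 0 (hasDerivAt_line s 0)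
  rw [fderiv_axisPow hm] at h2
  simpa [dir] using h2

end AxisPow

theorem hasDerivAt_clm_apply {E F : Type*} [NormedAddCommGroup E] [NormedSpace ℝ E]
    [NormedAddCommGroup F] [NormedSpace ℝ F] {A : ℝ → E →L[ℝ] F} {A' : E →L[ℝ] F} {t : ℝ}
    (h : HasDerivAt A A' t) (u : E) : HasDerivAt (fun v => A v u) (A' u) t := by
  simpa using h.clm_apply (hasDerivAt_const t u)

section Perturbation

variable {P Q : Plane → Space} {m : ℝ → Space} {ε s : ℝ}

theorem fderiv_perturbation (hP : ContDiffAt ℝ 3 P (pt s 0)) (hm : ContDiff ℝ 2 m)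
    (hQ : Q =ᶠ[𝓝 (pt s 0)] fun y => P y + ε • axisPow 3 m y) :
    ∀ᶠ y in 𝓝 (pt s 0), fderiv ℝ Q y = fderiv ℝ P y + ε • fderiv ℝ (axisPow 3 m) y ∧
      fderiv ℝ (fderiv ℝ Q) y =
        fderiv ℝ (fderiv ℝ P) y + ε • fderiv ℝ (fderiv ℝ (axisPow 3 m)) y := by
  have h1 : fderiv ℝ Q =ᶠ[𝓝 (pt s 0)] fun y => fderiv ℝ P y + ε • fderiv ℝ (axisPow 3 m) y := by
    filter_upwards [hQ.eventuallyEq_nhds, hP.eventually (by simp)] with y i1 i2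
    rw [i1.fderiv_eq]
    exact ((i2.differentiableAt (by norm_num)).hasFDerivAt.fun_add
      (((contDiff_axisPow hm).differentiable two_ne_zero y).hasFDerivAt.fun_const_smul ε)).fderiv
  filter_upwards [h1, h1.eventuallyEq_nhds, hP.eventually (by simp)] with y i1 i2 i3
  refine ⟨i1, ?_⟩
  rw [i2.fderiv_eq]
  have d1 : DifferentiableAt ℝ (fderiv ℝ P) y :=
    (i3.fderiv_right (m := 1) (by norm_num)).differentiableAt one_ne_zero
  have d2 : DifferentiableAt ℝ (fderiv ℝ (axisPow 3 m)) y :=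
    (((contDiff_axisPow hm).fderiv_right (m := 1) (by norm_num)).differentiable one_ne_zero) y
  exact (d1.hasFDerivAt.fun_add (d2.hasFDerivAt.fun_const_smul ε)).fderiv

/-- A perturbation of third order does not change the 2-jet along the axis. -/
theorem jet_perturbation (hP : ContDiffAt ℝ 3 P (pt s 0)) (hm : ContDiff ℝ 2 m)
    (hQ : Q =ᶠ[𝓝 (pt s 0)] fun y => P y + ε • axisPow 3 m y) :
    fderiv ℝ Q (pt s 0) = fderiv ℝ P (pt s 0) ∧
      fderiv ℝ (fderiv ℝ Q) (pt s 0) = fderiv ℝ (fderiv ℝ P) (pt s 0) := by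
  obtain ⟨h1, h2⟩ := (fderiv_perturbation hP hm hQ).self_of_nhds
  rw [h1, h2]
  constructor
  · ext1 u
    simp [fderiv_axisPow (hm.of_le one_le_two), axisPow_axis]
  · ext1 u
    ext1 w
    simp [fderiv_fderiv_axisPow hm, axisPow_axis]

/-- The derivatives of the first and second partial derivatives along a coordinate line. -/
theorem hasDerivAt_perturbation (hP : ContDiffAt ℝ 3 P (pt s 0)) (hm : ContDiff ℝ 2 m)
    (hQ : Q =ᶠ[𝓝 (pt s 0)] fun y => P y + ε • axisPow 3 m y) :
    ∃ (p : Plane → Space) (p₂ : Plane → Plane → Space),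
      (∀ u, HasDerivAt (fun v => fderiv ℝ P (pt s v) u) (p u) 0) ∧
      (∀ u, HasDerivAt (fun v => fderiv ℝ Q (pt s v) u) (p u) 0) ∧
      (∀ u w, HasDerivAt (fun v => fderiv ℝ (fderiv ℝ P) (pt s v) u w) (p₂ u w) 0) ∧
      ∀ u w, HasDerivAt (fun v => fderiv ℝ (fderiv ℝ Q) (pt s v) u w)
        (p₂ u w + (ε * (6 * (u 1 * w 1))) • m s) 0 := by
  have hline : ContinuousAt (fun v => pt s v) 0 := (hasDerivAt_line s 0).continuousAt
  have hev := hline.eventually (fderiv_perturbation hP hm hQ)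
  have hm1 : ContDiff ℝ 1 m := hm.of_le one_le_two
  have hm' : ContDiff ℝ 1 (deriv m) := by
    have : ContDiff ℝ (1 + 1) m := by rwa [one_add_one_eq_two]
    exact (contDiff_succ_iff_deriv.1 this).2.2
  have d1 : DifferentiableAt ℝ (fderiv ℝ P) (pt s 0) :=
    (hP.fderiv_right (m := 1) (by norm_num)).differentiableAt one_ne_zero
  have d2 : DifferentiableAt ℝ (fderiv ℝ (fderiv ℝ P)) (pt s 0) :=
    ((hP.fderiv_right (m := 2) (by norm_num)).fderiv_right (m := 1)
      (by norm_num)).differentiableAt one_ne_zero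
  have e1 (u : Plane) : HasDerivAt (fun v => fderiv ℝ P (pt s v) u)
      (fderiv ℝ (fderiv ℝ P) (pt s 0) (dir 1) u) 0 :=
    hasDerivAt_clm_apply (HasFDerivAt.comp_hasDerivAt (l := fderiv ℝ P) (f := fun v => pt s v)
      (0 : ℝ) d1.hasFDerivAt (hasDerivAt_line s 0)) u
  have e2 (u w : Plane) : HasDerivAt (fun v => fderiv ℝ (fderiv ℝ P) (pt s v) u w)
      (fderiv ℝ (fderiv ℝ (fderiv ℝ P)) (pt s 0) (dir 1) u w) 0 := by
    have i1 : HasDerivAt (fun v => fderiv ℝ (fderiv ℝ P) (pt s v))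
        (fderiv ℝ (fderiv ℝ (fderiv ℝ P)) (pt s 0) (dir 1)) 0 :=
      HasFDerivAt.comp_hasDerivAt (l := fderiv ℝ (fderiv ℝ P)) (f := fun v => pt s v) (0 : ℝ)
        d2.hasFDerivAt (hasDerivAt_line s 0)
    exact hasDerivAt_clm_apply (hasDerivAt_clm_apply i1 u) w
  have e3 (u : Plane) : HasDerivAt (fun v => fderiv ℝ (axisPow 3 m) (pt s v) u) 0 0 := by
    simp only [fderiv_axisPow hm1]
    have := ((hasDerivAt_axisPow_line (k := 3 - 1) hm1 s).fun_const_smul (((3 : ℕ) : ℝ) * u 1)).fun_add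
      ((hasDerivAt_axisPow_line (k := 3) hm' s).fun_const_smul (u 0))
    simpa [axisPow_axis] using this
  have e4 (u w : Plane) : HasDerivAt (fun v => fderiv ℝ (fderiv ℝ (axisPow 3 m)) (pt s v) u w)
      ((6 * (u 1 * w 1)) • m s) 0 := by
    simp only [fderiv_fderiv_axisPow hm]
    have hm'' : HasDerivAt (fun v => axisPow 3 (deriv (deriv m)) (pt s v)) 0 0 := by
      have := ((hasDerivAt_id (0 : ℝ)).fun_pow 3).smul_const (deriv (deriv m) s)
      simpa [axisPow] using this
    have := ((((hasDerivAt_axisPow_line (k := 3 - 1 - 1) hm1 s).fun_const_smul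
      (((3 - 1 : ℕ) : ℝ) * u 1)).fun_add
      ((hasDerivAt_axisPow_line (k := 3 - 1) hm' s).fun_const_smul (u 0))).fun_const_smul
        (((3 : ℕ) : ℝ) * w 1)).fun_add
      ((((hasDerivAt_axisPow_line (k := 3 - 1) hm' s).fun_const_smul
        (((3 : ℕ) : ℝ) * u 1)).fun_add (hm''.fun_const_smul (u 0))).fun_const_smul (w 0))
    refine this.congr_deriv ?_
    simp [axisPow, smul_smul]
    ring_nf
  refine ⟨_, _, e1, fun u => ?_, e2, fun u w => ?_⟩
  · have := (e1 u).fun_add ((e3 u).fun_const_smul ε)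
    rw [smul_zero, add_zero] at this
    refine this.congr_of_eventuallyEq ?_
    filter_upwards [hev] with v hv
    rw [hv.1]
    simp
  · have := (e2 u w).fun_add ((e4 u w).fun_const_smul ε)
    rw [smul_smul] at this
    refine this.congr_of_eventuallyEq ?_
    filter_upwards [hev] with v hv
    rw [hv.2]
    simp

end Perturbation

end HarmonicMC

/-! ### Variation of the harmonic line equation under a cubic perturbation. -/

namespace HarmonicMC

/-- The derivative of `e - (𝒦/ℋ) E` where the first fundamental form is the identity. -/
theorem hasDerivAt_coeff {E F G e f g : ℝ → ℝ} {E' F' G' e' f' g' : ℝ}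
    (hE : HasDerivAt E E' 0) (hF : HasDerivAt F F' 0) (hG : HasDerivAt G G' 0)
    (he : HasDerivAt e e' 0) (hf : HasDerivAt f f' 0) (hg : HasDerivAt g g' 0)
    (hE0 : E 0 = 1) (hF0 : F 0 = 0) (hG0 : G 0 = 1) (hS : e 0 + g 0 ≠ 0) :
    HasDerivAt (fun v => e v - (e v * g v - f v ^ 2) / (E v * G v - F v ^ 2) /
      ((e v * G v - 2 * f v * F v + g v * E v) / (2 * (E v * G v - F v ^ 2))) * E v)
      (e' - 2 * ((e' * g 0 + e 0 * g' - 2 * f 0 * f') + (e 0 * g 0 - f 0 ^ 2) * E') / (e 0 + g 0)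
        + 2 * (e 0 * g 0 - f 0 ^ 2) * (e' + e 0 * G' - 2 * f 0 * F' + g' + g 0 * E')
          / (e 0 + g 0) ^ 2) 0 := by
  have hn := (he.fun_mul hg).fun_sub (hf.fun_pow 2)
  have hΔ := (hE.fun_mul hG).fun_sub (hF.fun_pow 2)
  have hs := ((he.fun_mul hG).fun_sub ((hf.const_mul 2).fun_mul hF)).fun_add (hg.fun_mul hE)
  have h := he.fun_sub (((hn.fun_div hΔ (by rw [hE0, hF0, hG0]; norm_num)).fun_div
    (hs.fun_div (hΔ.const_mul 2) (by rw [hE0, hF0, hG0]; norm_num))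
    (by rw [hE0, hF0, hG0]; norm_num; simpa using hS)).fun_mul hE)
  refine h.congr_deriv ?_
  rw [hE0, hF0, hG0]
  norm_num
  field_simp
  ring

section Perturbation

variable {P Q : Plane → Space} {m : ℝ → Space} {ε s : ℝ}

/-- The effect of a perturbation of third order on the harmonic mean curvature lines. -/
theorem fderiv_harmonicCoeff_perturbation (hP : ContDiffAt ℝ 3 P (pt s 0)) (hm : ContDiff ℝ 3 m)
    (hQ : Q =ᶠ[𝓝 (pt s 0)] fun y => P y + ε • axisPow 3 m y)
    (hi : Function.Injective (fderiv ℝ P (pt s 0))) (hH : patchMean P (pt s 0) ≠ 0)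
    (hE : firstForm P (pt s 0) (dir 0) (dir 0) = 1)
    (hF : firstForm P (pt s 0) (dir 0) (dir 1) = 0)
    (hG : firstForm P (pt s 0) (dir 1) (dir 1) = 1) (h0 : harmonicCoeff P 0 0 (pt s 0) = 0) :
    fderiv ℝ (harmonicCoeff Q 0 0) (pt s 0) (dir 1) =
      fderiv ℝ (harmonicCoeff P 0 0) (pt s 0) (dir 1)
        - ε * (6 * inner ℝ (patchNormal P (pt s 0)) (m s)) *
          (patchGauss P (pt s 0) / (2 * patchMean P (pt s 0) ^ 2)) := by
  obtain ⟨p, p₂, a1, a2, a3, a4⟩ := hasDerivAt_perturbation hP (hm.of_le (by norm_num)) hQ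
  obtain ⟨j1, j2⟩ := jet_perturbation hP (hm.of_le (by norm_num)) hQ
  have hP2 : ContDiffAt ℝ 2 P (pt s 0) := hP.of_le (by norm_num)
  -- The normal is a function of the first partial derivatives, whose `v`-derivatives at the axis
  -- agree for `P` and `Q`.
  have hν : ∃ N' : Space, HasDerivAt (fun v => patchNormal P (pt s v)) N' 0 ∧
      HasDerivAt (fun v => patchNormal Q (pt s v)) N' 0 := by
    set ν : Space × Space → Space := fun x => ‖vec x.1 x.2‖⁻¹ • vec x.1 x.2 with hν
    have hd : DifferentiableAt ℝ ν
        (fderiv ℝ P (pt s 0) (dir 0), fderiv ℝ P (pt s 0) (dir 1)) := by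
      have h1 := (injective_iff_vec_ne_zero _).1 hi
      have h2 : ContDiffAt ℝ 1 (fun x : Space × Space => vec x.1 x.2)
        (fderiv ℝ P (pt s 0) (dir 0), fderiv ℝ P (pt s 0) (dir 1)) := contDiff_vec.contDiffAt
      exact (((h2.norm ℝ h1).inv (by simpa using h1)).smul h2).differentiableAt one_ne_zero
    refine ⟨fderiv ℝ ν (fderiv ℝ P (pt s 0) (dir 0), fderiv ℝ P (pt s 0) (dir 1))
      (p (dir 0), p (dir 1)), ?_, ?_⟩
    · exact HasFDerivAt.comp_hasDerivAt (l := ν)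
        (f := fun v => (fderiv ℝ P (pt s v) (dir 0), fderiv ℝ P (pt s v) (dir 1))) (0 : ℝ)
        hd.hasFDerivAt ((a1 _).prodMk (a1 _))
    · refine HasFDerivAt.comp_hasDerivAt (l := ν)
        (f := fun v => (fderiv ℝ Q (pt s v) (dir 0), fderiv ℝ Q (pt s v) (dir 1))) (0 : ℝ)
        ?_ ((a2 _).prodMk (a2 _))
      rw [j1]
      exact hd.hasFDerivAt
  obtain ⟨N', n1, n2⟩ := hν
  have hN : patchNormal Q (pt s 0) = patchNormal P (pt s 0) := by
    rw [patchNormal, patchNormal, j1]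
  have hiQ : Function.Injective (fderiv ℝ Q (pt s 0)) := by rwa [j1]
  have sI (u w : Plane) : firstForm Q (pt s 0) u w = firstForm P (pt s 0) u w := by
    rw [firstForm, firstForm, j1]
  have sII (u w : Plane) : secondForm Q (pt s 0) u w = secondForm P (pt s 0) u w := by
    rw [secondForm, secondForm, j2, hN]
  have dI (u w : Plane) := (a1 u).inner ℝ (a1 w)
  have dIQ (u w : Plane) := (a2 u).inner ℝ (a2 w)
  have dII (u w : Plane) := n1.inner ℝ (a3 u w)
  have dIIQ (u w : Plane) := n2.inner ℝ (a4 u w)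
  simp only [j1, j2, hN] at dIQ dIIQ
  have hΔ : firstDet P (pt s 0) = 1 := by rw [firstDet, hE, hF, hG]; norm_num
  have hS : secondForm P (pt s 0) (dir 0) (dir 0) + secondForm P (pt s 0) (dir 1) (dir 1) ≠ 0 := by
    intro h
    refine hH ?_
    rw [patchMean, hE, hF, hG]
    simp [h]
  have hSQ : secondForm Q (pt s 0) (dir 0) (dir 0) + secondForm Q (pt s 0) (dir 1) (dir 1) ≠ 0 := by
    rwa [sII, sII]
  have b1 := hasDerivAt_coeff (dI (dir 0) (dir 0)) (dI (dir 0) (dir 1)) (dI (dir 1) (dir 1))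
    (dII (dir 0) (dir 0)) (dII (dir 0) (dir 1)) (dII (dir 1) (dir 1)) hE hF hG hS
  have b2 := hasDerivAt_coeff (dIQ (dir 0) (dir 0)) (dIQ (dir 0) (dir 1)) (dIQ (dir 1) (dir 1))
    (dIIQ (dir 0) (dir 0)) (dIIQ (dir 0) (dir 1)) (dIIQ (dir 1) (dir 1))
    ((sI _ _).trans hE) ((sI _ _).trans hF) ((sI _ _).trans hG)
    hSQ
  have hP' : ContDiffAt ℝ (1 + 2) P (pt s 0) := by
    have : (1 + 2 : WithTop ℕ∞) = 3 := by norm_num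
    rwa [this]
  have hQ' : ContDiffAt ℝ (1 + 2) Q (pt s 0) := by
    have h3 : (1 + 2 : WithTop ℕ∞) = 3 := by norm_num
    rw [h3]
    exact (hP.add ((contDiff_axisPow hm).const_smul ε).contDiffAt).congr_of_eventuallyEq hQ
  have hHQ : patchMean Q (pt s 0) ≠ 0 := by
    simpa only [patchMean, firstDet, sI, sII] using hH
  have c1 := HasFDerivAt.comp_hasDerivAt (l := harmonicCoeff P 0 0) (f := fun v => pt s v) (0 : ℝ)
    ((contDiffAt_harmonicCoeff hP' hi hH 0 0).differentiableAt one_ne_zero).hasFDerivAt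
    (hasDerivAt_line s 0)
  have c2 := HasFDerivAt.comp_hasDerivAt (l := harmonicCoeff Q 0 0) (f := fun v => pt s v) (0 : ℝ)
    ((contDiffAt_harmonicCoeff hQ' hiQ hHQ 0 0).differentiableAt one_ne_zero).hasFDerivAt
    (hasDerivAt_line s 0)
  -- The relation `e = 𝒦/ℋ = 2(eg - f²)/(e + g)` on the axis, cleared of denominators.
  have h0' : secondForm P (pt s 0) (dir 0) (dir 0) ^ 2 + 2 * secondForm P (pt s 0) (dir 0) (dir 1) ^ 2
      = secondForm P (pt s 0) (dir 0) (dir 0) * secondForm P (pt s 0) (dir 1) (dir 1) := by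
    rw [harmonicCoeff, patchHarmonic, patchGauss, patchMean, hΔ, hE, hF, hG] at h0
    norm_num at h0
    field_simp at h0
    linear_combination h0
  have hR : patchGauss P (pt s 0) / (2 * patchMean P (pt s 0) ^ 2) =
      2 * (secondForm P (pt s 0) (dir 0) (dir 0) * secondForm P (pt s 0) (dir 1) (dir 1)
        - secondForm P (pt s 0) (dir 0) (dir 1) ^ 2) /
      (secondForm P (pt s 0) (dir 0) (dir 0) + secondForm P (pt s 0) (dir 1) (dir 1)) ^ 2 := by
    rw [patchGauss, patchMean, hΔ, hE, hF, hG]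
    norm_num
    field_simp
  -- The same relation, in the form that merges the two `g'` terms of `hasDerivAt_coeff` into a
  -- multiple of `𝒦/(2ℋ²)`.
  have hK : secondForm P (pt s 0) (dir 0) (dir 0) /
      (secondForm P (pt s 0) (dir 0) (dir 0) + secondForm P (pt s 0) (dir 1) (dir 1)) =
      2 * (secondForm P (pt s 0) (dir 0) (dir 0) * secondForm P (pt s 0) (dir 1) (dir 1)
        - secondForm P (pt s 0) (dir 0) (dir 1) ^ 2) /
      (secondForm P (pt s 0) (dir 0) (dir 0) + secondForm P (pt s 0) (dir 1) (dir 1)) ^ 2 := by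
    field_simp
    linear_combination h0'
  have d01 : (dir 0 : Plane) 1 = 0 := by simp [dir]
  have d11 : (dir 1 : Plane) 1 = 1 := by simp [dir]
  rw [hR, c1.unique b1, c2.unique b2]
  simp only [secondForm] at hK
  simp only [hN, j2, d01, d11, inner_add_right, inner_smul_right, secondForm]
  linear_combination (-2 * (6 * ε * inner ℝ (patchNormal P (pt s 0)) (m s))) * hK

end Perturbation

end HarmonicMC

namespace HarmonicMC

/-! ### The adapted chart along the cycle -/

/-- A strip `(s, v) ↦ X (s, v)` as a map on the parameter plane. -/
def planar {M : Type*} (X : ℝ × ℝ → M) (y : Plane) : M := X (y 0, y 1)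

@[simp] theorem planar_pt {M : Type*} (X : ℝ × ℝ → M) (s v : ℝ) : planar X (pt s v) = X (s, v) := rfl

variable {M : Type*} [TopologicalSpace M] [ChartedSpace Plane M]

theorem contDiff_coords {n : WithTop ℕ∞} : ContDiff ℝ n (fun y : Plane => (y 0, y 1)) :=
  (EuclideanSpace.proj 0 : Plane →L[ℝ] ℝ).contDiff.prodMk
    (EuclideanSpace.proj 1 : Plane →L[ℝ] ℝ).contDiff

theorem hasDerivAt_axis (s : ℝ) : HasDerivAt (fun t => pt t 0) (dir 0) s := by
  have h := hasDerivAt_pt (hasDerivAt_id s) (hasDerivAt_const s 0)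
  have e : pt 1 0 = dir 0 := by rw [pt_eq]; simp
  rwa [e] at h

theorem dir_zero_ne_zero : dir 0 ≠ 0 := by
  intro h
  simpa [dir] using congrArg (fun y : Plane => y 0) h

/-- When `N ∧ F_s = F_v` and `|F_s| = 1`, the torsion is `-⟨N_s, F_v⟩`, and the Weingarten relation
applies. -/
theorem patchTorsion_eq_secondForm {F : Plane → Space} {y : Plane} (hF : ContDiffAt ℝ 2 F y)
    (hi : Function.Injective (fderiv ℝ F y)) (h1 : firstForm F y (dir 0) (dir 0) = 1)
    (h : vec (patchNormal F y) (fderiv ℝ F y (dir 0)) = fderiv ℝ F y (dir 1)) :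
    patchTorsion F y (dir 0) = secondForm F y (dir 0) (dir 1) := by
  rw [patchTorsion, h, h1, inner_fderiv_patchNormal hF hi]
  simp

theorem IsSmoothStrip.contDiffAt_comp_planar {n : ℕ} {X : ℝ × ℝ → M} {η₀ : ℝ}
    (hS : IsSmoothStrip n X η₀) {f : M → Space} (hf : ContMDiff (𝓡 2) 𝓘(ℝ, Space) n f)
    {y : Plane} (hy : y 1 ∈ Ioo (-η₀) η₀) : ContDiffAt ℝ n (f ∘ planar X) y :=
  ContDiffAt.comp (g := f ∘ X) (f := fun y : Plane => (y 0, y 1)) y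
    (hS.contDiffAt_comp hf hy) contDiff_coords.contDiffAt

section Chart

variable {n : ℕ} {α : M → Space} {c : ℝ → M} {L : ℝ}
  {k : ℕ} {η η₀ : ℝ} {X : ℝ × ℝ → M}

/-- Continuity of `B` suffices: the difference quotient of `v³ B(v)` at `0` is `v² B(v)`, which
tends to `0`. -/
theorem hasDerivAt_cubic {E : Type*} [NormedAddCommGroup E] [NormedSpace ℝ E] (γ W N : E)
    (a b η : ℝ) (hη : 0 < η) {B : ℝ → ℝ} (hB : ContinuousOn B (Ioo (-η) η)) :
    HasDerivAt (fun v => γ + v • W + (a * (v ^ 2 / 2) + b * v ^ 3 + v ^ 3 * B v) • N) W 0 := by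
  have hB0 : ContinuousAt B 0 := hB.continuousAt (Ioo_mem_nhds (by linarith) hη)
  have h3 : HasDerivAt (fun v => v ^ 3 * B v) 0 0 := by
    rw [hasDerivAt_iff_tendsto_slope]
    have : Tendsto (fun v => v ^ 2 * B v) (𝓝[≠] 0) (𝓝 0) := by
      have h : ContinuousAt (fun v => v ^ 2 * B v) 0 := (continuousAt_id.pow 2).mul hB0
      simpa using h.tendsto.mono_left (nhdsWithin_le_nhds (s := {0}ᶜ))
    refine this.congr' ?_
    filter_upwards [self_mem_nhdsWithin] with v hv
    have hv' : v ≠ 0 := hv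
    rw [slope_def_field]
    field_simp
    ring
  have h2 : HasDerivAt (fun v : ℝ => a * (v ^ 2 / 2) + b * v ^ 3) 0 0 := by
    have i1 := ((hasDerivAt_pow 2 (0 : ℝ)).div_const 2).const_mul a
    have i2 := (hasDerivAt_pow 3 (0 : ℝ)).const_mul b
    simpa using i1.fun_add i2
  have h := (((hasDerivAt_id (0 : ℝ)).smul_const W).const_add γ).fun_add
    ((h2.fun_add h3).smul_const N)
  simpa using h

theorem IsAdaptedChart.hasDerivAt_normal (hX : IsAdaptedChart k α c L η X) (s : ℝ) :
    HasDerivAt (fun v => α (X (s, v))) (conormal α c s) 0 := by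
  obtain ⟨A, B, -, hB, -, hf⟩ := hX.form
  have hBs : ContinuousOn (fun v => B (s, v)) (Ioo (-η) η) :=
    hB.comp (by fun_prop) fun v hv => ⟨mem_univ _, hv⟩
  refine (hasDerivAt_cubic (α (c s)) (conormal α c s) (unitNormal α (c s))
    (2 * mean α (c s) - harmonicMean α (c s)) (A s / 6) η hX.pos hBs).congr_of_eventuallyEq ?_
  filter_upwards [Ioo_mem_nhds (neg_lt_zero.2 hX.pos) hX.pos] with v hv
  exact hf s v hv

variable [IsManifold (𝓡 2) ∞ M] [OrientedAtlas M] (hn : 2 ≤ n) (hα : IsImmersionOfClass (n + 2) α)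
  (hc : IsHarmonicCycle .maximal α c L) (hX : IsAdaptedChart k α c L η X)
  (hη : 0 < η₀) (hS : IsSmoothStrip n X η₀)

omit [IsManifold (𝓡 2) ∞ M] [OrientedAtlas M] in
include hα hη hS in
theorem contDiffAt_axis (s : ℝ) : ContDiffAt ℝ n (α ∘ planar X) (pt s 0) :=
  hS.contDiffAt_comp_planar (hα.1.of_le (by exact_mod_cast (by omega : n ≤ n + 2)))
    (by simpa using hη)

omit [IsManifold (𝓡 2) ∞ M] [OrientedAtlas M] in
include hn hα hX hη hS in
theorem fderiv_axis_zero (s : ℝ) :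
    fderiv ℝ (α ∘ planar X) (pt s 0) (dir 0) = tangent α c s := by
  have h1 := ((contDiffAt_axis hα hη hS s).differentiableAt
    (by exact_mod_cast (by omega : n ≠ 0))).hasFDerivAt.comp_hasDerivAt s (hasDerivAt_axis s)
  have e : (α ∘ planar X) ∘ (fun t => pt t 0) = α ∘ c := by
    funext t
    simp [hX.axis]
  rw [e] at h1
  exact h1.deriv.symm

omit [IsManifold (𝓡 2) ∞ M] [OrientedAtlas M] in
include hn hα hX hη hS in
theorem fderiv_axis_one (s : ℝ) :
    fderiv ℝ (α ∘ planar X) (pt s 0) (dir 1) = conormal α c s := by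
  have h1 := ((contDiffAt_axis hα hη hS s).differentiableAt
    (by exact_mod_cast (by omega : n ≠ 0))).hasFDerivAt.comp_hasDerivAt 0 (hasDerivAt_line s 0)
  exact h1.unique (hX.hasDerivAt_normal s)

include hn hα hc hX hη hS in
-- An adapted chart carries no orientation in its definition; positivity is read off from `α_s ∧ α_v
-- = T ∧ (N ∧ T) = N` on the axis.
theorem isPositiveParamAt_axis (s : ℝ) : IsPositiveParamAt (planar X) (pt s 0) := by
  have hn2 : (2 : WithTop ℕ∞) ≤ n := by exact_mod_cast hn
  have h0 : ((s, (0 : ℝ)) : ℝ × ℝ).2 ∈ Ioo (-η₀) η₀ := by simpa using hη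
  have hXs := hS.contMDiffAt (s, 0) h0
  set p := planar X (pt s 0) with hp
  have hcont : ContinuousAt (planar X) (pt s 0) :=
    ContinuousAt.comp (g := X) (f := fun y : Plane => (y 0, y 1)) (x := pt s 0)
      hXs.continuousAt (contDiff_coords (n := 0)).continuous.continuousAt
  have hφ : ContDiffAt ℝ 2 (extChartAt (𝓡 2) p ∘ planar X) (pt s 0) := by
    have : IsManifold (𝓡 2) n M := IsManifold.of_le (n := ∞) (by exact_mod_cast le_top)
    have h1 : ContDiffAt ℝ n (extChartAt (𝓡 2) p ∘ X) (s, 0) := by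
      rw [← contMDiffAt_iff_contDiffAt]
      exact ContMDiffAt.comp (s, 0) (contMDiffAt_extChartAt (I := 𝓡 2) (n := n) (x := p)) hXs
    exact (ContDiffAt.comp (g := extChartAt (𝓡 2) p ∘ X) (f := fun y : Plane => (y 0, y 1))
      (pt s 0) h1 contDiff_coords.contDiffAt).of_le hn2
  refine ⟨hcont, hφ, ?_⟩
  have hα2 := hα.contMDiff_two
  have e := (comp_eventuallyEq_patch α hcont).fderiv_eq (𝕜 := ℝ)
  have hd : DifferentiableAt ℝ (patch α p) ((extChartAt (𝓡 2) p ∘ planar X) (pt s 0)) :=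
    (contDiffAt_patch_coord (n := 2) (hα2 p)).differentiableAt two_ne_zero
  rw [← hp, fderiv_comp (pt s 0) hd (hφ.differentiableAt two_ne_zero)] at e
  have h1 := vec_comp (fderiv ℝ (patch α p) (coord p))
    (fderiv ℝ (extChartAt (𝓡 2) p ∘ planar X) (pt s 0))
  set m := vec (fderiv ℝ (patch α p) (coord p) (dir 0)) (fderiv ℝ (patch α p) (coord p) (dir 1))
    with hm
  have e' (u : Plane) : fderiv ℝ (patch α p) (coord p)
      (fderiv ℝ (extChartAt (𝓡 2) p ∘ planar X) (pt s 0) u) =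
      fderiv ℝ (α ∘ planar X) (pt s 0) u := by rw [e]; rfl
  have hpc : p = c s := hX.axis s
  have hN : unitNormal α (c s) = ‖m‖⁻¹ • m := by rw [← hpc]; rfl
  rw [e', e', fderiv_axis_zero hn hα hX hη hS, fderiv_axis_one hn hα hX hη hS,
    hc.vec_tangent_conormal hα, hN] at h1
  have hm0 : m ≠ 0 := (injective_iff_vec_ne_zero _).1
    (injective_fderiv_patch ((hα2 p).of_le one_le_two) (hα.2 p))
  -- Now `h1` reads `‖m‖⁻¹ • m = det • m`, so the Jacobian determinant is `‖m‖⁻¹`.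
  rw [← smul_left_injective ℝ hm0 h1]
  positivity

include hn hα hc hX hη hS in
theorem injective_fderiv_axis (s : ℝ) :
    Function.Injective (fderiv ℝ (α ∘ planar X) (pt s 0)) :=
  (isPositiveParamAt_axis hn hα hc hX hη hS s).injective_fderiv (hα.contMDiff_two _) (hα.2 _)

include hn hα hc hX hη hS in
theorem firstForm_axis (s : ℝ) :
    firstForm (α ∘ planar X) (pt s 0) (dir 0) (dir 0) = 1 ∧
      firstForm (α ∘ planar X) (pt s 0) (dir 0) (dir 1) = 0 ∧
      firstForm (α ∘ planar X) (pt s 0) (dir 1) (dir 1) = 1 := by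
  simp only [firstForm, fderiv_axis_zero hn hα hX hη hS, fderiv_axis_one hn hα hX hη hS]
  refine ⟨?_, ?_, ?_⟩
  · rw [real_inner_self_eq_norm_sq, tangent, hc.arcLength]
    norm_num
  · rw [conormal, real_inner_comm, inner_vec_right]
  · rw [real_inner_self_eq_norm_sq, hc.norm_conormal hα]
    norm_num

include hn hα hc hX hη hS in
theorem patchNormal_axis (s : ℝ) :
    patchNormal (α ∘ planar X) (pt s 0) = unitNormal α (c s) := by
  rw [← (isPositiveParamAt_axis hn hα hc hX hη hS s).unitNormal_eq (hα.contMDiff_two _),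
    planar_pt, hX.axis]

include hn hα hc hX hη hS in
theorem vec_patchNormal_axis (s : ℝ) :
    vec (patchNormal (α ∘ planar X) (pt s 0)) (fderiv ℝ (α ∘ planar X) (pt s 0) (dir 0)) =
      fderiv ℝ (α ∘ planar X) (pt s 0) (dir 1) := by
  rw [patchNormal_axis hn hα hc hX hη hS, fderiv_axis_zero hn hα hX hη hS,
    fderiv_axis_one hn hα hX hη hS, conormal]

include hX in
omit [IsManifold (𝓡 2) ∞ M] [OrientedAtlas M] in
theorem eventuallyEq_axis (s : ℝ) : c =ᶠ[𝓝 s] planar X ∘ fun t => pt t 0 :=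
  Eventually.of_forall fun t => (hX.axis t).symm

include hn hα hc hX hη hS in
theorem patchGauss_axis (s : ℝ) : patchGauss (α ∘ planar X) (pt s 0) = gauss α (c s) := by
  rw [← (isPositiveParamAt_axis hn hα hc hX hη hS s).gauss_eq (hα.contMDiff_two _),
    planar_pt, hX.axis]

include hn hα hc hX hη hS in
theorem patchMean_axis (s : ℝ) : patchMean (α ∘ planar X) (pt s 0) = mean α (c s) := by
  rw [← (isPositiveParamAt_axis hn hα hc hX hη hS s).mean_eq (hα.contMDiff_two _),
    planar_pt, hX.axis]

include hn hα hc hX hη hS in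
-- On the axis `E = 1`, so this coefficient is `k_n - 𝒦/ℋ` along `c`.
theorem harmonicCoeff_axis (s : ℝ) : harmonicCoeff (α ∘ planar X) 0 0 (pt s 0) = 0 := by
  have h := hc.line.normalCurvature_eq s (mem_univ s)
  rw [(isPositiveParamAt_axis hn hα hc hX hη hS s).normalCurvature_eq (ζ := fun t => pt t 0)
    (hα.contMDiff_two _) (hasDerivAt_axis s) (eventuallyEq_axis hX s), patchNormalCurvature,
    (firstForm_axis hn hα hc hX hη hS s).1, div_one] at h
  rw [harmonicCoeff, (firstForm_axis hn hα hc hX hη hS s).1, h, patchHarmonic,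
    patchGauss_axis hn hα hc hX hη hS, patchMean_axis hn hα hc hX hη hS, harmonicMean]
  ring

include hn hα hc hX hη hS in
theorem secondForm_axis (s : ℝ) :
    secondForm (α ∘ planar X) (pt s 0) (dir 0) (dir 1) = geodesicTorsion α c s := by
  rw [(isPositiveParamAt_axis hn hα hc hX hη hS s).geodesicTorsion_eq (ζ := fun t => pt t 0)
    (hα.contMDiff_two _) (hα.2 _) (hasDerivAt_axis s) (eventuallyEq_axis hX s),
    patchTorsion_eq_secondForm ((contDiffAt_axis hα hη hS s).of_le (by exact_mod_cast hn))
      (injective_fderiv_axis hn hα hc hX hη hS s) (firstForm_axis hn hα hc hX hη hS s).1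
      (vec_patchNormal_axis hn hα hc hX hη hS s)]

end Chart

end HarmonicMC

namespace HarmonicMC

/-! ### Surfaces with the same two-jet -/

section Jet

variable {F G : Plane → Space} {y : Plane} (h1 : fderiv ℝ F y = fderiv ℝ G y)
  (h2 : fderiv ℝ (fderiv ℝ F) y = fderiv ℝ (fderiv ℝ G) y)

include h1

theorem patchNormal_of_jet : patchNormal F y = patchNormal G y := by
  rw [patchNormal, patchNormal, h1]

theorem firstForm_of_jet (u w : Plane) : firstForm F y u w = firstForm G y u w := by
  rw [firstForm, firstForm, h1]

theorem firstDet_of_jet : firstDet F y = firstDet G y := by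
  simp only [firstDet, firstForm_of_jet h1]

include h2

theorem secondForm_of_jet (u w : Plane) : secondForm F y u w = secondForm G y u w := by
  rw [secondForm, secondForm, patchNormal_of_jet h1, h2]

theorem patchGauss_of_jet : patchGauss F y = patchGauss G y := by
  simp only [patchGauss, secondForm_of_jet h1 h2, firstDet_of_jet h1]

theorem patchMean_of_jet : patchMean F y = patchMean G y := by
  simp only [patchMean, secondForm_of_jet h1 h2, firstDet_of_jet h1, firstForm_of_jet h1]

theorem harmonicCoeff_of_jet (i j : Fin 2) : harmonicCoeff F i j y = harmonicCoeff G i j y := by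
  rw [harmonicCoeff, harmonicCoeff, secondForm_of_jet h1 h2, firstForm_of_jet h1, patchHarmonic,
    patchHarmonic, patchGauss_of_jet h1 h2, patchMean_of_jet h1 h2]

end Jet

variable {M : Type*} [TopologicalSpace M] [ChartedSpace Plane M] {n : ℕ} {α β : M → Space}
  {c : ℝ → M} {L ε : ℝ} {k : ℕ} {η η₀ : ℝ} {X : ℝ × ℝ → M} {m : ℝ → Space}

/-- Near the axis the cut-off `δ` is `1`, so the deformation is purely cubic in `v`. -/
theorem deformation_comp_planar (hX : IsAdaptedChart k α c L η X) (hc : Function.Periodic c L)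
    {A₁ δ : ℝ → ℝ} (hA : Function.Periodic A₁ L) (hδ : ∀ᶠ v in 𝓝 (0 : ℝ), δ v = 1) (ε s : ℝ) :
    deformation α c η X A₁ δ ε ∘ planar X =ᶠ[𝓝 (pt s 0)] fun y =>
      (α ∘ planar X) y + ε • axisPow 3 (fun s => (A₁ s / 6) • unitNormal α (c s)) y := by
  have h : Tendsto (fun y : Plane => y 1) (𝓝 (pt s 0)) (𝓝 0) :=
    (contDiff_coords (n := 0)).continuous.snd.continuousAt
  filter_upwards [h.eventually hδ, h.eventually (Ioo_mem_nhds (neg_lt_zero.2 hX.pos) hX.pos)]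
    with y h1 h2
  rw [Function.comp_apply, planar, deformation_chart hX hc hA δ ε _ _ h2, h1, axisPow, mul_one,
    mul_comm (A₁ _ / 6), ← smul_smul (y 1 ^ 3)]
  rfl

section Axis

variable [IsManifold (𝓡 2) ∞ M] [OrientedAtlas M] (hn : 3 ≤ n)
  (hα : IsImmersionOfClass (n + 2) α) (hc : IsHarmonicCycle .maximal α c L)
  (hX : IsAdaptedChart k α c L η X) (hη : 0 < η₀) (hS : IsSmoothStrip n X η₀)
  (hβ : IsImmersionOfClass n β) (hm : ContDiff ℝ 3 m)
  (hQ : ∀ s, β ∘ planar X =ᶠ[𝓝 (pt s 0)] fun y => (α ∘ planar X) y + ε • axisPow 3 m y)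

include hn hα hη hS hm hQ in
omit [IsManifold (𝓡 2) ∞ M] [OrientedAtlas M] in
theorem jet_axis (s : ℝ) :
    fderiv ℝ (β ∘ planar X) (pt s 0) = fderiv ℝ (α ∘ planar X) (pt s 0) ∧
      fderiv ℝ (fderiv ℝ (β ∘ planar X)) (pt s 0) =
        fderiv ℝ (fderiv ℝ (α ∘ planar X)) (pt s 0) :=
  jet_perturbation ((contDiffAt_axis hα hη hS s).of_le (by exact_mod_cast hn))
    (hm.of_le (by norm_num)) (hQ s)

include hQ hX in
omit [IsManifold (𝓡 2) ∞ M] [OrientedAtlas M] in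
theorem comp_axis : β ∘ c = α ∘ c := by
  funext s
  simpa [axisPow, hX.axis] using (hQ s).eq_of_nhds

include hn hα hc hX hη hS hβ hm hQ in
-- Curvatures, normal curvature and first fundamental form depend only on the 2-jet, which is
-- unchanged on the axis. The torsion, although defined by a derivative of the normal, equals
-- `II(∂/∂s, ∂/∂v)` there and is unchanged too.
theorem isHarmonicCycle_perturbation : IsHarmonicCycle .maximal β c L := by
  have hn2 : 2 ≤ n := by omega
  have hβ2 : ContMDiff (𝓡 2) 𝓘(ℝ, Space) 2 β := hβ.1.of_le (by exact_mod_cast hn2)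
  have hY := isPositiveParamAt_axis hn2 hα hc hX hη hS
  have hj (s : ℝ) := jet_axis hn hα hη hS hm hQ s
  have hK (s : ℝ) : gauss β (c s) = gauss α (c s) := by
    rw [← patchGauss_axis hn2 hα hc hX hη hS, ← patchGauss_of_jet (hj s).1 (hj s).2,
      ← (hY s).gauss_eq (hβ2 _), planar_pt, hX.axis]
  have hH (s : ℝ) : mean β (c s) = mean α (c s) := by
    rw [← patchMean_axis hn2 hα hc hX hη hS, ← patchMean_of_jet (hj s).1 (hj s).2,
      ← (hY s).mean_eq (hβ2 _), planar_pt, hX.axis]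
  have hu (s : ℝ) := hasDerivAt_axis s
  refine ⟨hc.length_pos, ⟨hc.line.contMDiffOn, hc.line.regular, fun s hs => ?_, fun s hs => ?_,
    fun s hs => ?_, fun s hs => ?_⟩, fun s => ?_, hc.periodic, hc.simple⟩
  · rw [hK]; exact hc.line.elliptic s hs
  · rw [hK, hH]; exact hc.line.nonumbilic s hs
  · have := hc.line.normalCurvature_eq s hs
    rw [(hY s).normalCurvature_eq (ζ := fun t => pt t 0) (hα.contMDiff_two _) (hu s)
      (eventuallyEq_axis hX s)] at this
    rw [(hY s).normalCurvature_eq (ζ := fun t => pt t 0) (hβ2 _) (hu s)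
      (eventuallyEq_axis hX s), patchNormalCurvature, secondForm_of_jet (hj s).1 (hj s).2,
      firstForm_of_jet (hj s).1, harmonicMean, hK, hH]
    exact this
  · have := hc.line.torsion_sign s hs
    rw [← secondForm_axis hn2 hα hc hX hη hS] at this
    have hv := vec_patchNormal_axis hn2 hα hc hX hη hS s
    rw [(hY s).geodesicTorsion_eq (ζ := fun t => pt t 0) (hβ2 _) (hβ.2 _) (hu s)
      (eventuallyEq_axis hX s), patchTorsion_eq_secondForm ((hY s).contDiffAt_comp (hβ2 _))
      ((hY s).injective_fderiv (hβ2 _) (hβ.2 _)), secondForm_of_jet (hj s).1 (hj s).2]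
    · exact this
    · rw [firstForm_of_jet (hj s).1]
      exact (firstForm_axis hn2 hα hc hX hη hS s).1
    · rw [patchNormal_of_jet (hj s).1, (hj s).1, hv]
  · rw [comp_axis hX hQ]
    exact hc.arcLength s

end Axis

end HarmonicMC

namespace HarmonicMC

variable {M : Type*} [TopologicalSpace M] [ChartedSpace Plane M]

/-! ### The return map of a cycle in a strip -/

theorem pt_one_ne_zero (x : ℝ) : pt 1 x ≠ 0 := by
  intro h
  simpa using congrArg (fun y : Plane => y 0) h

theorem contDiffAt_pt_one {n : WithTop ℕ∞} {f : Plane → ℝ} {y : Plane} (hf : ContDiffAt ℝ n f y) :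
    ContDiffAt ℝ n (fun z => pt 1 (f z)) y :=
  (contDiff_pt (n := n)).contDiffAt.comp y (contDiffAt_const.prodMk hf)

/-- Near the point `y` of the strip, the maximal harmonic mean curvature lines of `β` are the
graphs of the solutions of `dv/ds = slope`. -/
structure IsTransverseAt (β : M → Space) (X : ℝ × ℝ → M) (η₀ : ℝ) (y : Plane) : Prop where
  mem : y 1 ∈ Ioo (-η₀) η₀
  param : IsPositiveParamAt (planar X) y
  gauss_pos : 0 < patchGauss (β ∘ planar X) y
  nonumbilic : patchMean (β ∘ planar X) y ^ 2 - patchGauss (β ∘ planar X) y ≠ 0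
  coeff_pos : 0 < harmonicCoeff (β ∘ planar X) 0 1 y
  disc_pos : 0 < harmonicDisc (β ∘ planar X) y
  torsion_pos : 0 < patchTorsion (β ∘ planar X) y (pt 1 (slope (β ∘ planar X) y))

theorem IsImmersionOfClass.contMDiff_two_of_three {β : M → Space}
    (hβ : IsImmersionOfClass 3 β) : ContMDiff (𝓡 2) 𝓘(ℝ, Space) 2 β :=
  hβ.1.of_le (by exact_mod_cast (by norm_num : 2 ≤ 3))

section Strip

variable {β : M → Space} {c : ℝ → M} {L : ℝ} {k : ℕ} {η η₀ : ℝ} {X : ℝ × ℝ → M}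
  [IsManifold (𝓡 2) ∞ M] (hS : IsSmoothStrip 3 X η₀) (hβ : IsImmersionOfClass 3 β)

include hS hβ

theorem contDiffAt_slope_strip {y : Plane} (hm : y 1 ∈ Ioo (-η₀) η₀)
    (hp : IsPositiveParamAt (planar X) y) (hK : 0 < patchGauss (β ∘ planar X) y)
    (hb : 0 < harmonicCoeff (β ∘ planar X) 0 1 y) (hd : 0 < harmonicDisc (β ∘ planar X) y) :
    ContDiffAt ℝ 1 (slope (β ∘ planar X)) y := by
  have hi := hp.injective_fderiv (hβ.contMDiff_two_of_three _) (hβ.2 _)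
  have h3 : (1 + 2 : WithTop ℕ∞) = (3 : ℕ) := by norm_num
  exact contDiffAt_slope (by rw [h3]; exact hS.contDiffAt_comp_planar hβ.1 hm) hi
    (patchMean_ne_zero hi hK) hb hd

theorem IsTransverseAt.contDiffAt_slope {y : Plane} (h : IsTransverseAt β X η₀ y) :
    ContDiffAt ℝ 1 (slope (β ∘ planar X)) y :=
  contDiffAt_slope_strip hS hβ h.mem h.param h.gauss_pos h.coeff_pos h.disc_pos

/-- For a surface of class `C³` the curvatures, the coefficients, the slope and the torsion in the
direction of the slope are continuous, so all the strict conditions are open. -/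
theorem eventually_isTransverseAt [OrientedAtlas M] {y : Plane} (h : IsTransverseAt β X η₀ y) :
    ∀ᶠ z in 𝓝 y, IsTransverseAt β X η₀ z := by
  have hi := h.param.injective_fderiv (hβ.contMDiff_two_of_three _) (hβ.2 _)
  have h3 : (1 + 2 : WithTop ℕ∞) = (3 : ℕ) := by norm_num
  have hF : ContDiffAt ℝ (1 + 2) (β ∘ planar X) y := by
    rw [h3]; exact hS.contDiffAt_comp_planar hβ.1 h.mem
  have hM := patchMean_ne_zero hi h.gauss_pos
  have cid : ContDiffAt ℝ 1 (fun z : Plane => z) y := contDiffAt_id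
  have cK := (ContDiffAt.patchGauss (y := fun z => z) hF hi cid).continuousAt
  have cM := (ContDiffAt.patchMean (y := fun z => z) hF hi cid).continuousAt
  have cs := h.contDiffAt_slope hS hβ
  have cτ := (ContDiffAt.patchTorsion (y := fun z => z)
    (u := fun z => pt 1 (slope (β ∘ planar X) z)) hF hi cid (contDiffAt_pt_one cs)
    (pt_one_ne_zero _)).continuousAt
  have cb := (contDiffAt_harmonicCoeff hF hi hM 0 1).continuousAt
  have cd := (contDiffAt_harmonicDisc hF hi hM).continuousAt
  have ce : ContinuousAt (fun z : Plane => z 1) y :=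
    (contDiff_coords (n := 0)).continuous.snd.continuousAt
  filter_upwards [ce.eventually (isOpen_Ioo.mem_nhds h.mem), h.param.eventually,
    cK.eventually (lt_mem_nhds h.gauss_pos),
    ((cM.pow 2).sub cK).eventually (isOpen_ne.mem_nhds h.nonumbilic),
    cb.eventually (lt_mem_nhds h.coeff_pos), cd.eventually (lt_mem_nhds h.disc_pos),
    cτ.eventually (lt_mem_nhds h.torsion_pos)] with z i1 i2 i3 i4 i5 i6 i7
  exact ⟨i1, i2, i3, i4, i5, i6, i7⟩

/-- The tangent `(1, slope)` of the graph is a null direction of `II - (𝒦/ℋ) I`, and transversality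
supplies the remaining conditions. -/
theorem isHarmonicLineOn_graph {φ : ℝ → ℝ} {J : Set ℝ} (hJ : IsOpen J)
    (hφ : ∀ t ∈ J, IsTransverseAt β X η₀ (pt t (φ t)) ∧
      HasDerivAt φ (slope (β ∘ planar X) (pt t (φ t))) t) :
    IsHarmonicLineOn .maximal β (fun t => planar X (pt t (φ t))) J := by
  have hβ2 := hβ.contMDiff_two_of_three
  set ζ : ℝ → Plane := fun t => pt t (φ t) with hζ
  have hd : ∀ t ∈ J, HasDerivAt ζ (pt 1 (slope (β ∘ planar X) (ζ t))) t := fun t ht =>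
    hasDerivAt_pt (hasDerivAt_id t) (hφ t ht).2
  have hγ (t : ℝ) : (fun t => planar X (pt t (φ t))) =ᶠ[𝓝 t] planar X ∘ ζ := EventuallyEq.rfl
  refine ⟨fun t ht => ?_, fun t ht => ?_, fun t ht => ?_, fun t ht => ?_, fun t ht => ?_,
    fun t ht => ?_⟩
  · have h1 : ContDiffAt ℝ ((0 + 1 : ℕ)) ζ t := by
      refine contDiffAt_of_deriv_eq_comp (V := fun z => pt 1 (slope (β ∘ planar X) z)) (n := 0)
        (contDiffAt_pt_one (((hφ t ht).1.contDiffAt_slope hS hβ).of_le (by norm_num))) ?_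
      filter_upwards [hJ.mem_nhds ht] with s hs using hd s hs
    have h2 : ContMDiffAt 𝓘(ℝ, ℝ) 𝓘(ℝ, ℝ × ℝ) 1 (fun t => (ζ t 0, ζ t 1)) t :=
      ((contDiff_coords (n := 1)).contDiffAt.comp t (by simpa using h1)).contMDiffAt
    exact (ContMDiffAt.comp t (g := X) (f := fun t => (ζ t 0, ζ t 1))
      ((hS.contMDiffAt _ (hφ t ht).1.mem).of_le (by norm_num)) h2).contMDiffWithinAt
  · exact (hφ t ht).1.param.velocity_ne_zero (ζ := ζ) (hd t ht) (hγ t) (pt_one_ne_zero _)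
  · rw [(hφ t ht).1.param.gauss_eq (hβ2 _)]
    exact (hφ t ht).1.gauss_pos
  · rw [(hφ t ht).1.param.gauss_eq (hβ2 _), (hφ t ht).1.param.mean_eq (hβ2 _)]
    exact (hφ t ht).1.nonumbilic
  · obtain ⟨h, -⟩ := hφ t ht
    rw [h.param.normalCurvature_eq (ζ := ζ) (hβ2 _) (hd t ht) (hγ t),
      patchNormalCurvature_slope (h.param.contDiffAt_comp (hβ2 _))
        (h.param.injective_fderiv (hβ2 _) (hβ.2 _)) h.coeff_pos h.disc_pos, harmonicMean,
      h.param.gauss_eq (hβ2 _), h.param.mean_eq (hβ2 _), patchHarmonic]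
  · obtain ⟨h, -⟩ := hφ t ht
    change 0 < geodesicTorsion _ _ _
    rw [h.param.geodesicTorsion_eq (ζ := ζ) (hβ2 _) (hβ.2 _) (hd t ht) (hγ t)]
    exact h.torsion_pos

end Strip

end HarmonicMC

namespace HarmonicMC

variable {M : Type*} [TopologicalSpace M] [ChartedSpace Plane M] {β : M → Space} {c : ℝ → M}
  {L : ℝ} {k : ℕ} {η η₀ : ℝ} {X : ℝ × ℝ → M}

/-- The transversal `v ↦ X (0, v)` is a cross section of the axis of the strip. -/
theorem isCrossSection_transversal [IsManifold (𝓡 2) ∞ M] {α : M → Space}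
    (hX : IsAdaptedChart k α c L η X) (hη : η₀ ≤ η)
    (hS : IsSmoothStrip 3 X η₀) (hβ : IsImmersionOfClass 3 β)
    (hp : IsPositiveParamAt (planar X) (pt 0 0))
    (hF : firstForm (β ∘ planar X) (pt 0 0) (dir 0) (dir 1) = 0) {a : ℝ} (ha : 0 < a)
    (haη : a < η₀) : IsCrossSection β c a fun v => planar X (pt 0 v) := by
  have hβ2 := hβ.contMDiff_two_of_three
  have hmem : ∀ v ∈ Icc (-a) a, v ∈ Ioo (-η₀) η₀ := fun v hv =>
    ⟨by linarith [hv.1], by linarith [hv.2]⟩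
  have h0 : (0 : ℝ) ∈ Ioo (-η) η := ⟨by linarith [hX.pos], hX.pos⟩
  have hd := hasDerivAt_line 0 0
  refine ⟨ha, fun v hv => ?_, fun v hv v' hv' h => ?_, hX.axis 0, ?_, ?_, ?_⟩
  · have h2 : ContMDiffAt 𝓘(ℝ, ℝ) 𝓘(ℝ, ℝ × ℝ) 1 (fun v : ℝ => ((0 : ℝ), v)) v :=
      (contDiff_const.prodMk contDiff_id).contDiffAt.contMDiffAt
    exact (ContMDiffAt.comp v (g := X) (f := fun v => ((0 : ℝ), v))
      ((hS.contMDiffAt (0, v) (hmem v hv)).of_le (by norm_num)) h2).contMDiffWithinAt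
  · exact (hX.inj 0 0 v (mem_Ioo_of_le hη (hmem v hv)) v' (mem_Ioo_of_le hη (hmem v' hv')) h).1
  · refine IsPositiveParamAt.velocity_ne_zero (ζ := fun v => pt 0 v) hp hd EventuallyEq.rfl ?_
    intro h
    simpa [dir] using congrArg (fun y : Plane => y 1) h
  · have e1 := IsPositiveParamAt.deriv_comp_eq (ζ := fun v => pt 0 v)
      (γ := fun v => planar X (pt 0 v)) hp (hβ2 _) hd EventuallyEq.rfl
    have e2 := IsPositiveParamAt.deriv_comp_eq (ζ := fun t => pt t 0) (γ := c) (t := 0) hp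
      (hβ2 _) (hasDerivAt_axis 0) (eventuallyEq_axis hX 0)
    rw [e1, e2, real_inner_comm]
    exact hF
  · rintro s ⟨v, hv, h⟩
    rw [← hX.axis s] at h
    obtain ⟨rfl, -⟩ := hX.inj 0 s v (mem_Ioo_of_le hη (hmem v hv)) 0 h0 h
    rw [← hX.axis s, ← hX.axis 0]
    exact h.symm

/-- The return map of the axis of the strip on the transversal `v ↦ X (0, v)`. -/
theorem exists_isReturnMap [IsManifold (𝓡 2) ∞ M] [OrientedAtlas M] {α : M → Space}
    (hX : IsAdaptedChart k α c L η X) (hη : η₀ ≤ η) (hL : 0 < L)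
    (hS : IsSmoothStrip 3 X η₀) (hβ : IsImmersionOfClass 3 β)
    (ht : ∀ s, IsTransverseAt β X η₀ (pt s 0))
    (h0 : ∀ s, slope (β ∘ planar X) (pt s 0) = 0)
    (hF : firstForm (β ∘ planar X) (pt 0 0) (dir 0) (dir 1) = 0) :
    ∃ (a : ℝ) (σ : ℝ → M) (π : ℝ → ℝ), IsCrossSection β c a σ ∧
      IsReturnMap .maximal β c a σ π ∧
      HasDerivAt π (Real.exp (∫ t in (0)..L,
        fderiv ℝ (slope (β ∘ planar X)) (pt t 0) (dir 1))) 0 := by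
  have hβ2 := hβ.contMDiff_two_of_three
  set Q := β ∘ planar X with hQ
  have hptc : Continuous fun z : ℝ × ℝ => pt z.1 z.2 := (contDiff_pt (n := 0)).continuous
  -- The interval exceeds one period on both sides, because a leaf has to be a harmonic line on an
  -- open set containing `[0, L]`.
  have hcomp : ∀ᶠ v in 𝓝 (0 : ℝ), ∀ t ∈ Icc (-1) (L + 1), IsTransverseAt β X η₀ (pt t v) := by
    refine isCompact_Icc.eventually_forall_of_forall_eventually fun t _ => ?_
    have h1 : Tendsto (fun z : ℝ × ℝ => pt z.2 z.1) (𝓝 (0, t)) (𝓝 (pt t 0)) :=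
      (hptc.comp continuous_swap).continuousAt
    exact h1.eventually (eventually_isTransverseAt hS hβ (ht t))
  obtain ⟨b, hb, hball⟩ := Metric.eventually_nhds_iff.1 hcomp
  set a := b / 2 with ha
  have ha0 : 0 < a := by positivity
  have hgood : ∀ t ∈ Icc (-1) (L + 1), ∀ v ∈ Icc (-a) a, IsTransverseAt β X η₀ (pt t v) := by
    intro t ht v hv
    refine hball ?_ t ht
    rw [Real.dist_eq, sub_zero]
    have := abs_le.2 hv
    linarith
  have haη : a < η₀ := by
    have := (hgood 0 ⟨by norm_num, by linarith⟩ a ⟨by linarith, le_rfl⟩).mem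
    simpa using this.2
  have hsl (t : ℝ) (ht : t ∈ Icc (-1) (L + 1)) (v : ℝ) (hv : v ∈ Icc (-a) a) :
      ContDiffAt ℝ 1 (slope Q) (pt t v) := (hgood t ht v hv).contDiffAt_slope hS hβ
  obtain ⟨π, hπ, hret⟩ := exists_return_map (F := fun t v => slope Q (pt t v))
    (F' := fun t v => fderiv ℝ (slope Q) (pt t v) (dir 1)) hL ha0
    (fun z hz => (ContinuousAt.comp (f := fun z : ℝ × ℝ => pt z.1 z.2)
      (hsl z.1 hz.1 z.2 hz.2).continuousAt hptc.continuousAt).continuousWithinAt)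
    (fun z hz => (ContinuousAt.comp (g := fun y => fderiv ℝ (slope Q) y (dir 1))
      (f := fun z : ℝ × ℝ => pt z.1 z.2)
      (((hsl z.1 hz.1 z.2 hz.2).fderiv_right (m := 0) (by norm_num)).continuousAt.clm_apply
        continuousAt_const) hptc.continuousAt).continuousWithinAt)
    (fun t ht v hv => ((hsl t ht v hv).differentiableAt
      one_ne_zero).hasFDerivAt.comp_hasDerivAt v (hasDerivAt_line t v)) (fun t _ => h0 t)
  refine ⟨a, fun v => planar X (pt 0 v), π,
    isCrossSection_transversal hX hη hS hβ (ht 0).param hF ha0 haη, ?_, hπ⟩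
  -- At `v = 0` the slope is zero and the inner product is `I(∂/∂s, ∂/∂s) > 0`; by continuity nearby
  -- leaves start in the direction of `c`.
  have hdir : ∀ᶠ v in 𝓝 (0 : ℝ),
      0 < inner ℝ (fderiv ℝ Q (pt 0 v) (pt 1 (slope Q (pt 0 v)))) (fderiv ℝ Q (pt 0 0) (dir 0)) := by
    have hline : ContinuousAt (fun v => pt 0 v) 0 := (hasDerivAt_line 0 0).continuousAt
    have hQ2 := (ht 0).param.contDiffAt_comp (hβ2 _)
    have c1 : ContinuousAt (fun y => fderiv ℝ Q y (pt 1 (slope Q y))) (pt 0 0) :=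
      (hQ2.fderiv_right (m := 1) (by norm_num)).continuousAt.clm_apply
        (contDiffAt_pt_one ((ht 0).contDiffAt_slope hS hβ)).continuousAt
    have c2 : ContinuousAt (fun v => inner ℝ (fderiv ℝ Q (pt 0 v) (pt 1 (slope Q (pt 0 v))))
        (fderiv ℝ Q (pt 0 0) (dir 0))) 0 :=
      (ContinuousAt.comp (f := fun v => pt 0 v) (g := fun y => fderiv ℝ Q y (pt 1 (slope Q y)))
        c1 hline).inner continuousAt_const
    refine c2.eventually (lt_mem_nhds ?_)
    have e : pt 1 0 = dir 0 := by rw [pt_eq]; simp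
    beta_reduce
    rw [h0, e]
    exact firstForm_pos ((ht 0).param.injective_fderiv (hβ2 _) (hβ.2 _)) dir_zero_ne_zero
  filter_upwards [hret, hdir] with v hv hv'
  obtain ⟨φ, J, hJo, hJ, hJs, hφ0, hφL, hφ⟩ := hv
  have hJ0 : (0 : ℝ) ∈ J := hJ ⟨le_rfl, hL.le⟩
  have hJL : L ∈ J := hJ ⟨hL.le, le_rfl⟩
  have hT : ∀ t ∈ J, IsTransverseAt β X η₀ (pt t (φ t)) := fun t ht =>
    hgood t (Ioo_subset_Icc_self (hJs ht)) _ (Ioo_subset_Icc_self (hφ t ht).1)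
  refine ⟨L, J, fun t => planar X (pt t (φ t)), hL, hJo, hJ,
    isHarmonicLineOn_graph hS hβ hJo fun t ht => ⟨hT t ht, (hφ t ht).2⟩, by simp only [hφ0], ?_, ?_,
    hφL ▸ Ioo_subset_Icc_self (hφ L hJL).1, ?_⟩
  · have e1 := IsPositiveParamAt.deriv_comp_eq (f := β) (ζ := fun t => pt t (φ t))
      (γ := fun t => planar X (pt t (φ t))) (t := 0) (hT 0 hJ0).param (hβ2 _)
      (hasDerivAt_pt (hasDerivAt_id 0) (hφ 0 hJ0).2) EventuallyEq.rfl
    have e2 := IsPositiveParamAt.deriv_comp_eq (f := β) (ζ := fun t => pt t 0) (γ := c) (t := 0)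
      (ht 0).param (hβ2 _) (hasDerivAt_axis 0) (eventuallyEq_axis hX 0)
    rw [e1, e2, hφ0]
    exact hv'
  · rintro t ht ⟨w, hw, h⟩
    have htJ := hJ (Ioo_subset_Icc_self ht)
    obtain ⟨-, m, hm⟩ := hX.inj 0 t w
      (mem_Ioo_of_le hη ⟨by linarith [hw.1], by linarith [hw.2]⟩) (φ t)
      (mem_Ioo_of_le hη (hT t htJ).mem) h
    rw [zero_add] at hm
    have h1 : (0 : ℝ) < m := by
      by_contra! h
      nlinarith [ht.1]
    have h2 : (m : ℝ) < 1 := by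
      by_contra! h
      nlinarith [ht.2]
    have h1' : 0 < m := by exact_mod_cast h1
    have h2' : m < 1 := by exact_mod_cast h2
    omega
  · rw [← hφL]
    simpa using (hX.periodic 0 (φ L) (mem_Ioo_of_le hη (hT L hJL).mem))

end HarmonicMC

namespace HarmonicMC

variable {M : Type*} [TopologicalSpace M] [ChartedSpace Plane M]

/-! ### Hyperbolicity of the perturbed cycle -/

theorem IsSmoothStrip.of_le {n n' : ℕ} {X : ℝ × ℝ → M} {η₀ : ℝ} (hS : IsSmoothStrip n X η₀)
    (h : n' ≤ n) : IsSmoothStrip n' X η₀ := by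
  have h' : (n' : WithTop ℕ∞) ≤ n := by exact_mod_cast h
  refine ⟨fun x hx => (hS.contMDiffAt x hx).of_le h', fun x hx => ?_⟩
  obtain ⟨ψ, h1, h2⟩ := hS.exists_inverse x hx
  exact ⟨ψ, h1.of_le h', h2⟩

theorem IsImmersionOfClass.of_le {n n' : ℕ} {f : M → Space} (hf : IsImmersionOfClass n f)
    (h : n' ≤ n) : IsImmersionOfClass n' f :=
  ⟨hf.1.of_le (by exact_mod_cast h), hf.2⟩

section Axis

variable {n : ℕ} {α β : M → Space} {c : ℝ → M} {L ε : ℝ} {k : ℕ} {η η₀ : ℝ} {X : ℝ × ℝ → M}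
  {m : ℝ → Space} [IsManifold (𝓡 2) ∞ M] [OrientedAtlas M] (hn : 3 ≤ n)
  (hα : IsImmersionOfClass (n + 2) α) (hc : IsHarmonicCycle .maximal α c L)
  (hX : IsAdaptedChart k α c L η X) (hη : 0 < η₀) (hS : IsSmoothStrip n X η₀)
  (hβ : IsImmersionOfClass n β) (hm : ContDiff ℝ 3 m)
  (hQ : ∀ s, β ∘ planar X =ᶠ[𝓝 (pt s 0)] fun y => (α ∘ planar X) y + ε • axisPow 3 m y)

include hn hα hc hX hη hS hm hQ in
theorem harmonicCoeff_zero_zero_perturbation (s : ℝ) :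
    harmonicCoeff (β ∘ planar X) 0 0 (pt s 0) = 0 := by
  obtain ⟨h1, h2⟩ := jet_axis hn hα hη hS hm hQ s
  rw [harmonicCoeff_of_jet h1 h2, harmonicCoeff_axis (by omega) hα hc hX hη hS]

include hn hα hc hX hη hS hm hQ in
theorem harmonicCoeff_zero_one_perturbation (s : ℝ) :
    harmonicCoeff (β ∘ planar X) 0 1 (pt s 0) = geodesicTorsion α c s := by
  obtain ⟨h1, h2⟩ := jet_axis hn hα hη hS hm hQ s
  rw [harmonicCoeff_of_jet h1 h2, harmonicCoeff, secondForm_axis (by omega) hα hc hX hη hS,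
    (firstForm_axis (by omega) hα hc hX hη hS s).2.1, mul_zero, sub_zero]

include hn hα hc hX hη hS hβ hm hQ in
theorem isTransverseAt_perturbation (s : ℝ) : IsTransverseAt β X η₀ (pt s 0) := by
  have hn2 : 2 ≤ n := by omega
  have hβ2 : ContMDiff (𝓡 2) 𝓘(ℝ, Space) 2 β := hβ.1.of_le (by exact_mod_cast hn2)
  obtain ⟨h1, h2⟩ := jet_axis hn hα hη hS hm hQ s
  have hY := isPositiveParamAt_axis hn2 hα hc hX hη hS s
  have hb : 0 < geodesicTorsion α c s := hc.line.torsion_sign s (mem_univ s)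
  have h0 := harmonicCoeff_zero_zero_perturbation hn hα hc hX hη hS hm hQ s
  have h01 := harmonicCoeff_zero_one_perturbation hn hα hc hX hη hS hm hQ s
  refine ⟨by simpa using hη, hY, ?_, ?_, by rwa [h01], harmonicDisc_pos h0 (by rwa [h01]), ?_⟩
  · rw [patchGauss_of_jet h1 h2, patchGauss_axis hn2 hα hc hX hη hS]
    exact hc.line.elliptic s (mem_univ s)
  · rw [patchGauss_of_jet h1 h2, patchMean_of_jet h1 h2, patchGauss_axis hn2 hα hc hX hη hS,
      patchMean_axis hn2 hα hc hX hη hS]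
    exact hc.line.nonumbilic s (mem_univ s)
  · have e : pt 1 0 = dir 0 := by rw [pt_eq]; simp
    have := (isHarmonicCycle_perturbation hn hα hc hX hη hS hβ hm hQ).line.torsion_sign s
      (mem_univ s)
    change 0 < geodesicTorsion _ _ _ at this
    rw [hY.geodesicTorsion_eq (ζ := fun t => pt t 0) (hβ2 _) (hβ.2 _) (hasDerivAt_axis s)
      (eventuallyEq_axis hX s)] at this
    rwa [slope_eq_zero h0, e]

include hn hα hc hX hη hS in
theorem isTransverseAt_axis (s : ℝ) : IsTransverseAt α X η₀ (pt s 0) :=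
  -- The surface `α` is its own perturbation with `m = 0`.
  isTransverseAt_perturbation (m := fun _ => 0) (ε := 0) hn hα hc hX hη hS (hα.of_le (by omega))
    contDiff_const (fun s => by simp [Function.comp_def]) s

include hn hα hc hX hη hS hβ hm hQ in
-- The slope derivative is `-a_v / (2 τ_g)`. Only `a_v` feels the perturbation, and its decrease
-- contains the factor `𝒦/(2ℋ²)`.
theorem fderiv_slope_perturbation (s : ℝ) :
    fderiv ℝ (slope (β ∘ planar X)) (pt s 0) (dir 1) =
      fderiv ℝ (slope (α ∘ planar X)) (pt s 0) (dir 1) +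
        ε * (6 * inner ℝ (unitNormal α (c s)) (m s) / geodesicTorsion α c s *
          (gauss α (c s) / (4 * mean α (c s) ^ 2))) := by
  have hn2 : 2 ≤ n := by omega
  have hn3 : (3 : WithTop ℕ∞) ≤ n := by exact_mod_cast hn
  have hb : 0 < geodesicTorsion α c s := hc.line.torsion_sign s (mem_univ s)
  obtain ⟨h1, h2⟩ := jet_axis hn hα hη hS hm hQ s
  have hi := injective_fderiv_axis hn2 hα hc hX hη hS s
  have hH : patchMean (α ∘ planar X) (pt s 0) ≠ 0 := patchMean_ne_zero hi (by
    rw [patchGauss_axis hn2 hα hc hX hη hS]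
    exact hc.line.elliptic s (mem_univ s))
  have hP : ContDiffAt ℝ 3 (α ∘ planar X) (pt s 0) := (contDiffAt_axis hα hη hS s).of_le hn3
  have hP' : ContDiffAt ℝ 3 (β ∘ planar X) (pt s 0) :=
    (hS.contDiffAt_comp_planar hβ.1 (by simpa using hη)).of_le hn3
  have a1 := harmonicCoeff_zero_zero_perturbation hn hα hc hX hη hS hm hQ s
  have a2 := harmonicCoeff_zero_one_perturbation hn hα hc hX hη hS hm hQ s
  have b1 := harmonicCoeff_axis hn2 hα hc hX hη hS s
  have b2 : harmonicCoeff (α ∘ planar X) 0 1 (pt s 0) = geodesicTorsion α c s := by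
    rw [← harmonicCoeff_of_jet h1 h2, a2]
  obtain ⟨hE, hF, hG⟩ := firstForm_axis hn2 hα hc hX hη hS s
  rw [fderiv_slope hP hi hH b1 (by rwa [b2]), fderiv_slope hP' (by rwa [h1])
    (by rwa [patchMean_of_jet h1 h2]) a1 (by rwa [a2]), a2, b2,
    fderiv_harmonicCoeff_perturbation hP hm (hQ s) hi hH hE hF hG b1,
    patchNormal_axis hn2 hα hc hX hη hS, patchGauss_axis hn2 hα hc hX hη hS,
    patchMean_axis hn2 hα hc hX hη hS]
  rw [patchMean_axis hn2 hα hc hX hη hS] at hH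
  field_simp
  ring

include hn hα hc hX hη hS in
theorem continuous_fderiv_slope_axis :
    Continuous fun s => fderiv ℝ (slope (α ∘ planar X)) (pt s 0) (dir 1) := by
  refine continuous_iff_continuousAt.2 fun s => ?_
  have h := (isTransverseAt_axis hn hα hc hX hη hS s).contDiffAt_slope (hS.of_le hn)
    (hα.of_le (by omega))
  exact ContinuousAt.comp (g := fun y => fderiv ℝ (slope (α ∘ planar X)) y (dir 1))
    (f := fun s => pt s 0) ((h.fderiv_right (m := 0) (by norm_num)).continuousAt.clm_apply
      continuousAt_const) (hasDerivAt_axis s).continuousAt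

include hn hα hc hX hη hS in
theorem continuous_curvature_axis :
    Continuous fun s => gauss α (c s) / (4 * mean α (c s) ^ 2) := by
  have hn2 : 2 ≤ n := by omega
  refine continuous_iff_continuousAt.2 fun s => ?_
  have hi := injective_fderiv_axis hn2 hα hc hX hη hS s
  have hH : patchMean (α ∘ planar X) (pt s 0) ≠ 0 := patchMean_ne_zero hi (by
    rw [patchGauss_axis hn2 hα hc hX hη hS]
    exact hc.line.elliptic s (mem_univ s))
  have hP : ContDiffAt ℝ (0 + 2) (α ∘ planar X) (pt s 0) :=
    (contDiffAt_axis hα hη hS s).of_le (by rw [zero_add]; exact_mod_cast hn2)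
  have cp : ContDiffAt ℝ 0 (fun s => pt s 0) s :=
    contDiff_pt.contDiffAt.comp s (contDiffAt_id.prodMk contDiffAt_const)
  have h1 := (ContDiffAt.patchGauss (y := fun s => pt s 0) hP hi cp).continuousAt
  have h2 := (ContDiffAt.patchMean (y := fun s => pt s 0) hP hi cp).continuousAt
  simp only [patchGauss_axis hn2 hα hc hX hη hS] at h1
  simp only [patchMean_axis hn2 hα hc hX hη hS] at h2 hH
  exact h1.div (continuousAt_const.mul (h2.pow 2)) (by positivity)

include hn hα hc hX hη hS in
theorem integral_curvature_pos :
    0 < ∫ s in (0)..L, gauss α (c s) / (4 * mean α (c s) ^ 2) := by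
  refine intervalIntegral.intervalIntegral_pos_of_pos
    ((continuous_curvature_axis hn hα hc hX hη hS).intervalIntegrable _ _) (fun s => ?_)
    hc.length_pos
  have h1 := hc.line.elliptic s (mem_univ s)
  have h2 : mean α (c s) ≠ 0 := by
    have hn2 : 2 ≤ n := by omega
    rw [← patchMean_axis hn2 hα hc hX hη hS]
    refine patchMean_ne_zero (injective_fderiv_axis hn2 hα hc hX hη hS s) ?_
    rwa [patchGauss_axis hn2 hα hc hX hη hS]
  positivity

include hn hα hc hX hη hS hβ hm hQ in
/-- The perturbed cycle is hyperbolic as soon as the logarithm of the derivative of its return map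
does not vanish. -/
theorem isHyperbolicCycle_perturbation (hη' : η₀ ≤ η) {μ : ℝ}
    (hmN : ∀ s, 6 * inner ℝ (unitNormal α (c s)) (m s) = μ * geodesicTorsion α c s)
    (hI : (∫ s in (0)..L, fderiv ℝ (slope (α ∘ planar X)) (pt s 0) (dir 1)) +
      ε * (μ * ∫ s in (0)..L, gauss α (c s) / (4 * mean α (c s) ^ 2)) ≠ 0) :
    IsHyperbolicCycle .maximal β c L := by
  have hn2 : 2 ≤ n := by omega
  obtain ⟨a, σ, π, hσ, hπ, hd⟩ := exists_isReturnMap hX hη' hc.length_pos (hS.of_le hn)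
    (hβ.of_le hn) (isTransverseAt_perturbation hn hα hc hX hη hS hβ hm hQ)
    (fun s => slope_eq_zero (harmonicCoeff_zero_zero_perturbation hn hα hc hX hη hS hm hQ s))
    (by rw [firstForm_of_jet (jet_axis hn hα hη hS hm hQ 0).1]
        exact (firstForm_axis hn2 hα hc hX hη hS 0).2.1)
  refine ⟨isHarmonicCycle_perturbation hn hα hc hX hη hS hβ hm hQ, a, σ, π, _, hσ, hπ, hd, ?_⟩
  -- The choice of `A₁` proportional to `τ_g` cancels the torsion in the denominator, so the
  -- exponent becomes the sum in `hI`.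
  rw [Ne, Real.exp_eq_one_iff]
  convert hI using 2
  rw [← intervalIntegral.integral_const_mul, ← intervalIntegral.integral_const_mul,
    ← intervalIntegral.integral_add
      ((continuous_fderiv_slope_axis hn hα hc hX hη hS).intervalIntegrable _ _)
      ((((continuous_curvature_axis hn hα hc hX hη hS).const_mul _).const_mul _).intervalIntegrable
        _ _)]
  refine intervalIntegral.integral_congr fun s _ => ?_
  have hb : 0 < geodesicTorsion α c s := hc.line.torsion_sign s (mem_univ s)
  rw [fderiv_slope_perturbation hn hα hc hX hη hS hβ hm hQ, hmN, mul_div_assoc, div_self hb.ne',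
    mul_one]

end Axis

end HarmonicMC

/-! ### Choice of the strip and of the bound on `ε`. -/

theorem proposition4 {M : Type*} [TopologicalSpace M] [T2Space M] [ChartedSpace Plane M]
    [IsManifold (𝓡 2) ∞ M] [OrientedAtlas M]
    (r : ℕ) (hr : 6 ≤ r) (α : M → Space) (hα : IsImmersionOfClass r α)
    (c : ℝ → M) (L : ℝ) (hc : IsHarmonicCycle .maximal α c L)
    (η : ℝ) (X : ℝ × ℝ → M) (hX : IsAdaptedChart (r - 5) α c L η X) :
    ∃ η₀ : ℝ, 0 < η₀ ∧ η₀ ≤ η ∧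
      ∀ δ : ℝ → ℝ, ContDiff ℝ r δ → (∀ᶠ v in 𝓝 (0 : ℝ), δ v = 1) →
        tsupport δ ⊆ Ioo (-η₀) η₀ →
      ∀ (μ : ℝ) (A₁ : ℝ → ℝ), 0 < μ → (∀ s, A₁ s = μ * geodesicTorsion α c s) →
      ∃ ε₀ : ℝ, 0 < ε₀ ∧ ∀ ε : ℝ, |ε| < ε₀ →
        IsImmersionOfClass (r - 2) (deformation α c η X A₁ δ ε) ∧
        IsHarmonicCycle .maximal (deformation α c η X A₁ δ ε) c L ∧
        (ε ≠ 0 → IsHyperbolicCycle .maximal (deformation α c η X A₁ δ ε) c L) := by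
  obtain ⟨n, rfl⟩ : ∃ n, r = n + 2 := ⟨r - 2, by omega⟩
  have hn2 : 2 ≤ n := by omega
  have hn3 : 3 ≤ n := by omega
  obtain ⟨η₀, hη₀, hη, hreg⟩ := hX.exists_regular hα hc hn2
  have hS : IsSmoothStrip n X η₀ := by
    have h (x : ℝ × ℝ) (hx : x.2 ∈ Ioo (-η₀) η₀) := hX.contMDiffAt_of_injective (by omega) hn2
      hα hc (mem_Ioo_of_le hη hx) (hreg x.1 x.2 hx)
    exact ⟨fun x hx => (h x hx).1, fun x hx => (h x hx).2⟩
  refine ⟨η₀, hη₀, hη, fun δ hδ hδ1 hδs μ A₁ hμ hA => ?_⟩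
  have hn0 : n ≠ 0 := by omega
  have hL := hc.length_pos
  have hA' : A₁ = fun s => μ * geodesicTorsion α c s := funext hA
  have hAp : Function.Periodic A₁ L := fun s => by rw [hA, hA, hc.periodic_torsion hα]
  have hAc : ContDiff ℝ n A₁ := by
    rw [hA']
    exact contDiff_const.mul (hc.contDiff_torsion hα hn0)
  have hN : ContDiff ℝ n fun s => unitNormal α (c s) :=
    (hc.contDiff_unitNormal hα hn0).of_le le_self_add
  have hb : ContDiff ℝ n (bump (fun s => unitNormal α (c s)) A₁ δ) :=
    contDiff_bump hN hAc (hδ.of_le (by exact_mod_cast (by omega : n ≤ n + 2)))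
  have hαn : IsImmersionOfClass n α := hα.of_le (by omega)
  obtain ⟨ε₁, hε₁, hinj⟩ := Metric.eventually_nhds_iff.1
    (eventually_injective_mfderiv_deformation hX hc.periodic hAp hη hδs hL hn0 hαn hS hb)
  set I₀ := ∫ s in (0)..L, fderiv ℝ (HarmonicMC.slope (α ∘ planar X)) (pt s 0) (dir 1)
  set I₁ := ∫ s in (0)..L, gauss α (c s) / (4 * mean α (c s) ^ 2)
  have hI₁ : 0 < I₁ := integral_curvature_pos hn3 hα hc hX hη₀ hS
  -- The exponent vanishes only at `ε = -I₀ / (μ I₁)`. Either this is `0`, which is excluded, or its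
  -- absolute value is the bound `ε₂`.
  obtain ⟨ε₂, hε₂, hI⟩ : ∃ ε₂ > 0, ∀ ε : ℝ, |ε| < ε₂ → ε ≠ 0 → I₀ + ε * (μ * I₁) ≠ 0 := by
    have h1 : 0 < μ * I₁ := mul_pos hμ hI₁
    by_cases h0 : I₀ = 0
    · refine ⟨1, one_pos, fun ε _ hε => ?_⟩
      rw [h0, zero_add]
      exact mul_ne_zero hε h1.ne'
    · refine ⟨|I₀| / (μ * I₁), div_pos (abs_pos.2 h0) h1, fun ε hε _ h => ?_⟩
      rw [lt_div_iff₀ h1] at hε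
      have h2 : I₀ = -(ε * (μ * I₁)) := by linarith
      rw [h2, abs_neg, abs_mul, abs_of_pos h1] at hε
      exact lt_irrefl _ hε
  refine ⟨min ε₁ ε₂, lt_min hε₁ hε₂, fun ε hε => ?_⟩
  have hβ : IsImmersionOfClass n (deformation α c η X A₁ δ ε) :=
    ⟨contMDiff_deformation hX hc.periodic hAp hη hδs hL hαn.1 hS hb ε,
      hinj (by rw [Real.dist_eq, sub_zero]; exact hε.trans_le (min_le_left _ _))⟩
  have hm : ContDiff ℝ 3 fun s => (A₁ s / 6) • unitNormal α (c s) :=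
    ((hAc.div_const 6).smul hN).of_le (by exact_mod_cast hn3)
  have hQ := deformation_comp_planar hX hc.periodic hAp hδ1 ε
  refine ⟨hβ, isHarmonicCycle_perturbation hn3 hα hc hX hη₀ hS hβ hm hQ, fun hε0 =>
    isHyperbolicCycle_perturbation hn3 hα hc hX hη₀ hS hβ hm hQ hη (μ := μ) (fun s => ?_)
      (hI ε (hε.trans_le (min_le_right _ _)) hε0)⟩
  rw [inner_smul_right, real_inner_self_eq_norm_sq,
    norm_unitNormal (hα.contMDiff_two.of_le one_le_two) hα.2, hA]
  ring
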